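/- Let $G=\mathrm{PGL}(2,\overline{\mathbb Q})$ and let $\mathcal C=\mathrm{Rep}(G)$ be the category of finite dimensional rational representations of $G$ (those whose matrix coefficients are regular functions on $G$). For a prime $p$, let $\overline{\mathbb Z}_p$ be the ring of integers of $\overline{\mathbb Q}_p$, with residue field $\overline{\mathbb F}_p$, and fix an embedding $\overline{\mathbb Q}\subset\overline{\mathbb Q}_p$. A *good reduction* modulo $p$ of a semisimple rigid tensor category $\mathcal C$ over $\overline{\mathbb Q}$ is a semisimple rigid tensor category $\mathcal C_p$ over $\overline{\mathbb F}_p$ with the same Grothendieck ring (as a ring with basis of simple objects) as $\mathcal C$, for which there are a semisimple rigid tensor category $\widetilde{\mathcal C}_p$ over $\overline{\mathbb Z}_p$ whose reduction modulo the maximal ideal is $\mathcal C_p$, and a tensor equivalence $\widetilde{\mathcal C}_p\otimes_{\overline{\mathbb Z}_p}\overline{\mathbb Q}_p\cong\mathcal C\otimes_{\overline{\mathbb Q}}\overline{\mathbb Q}_p$. (A semisimple category over $\overline{\mathbb Z}_p$ is one in which every object is a finite direct sum of objects $X_i$ with $\mathrm{Hom}(X_i,X_j)=\delta_{ij}\overline{\mathbb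 Z}_p$.) The prime $p$ is *bad* for $\mathcal C$ if no good reduction modulo $p$ exists. Let $X$ be the (3-dimensional) adjoint representation of $G$. For a nonzero morphism $m:X\otimes X\to X$ and an isomorphism $b:X\to X^*$, let $m_*:X\to X\otimes X$ be the dual of $m$, with $X^*$ identified with $X$ by $b$, and put $$A(T_2)=\mathrm{Tr}(m\,m_*),\qquad A(T_4)=\mathrm{Tr}\bigl(m(1\otimes m)(m_*\otimes 1)m_*\bigr),$$ the amplitudes of the planar trivalent graphs $T_2$ (2 vertices, 3 edges) and $T_4$ (a square with its diagonals). Then: 1. $\mathcal C$ is a semisimple rigid tensor category over $\overline{\mathbb Q}$. Its simple objects are, up to isomorphism, $V_{2m}$, $m=0,1,2,\dots$, with $\dim V_{2m}=2m+1$. In particular every odd prime divides the dimension of some simple object. 2. The morphism $m:X\otimes X\to X$ and the pairing $X\otimes X\to\mathbf 1$ (equivalently, $b$) exist and are unique up to scaling. For every nonzero $m$ and every isomorphism $b$ one has $A(T_2)\neq 0$ and $A(T_4)=\tfrac16A(T_2)^2$. For every $b$ there is an $m$ with $m\,m_*=\mathrm{id}_X$, and for every such $m$ one has $A(T_2)=\dim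 X=3$ and $A(T_4)=3/2$, a number that does not lie in $\overline{\mathbb Z}_2$. 3. Every prime $p$ (including $p=2$) is bad for $\mathcal C$, for every embedding $\overline{\mathbb Q}\subset\overline{\mathbb Q}_p$. -/

import Mathlib

open CategoryTheory MonoidalCategory Limits
open scoped MatrixGroups TensorProduct

/-! ### Tensor categories over a commutative ring -/

section TensorCategories

universe v u v' u'

/-- `X : I → C` is a complete irredundant list of simple objects of the `R`-linear category `C`:
`Hom(X i, X i) = R`, `Hom(X i, X j) = 0` for `i ≠ j`, and each object is a finite direct sum of
objects of the list. -/
structure IsSimpleBasis (R : Type*) [CommRing R] {C : Type u} [Category.{v} C] [Preadditive C]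
    [Linear R C] {I : Type*} (X : I → C) : Prop where
  end_scalar : ∀ i, Function.Bijective (fun r : R => r • 𝟙 (X i))
  hom_zero : ∀ i j, i ≠ j → ∀ f : X i ⟶ X j, f = 0
  directSum : ∀ Y : C, ∃ (n : ℕ) (s : Fin n → I) (b : Bicone (fun a => X (s a))),
    Nonempty b.IsBilimit ∧ Nonempty (b.pt ≅ Y)

/-- The `R`-linear monoidal category `C` is a (split) semisimple rigid tensor category over `R`.
Over an algebraically closed field this is the usual notion: a semisimple abelian category with
finite dimensional `Hom` spaces (so that `End` of a simple object consists of scalars), with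
bilinear tensor product, left and right duals, and `End(𝟙) = R`. Over a local ring `R` it is
the usual notion of a lift to `R` of such a category: the `Hom` modules are
free of finite rank, with objects and `Hom`s as in the semisimple case. -/
structure IsSemisimpleTensorCategory (R : Type*) [CommRing R] (C : Type u) [Category.{v} C]
    [Preadditive C] [Linear R C] [MonoidalCategory C] [MonoidalPreadditive C]
    [MonoidalLinear R C] : Prop where
  hasFiniteBiproducts : HasFiniteBiproducts C
  exists_simpleBasis : ∃ (I : Type u) (X : I → C), IsSimpleBasis R X
  end_unit : Function.Bijective (fun r : R => r • 𝟙 (𝟙_ C))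
  exists_rightDual : ∀ X : C, ∃ Y : C, Nonempty (ExactPairing X Y)
  exists_leftDual : ∀ X : C, ∃ Y : C, Nonempty (ExactPairing Y X)

/-- The semisimple tensor categories `C` (over `k`) and `D` (over `l`) have the same Grothendieck
ring: their simple objects can be listed by the same set, with the unit objects in the same place
and with the same multiplicities in tensor products. -/
def SameGrothendieckRing (k : Type*) [Field k] (l : Type*) [Field l]
    (C : Type u) [Category.{v} C] [Preadditive C] [Linear k C] [MonoidalCategory C]
    (D : Type u') [Category.{v'} D] [Preadditive D] [Linear l D] [MonoidalCategory D] : Prop :=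
  ∃ (I : Type u) (X : I → C) (Y : I → D) (i₀ : I),
    IsSimpleBasis k X ∧ IsSimpleBasis l Y ∧
    Nonempty (X i₀ ≅ 𝟙_ C) ∧ Nonempty (Y i₀ ≅ 𝟙_ D) ∧
    ∀ a b c : I, Module.finrank k (X c ⟶ X a ⊗ X b) = Module.finrank l (Y c ⟶ Y a ⊗ Y b)

/-- The `φ`-semilinear map `f : M → N` exhibits `N` as `S ⊗[R] M`, where `S` is an `R`-algebra
through `φ`. -/
def IsSemilinearBaseChange {R S : Type*} [CommRing R] [CommRing S] (φ : R →+* S)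
    {M N : Type*} [AddCommGroup M] [AddCommGroup N] [Module R M] [Module S N]
    (f : M →ₛₗ[φ] N) : Prop :=
  letI : Algebra R S := φ.toAlgebra
  letI : Module R N := Module.compHom N φ
  haveI : IsScalarTower R S N := ⟨fun r s x => mul_smul (φ r) s x⟩
  IsBaseChange S ({ toFun := f, map_add' := f.map_add, map_smul' := f.map_smulₛₗ } : M →ₗ[R] N)

/-- The functor `F : C ⥤ D` from an `R`-linear monoidal category to an `S`-linear one exhibits `D`
as the extension of scalars `C ⊗_R S` along `φ : R →+* S` (same objects up to isomorphism, and
`Hom`s tensored with `S`), as a tensor category. For `S` a quotient of `R`, this is the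
reduction of `C`. -/
structure IsScalarExtension {R S : Type*} [CommRing R] [CommRing S] (φ : R →+* S)
    {C : Type u} [Category.{v} C] [Preadditive C] [Linear R C] [MonoidalCategory C]
    {D : Type u'} [Category.{v'} D] [Preadditive D] [Linear S D] [MonoidalCategory D]
    (F : C ⥤ D) : Prop where
  monoidal : Nonempty F.Monoidal
  essSurj : F.EssSurj
  baseChange : ∀ X Y : C, ∃ l : (X ⟶ Y) →ₛₗ[φ] (F.obj X ⟶ F.obj Y),
    (∀ f, l f = F.map f) ∧ IsSemilinearBaseChange φ l

end TensorCategories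

/-! ### Good and bad primes -/

section GoodPrimes

universe v u v₀ u₀

/-- The field of algebraic numbers. -/
abbrev QBar : Type := AlgebraicClosure ℚ

/-- The ring of integers of the algebraic closure of `ℚ_[p]`, i.e. the elements of absolute value
at most `1`. -/
noncomputable abbrev PadicAlgClInt (p : ℕ) [Fact p.Prime] : ValuationSubring (PadicAlgCl p) :=
  (PadicAlgCl.valued p).v.valuationSubring

/-- The residue field of `PadicAlgClInt p`, an algebraic closure of the field with `p` elements. -/
abbrev FpBar (p : ℕ) [Fact p.Prime] : Type := IsLocalRing.ResidueField (PadicAlgClInt p)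

/-- `Cp` is a good reduction modulo `p` of the tensor category `C` over `QBar`, where `QBar` is
embedded by `ι` in the algebraic closure of `ℚ_[p]`. Here `Ct` is the lift of `Cp`, and `D` is the
common scalar extension of `Ct` and `C` to the algebraic closure of `ℚ_[p]`. -/
def IsGoodReduction (p : ℕ) [Fact p.Prime] (ι : QBar →+* PadicAlgCl p)
    (C : Type u₀) [Category.{v₀} C] [Preadditive C] [Linear QBar C] [MonoidalCategory C]
    (Cp : Type u) [Category.{v} Cp] [Preadditive Cp] [Linear (FpBar p) Cp] [MonoidalCategory Cp]
    [MonoidalPreadditive Cp] [MonoidalLinear (FpBar p) Cp] : Prop :=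
  IsSemisimpleTensorCategory (FpBar p) Cp ∧ SameGrothendieckRing QBar (FpBar p) C Cp ∧
  ∃ (Ct : Type u) (_ : Category.{v} Ct) (_ : Preadditive Ct) (_ : Linear (PadicAlgClInt p) Ct)
    (_ : MonoidalCategory Ct) (_ : MonoidalPreadditive Ct)
    (_ : MonoidalLinear (PadicAlgClInt p) Ct),
    IsSemisimpleTensorCategory (PadicAlgClInt p) Ct ∧
    (∃ F : Ct ⥤ Cp, IsScalarExtension (IsLocalRing.residue (PadicAlgClInt p)) F) ∧
    ∃ (D : Type u) (_ : Category.{v} D) (_ : Preadditive D) (_ : Linear (PadicAlgCl p) D)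
      (_ : MonoidalCategory D) (_ : MonoidalPreadditive D) (_ : MonoidalLinear (PadicAlgCl p) D)
      (G : Ct ⥤ D) (H : C ⥤ D),
      IsScalarExtension (PadicAlgClInt p).subtype G ∧ IsScalarExtension ι H

/-- `p` is a good prime for `C` if `C` has a good reduction modulo `p`. -/
def IsGoodPrime (p : ℕ) [Fact p.Prime] (ι : QBar →+* PadicAlgCl p)
    (C : Type u₀) [Category.{v₀} C] [Preadditive C] [Linear QBar C] [MonoidalCategory C] : Prop :=
  ∃ (Cp : Type u) (_ : Category.{v} Cp) (_ : Preadditive Cp) (_ : Linear (FpBar p) Cp)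
    (_ : MonoidalCategory Cp) (_ : MonoidalPreadditive Cp) (_ : MonoidalLinear (FpBar p) Cp),
    IsGoodReduction.{v, u} p ι C Cp

/-- `p` is a bad prime for `C` if it is not good. -/
def IsBadPrime (p : ℕ) [Fact p.Prime] (ι : QBar →+* PadicAlgCl p)
    (C : Type u₀) [Category.{v₀} C] [Preadditive C] [Linear QBar C] [MonoidalCategory C] : Prop :=
  ¬ IsGoodPrime.{v, u} p ι C

end GoodPrimes

/-! ### Amplitudes of planar trivalent graphs -/

section Amplitudes

universe v u

variable {C : Type u} [Category.{v} C] [MonoidalCategory C] {X : C} [ExactPairing X X]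

/-- The trace of an endomorphism of a self-dual object `X`. The instance `ExactPairing X X`
is the identification `b` of `X` with its dual. -/
def selfDualTrace (f : X ⟶ X) : 𝟙_ C ⟶ 𝟙_ C :=
  η_ X X ≫ f ▷ X ≫ ε_ X X

/-- The map `m_* : X ⟶ X ⊗ X` obtained from the dual `X* ⟶ (X ⊗ X)* = X* ⊗ X*` of `m` by
identifying `X*` with `X`. -/
def dualMul (m : X ⊗ X ⟶ X) : X ⟶ X ⊗ X :=
  @rightAdjointMate C _ _ (X ⊗ X) X
    { rightDual := X ⊗ X, exact := ExactPairing.tensor } { rightDual := X } m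

/-- The amplitude of the theta graph (two vertices, three edges). -/
def amplitudeT₂ (m : X ⊗ X ⟶ X) : 𝟙_ C ⟶ 𝟙_ C :=
  selfDualTrace (dualMul m ≫ m)

/-- The amplitude of the complete graph on four vertices:
`Tr (m (1 ⊗ m) (m_* ⊗ 1) m_*)`. -/
def amplitudeT₄ (m : X ⊗ X ⟶ X) : 𝟙_ C ⟶ 𝟙_ C :=
  selfDualTrace (dualMul m ≫ dualMul m ▷ X ≫ (α_ X X X).hom ≫ X ◁ m ≫ m)

end Amplitudes

/-! ### Rational representations of `PGL(2, k)` -/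

section RationalRepresentations

variable (k : Type) [Field k]

/-- `φ` is a regular function on the algebraic group `PGL(2)` (over an algebraically closed field
`k`): as a function on `GL(2)`, it is a polynomial in the entries divided by a power of the
determinant. -/
def IsRegularFun (φ : PGL(2, k) → k) : Prop :=
  ∃ (P : MvPolynomial (Fin 2 × Fin 2) k) (n : ℕ), ∀ g : GL (Fin 2) k,
    φ (Matrix.ProjGenLinGroup.mk g) * (g : Matrix (Fin 2) (Fin 2) k).det ^ n =
      MvPolynomial.eval (fun ij => (g : Matrix (Fin 2) (Fin 2) k) ij.1 ij.2) P

/-- A finite dimensional representation is rational if its matrix coefficients are regular. -/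
def isRational : ObjectProperty (FDRep k PGL(2, k)) := fun V =>
  ∀ (f : Module.Dual k V) (v : V), IsRegularFun k (fun g => f (V.ρ g v))

variable {k}

theorem IsRegularFun.const (c : k) : IsRegularFun k (fun _ => c) :=
  ⟨MvPolynomial.C c, 0, by simp⟩

theorem IsRegularFun.mul {φ ψ : PGL(2, k) → k} (hφ : IsRegularFun k φ) (hψ : IsRegularFun k ψ) :
    IsRegularFun k (fun g => φ g * ψ g) := by
  obtain ⟨P, n, hP⟩ := hφ
  obtain ⟨Q, m, hQ⟩ := hψ
  refine ⟨P * Q, n + m, fun g => ?_⟩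
  rw [map_mul, ← hP, ← hQ]
  ring

theorem IsRegularFun.add {φ ψ : PGL(2, k) → k} (hφ : IsRegularFun k φ) (hψ : IsRegularFun k ψ) :
    IsRegularFun k (fun g => φ g + ψ g) := by
  obtain ⟨P, n, hP⟩ := hφ
  obtain ⟨Q, m, hQ⟩ := hψ
  let d : MvPolynomial (Fin 2 × Fin 2) k :=
    .X (0, 0) * .X (1, 1) - .X (0, 1) * .X (1, 0)
  refine ⟨P * d ^ m + Q * d ^ n, n + m, fun g => ?_⟩
  have hd : MvPolynomial.eval (fun ij => (g : Matrix (Fin 2) (Fin 2) k) ij.1 ij.2) d =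
      (g : Matrix (Fin 2) (Fin 2) k).det := by
    simp [d, Matrix.det_fin_two]
  rw [map_add, map_mul, map_mul, map_pow, map_pow, hd, ← hP, ← hQ]
  ring

theorem IsRegularFun.sum {ι : Type*} (s : Finset ι) {φ : ι → PGL(2, k) → k}
    (h : ∀ i ∈ s, IsRegularFun k (φ i)) : IsRegularFun k (fun g => ∑ i ∈ s, φ i g) := by
  classical
  induction s using Finset.induction_on with
  | empty => simpa using IsRegularFun.const (0 : k)
  | insert a s ha ih =>
    simp only [Finset.sum_insert ha]
    exact (h a (Finset.mem_insert_self a s)).add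
      (ih fun i hi => h i (Finset.mem_insert_of_mem hi))

instance isRational_isMonoidal : (isRational k).IsMonoidal where
  prop_unit := fun f v => IsRegularFun.const (f v)
  prop_tensor V W hV hW := by
    have key : ∀ (f : Module.Dual k (TensorProduct k V W)) (x : TensorProduct k V W),
        IsRegularFun k (fun g => f (TensorProduct.map (V.ρ g) (W.ρ g) x)) := by
      intro f x
      induction x using TensorProduct.induction_on with
      | zero => simpa using IsRegularFun.const (0 : k)
      | add x y hx hy => simpa only [map_add] using hx.add hy
      | tmul v w =>
        let b := Module.finBasis k V
        have h : (fun g => f (TensorProduct.map (V.ρ g) (W.ρ g) (v ⊗ₜ w))) = fun g =>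
            ∑ i, b.coord i (V.ρ g v) *
              (f ∘ₗ TensorProduct.mk k V W (b i)) (W.ρ g w) := by
          funext g
          rw [TensorProduct.map_tmul]
          conv_lhs => rw [← b.sum_repr (V.ρ g v)]
          rw [TensorProduct.sum_tmul, map_sum]
          refine Finset.sum_congr rfl fun i _ => ?_
          exact map_smul (f ∘ₗ (TensorProduct.mk k V W).flip (W.ρ g w)) _ (b i)
        rw [h]
        exact IsRegularFun.sum _ fun i _ => (hV _ v).mul (hW _ w)
    exact fun f x => key f x

variable (k)

/-- The tensor category `Rep(PGL(2))` of rational representations of the algebraic group `PGL(2)`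
over an algebraically closed field `k`. -/
abbrev RepPGL₂ : Type 1 := (isRational k).FullSubcategory

variable {k}

/-- The dimension of a rational representation. -/
noncomputable def repDim (V : RepPGL₂ k) : ℕ := Module.finrank k V.obj

variable (k)

/-- The space of the adjoint representation: traceless matrices, which form the Lie algebra of
`PGL(2)` when the characteristic of `k` is not two. -/
abbrev TracelessMatrix : Type := LinearMap.ker (Matrix.traceLinearMap (Fin 2) k k)

/-- The action of `GL(2)` on traceless matrices by conjugation. -/
def adjointGL : Representation k (GL (Fin 2) k) (TracelessMatrix k) where
  toFun g :=
    { toFun := fun A => ⟨(g : Matrix (Fin 2) (Fin 2) k) * A.1 *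
        ((g⁻¹ : GL (Fin 2) k) : Matrix (Fin 2) (Fin 2) k), by
          have hA : Matrix.trace A.1 = 0 := A.2
          rw [LinearMap.mem_ker, Matrix.traceLinearMap_apply, Matrix.trace_mul_comm,
            ← Matrix.mul_assoc, ← Units.val_mul, inv_mul_cancel, Units.val_one, Matrix.one_mul, hA]⟩
      map_add' := fun A B => by ext1; simp [Matrix.mul_add, Matrix.add_mul]
      map_smul' := fun c A => by ext1; simp }
  map_one' := by ext1 A; ext1; simp
  map_mul' g h := by ext1 A; ext1; simp [Matrix.mul_assoc]

/-- The adjoint representation of `PGL(2)`. -/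
def adjointPGL : Representation k PGL(2, k) (TracelessMatrix k) :=
  QuotientGroup.lift (Subgroup.center (GL (Fin 2) k)) (adjointGL k) (by
    intro z hz
    rw [Matrix.GeneralLinearGroup.center_eq_range_scalar] at hz
    obtain ⟨u, rfl⟩ := hz
    ext1 A
    ext1
    have hc : ((Matrix.GeneralLinearGroup.scalar (Fin 2) u : GL (Fin 2) k) :
        Matrix (Fin 2) (Fin 2) k) * A.1 =
        A.1 * ((Matrix.GeneralLinearGroup.scalar (Fin 2) u : GL (Fin 2) k) :
          Matrix (Fin 2) (Fin 2) k) :=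
      Matrix.scalar_commute (u : k) (fun r => mul_comm _ _) A.1
    change _ * A.1 * _ = A.1
    rw [hc, Matrix.mul_assoc, ← Units.val_mul, mul_inv_cancel, Units.val_one, Matrix.mul_one])

theorem adjointPGL_mk (g : GL (Fin 2) k) (A : TracelessMatrix k) :
    ((adjointPGL k (Matrix.ProjGenLinGroup.mk g) A : TracelessMatrix k) :
      Matrix (Fin 2) (Fin 2) k) = (g : Matrix (Fin 2) (Fin 2) k) * A.1 *
        ((g⁻¹ : GL (Fin 2) k) : Matrix (Fin 2) (Fin 2) k) := rfl

theorem isRational_adjoint : isRational k (FDRep.of (adjointPGL k)) := by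
  have entry : ∀ (A : TracelessMatrix k) (i j : Fin 2),
      IsRegularFun k (fun g => (adjointPGL k g A).1 i j) := by
    intro A i j
    let M : Matrix (Fin 2) (Fin 2) (MvPolynomial (Fin 2 × Fin 2) k) :=
      Matrix.mvPolynomialX (Fin 2) (Fin 2) k
    let N : Matrix (Fin 2) (Fin 2) (MvPolynomial (Fin 2 × Fin 2) k) :=
      M * A.1.map MvPolynomial.C * M.adjugate
    refine ⟨N i j, 1, fun g => ?_⟩
    let e : MvPolynomial (Fin 2 × Fin 2) k →+* k :=
      MvPolynomial.eval (fun ij => (g : Matrix (Fin 2) (Fin 2) k) ij.1 ij.2)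
    have hM : e.mapMatrix M = (g : Matrix (Fin 2) (Fin 2) k) := by
      ext a b
      simp [e, M]
    have hA : e.mapMatrix (A.1.map MvPolynomial.C) = A.1 := by
      ext a b
      simp [e]
    have hadj : (g : Matrix (Fin 2) (Fin 2) k).det •
        ((g⁻¹ : GL (Fin 2) k) : Matrix (Fin 2) (Fin 2) k) =
          (g : Matrix (Fin 2) (Fin 2) k).adjugate := by
      have h1 := Matrix.adjugate_mul (g : Matrix (Fin 2) (Fin 2) k)
      have h2 : (g : Matrix (Fin 2) (Fin 2) k) *
          ((g⁻¹ : GL (Fin 2) k) : Matrix (Fin 2) (Fin 2) k) = 1 := by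
        rw [← Units.val_mul, mul_inv_cancel, Units.val_one]
      rw [← Matrix.mul_one (g : Matrix (Fin 2) (Fin 2) k).adjugate, ← h2, ← Matrix.mul_assoc, h1,
        Matrix.smul_mul, Matrix.one_mul]
    have he : e (N i j) = e.mapMatrix N i j := rfl
    have hN : e.mapMatrix N = e.mapMatrix M * e.mapMatrix (A.1.map MvPolynomial.C) *
        (e.mapMatrix M).adjugate := by
      rw [← RingHom.map_adjugate, ← map_mul, ← map_mul]
    change ((adjointPGL k (Matrix.ProjGenLinGroup.mk g) A : TracelessMatrix k) :
      Matrix (Fin 2) (Fin 2) k) i j * _ = e _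
    rw [he, hN, hM, hA, adjointPGL_mk, ← hadj,
      Matrix.mul_smul, Matrix.smul_apply, smul_eq_mul, pow_one, mul_comm]
  intro f A
  obtain ⟨F, hF⟩ := LinearMap.exists_extend
    (p := LinearMap.ker (Matrix.traceLinearMap (Fin 2) k k)) f
  have h : (fun g => f (adjointPGL k g A)) = fun g => ∑ i, ∑ j,
      (adjointPGL k g A).1 i j * F (Matrix.single i j 1) := by
    funext g
    have h1 : f (adjointPGL k g A) = F (adjointPGL k g A).1 := by rw [← hF]; rfl
    rw [h1]
    conv_lhs => rw [Matrix.matrix_eq_sum_single (adjointPGL k g A).1]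
    simp only [map_sum]
    refine Finset.sum_congr rfl fun i _ => Finset.sum_congr rfl fun j _ => ?_
    rw [← smul_eq_mul, ← map_smul, Matrix.smul_single, smul_eq_mul, mul_one]
  change IsRegularFun k (fun g => f (adjointPGL k g A))
  rw [h]
  exact IsRegularFun.sum _ fun i _ => IsRegularFun.sum _ fun j _ =>
    (entry A i j).mul (IsRegularFun.const _)

/-- The adjoint representation as an object of `Rep(PGL(2))`. -/
noncomputable def adjointRep : RepPGL₂ k := ⟨FDRep.of (adjointPGL k), isRational_adjoint k⟩

end RationalRepresentations

-- Universes in which the good reductions are allowed to live.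
universe w₁ w₂

/-! Complete reducibility comes from highest weights. On a nonzero rational representation `V` the
torus acts through a Laurent polynomial in `t`. Its top coefficient is a projection; conjugating
unipotents by the torus shows that the vectors in its image are fixed by the upper unipotents, and
the functionals factoring through it by the lower ones (`IsRationalRep.exists_highest_weight`). A
vector and a functional of this kind, with value 1 on each other, give equivariant maps `B* → V → B`
with nonzero composite, where `B` is the space of binary forms of some even degree `2j`, realized as
functions on the group induced from a character of the lower triangular subgroup
(`IsRationalRep.exists_maps`). In characteristic zero the binomial coefficients are invertible,
which makes `B` self-dual with only scalar endomorphisms. So `B` splits off from `V`, and induction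
on the dimension decomposes `V`.

Every prime is bad because some scalars of the category would have to be integral. In a semisimple
lift over the ring of integers, a simple object `Z` with a nonzero map to `A ⊗ A` is a direct
summand of it integrally: there are `i : Z ⟶ A ⊗ A` and `r : A ⊗ A ⟶ Z` with `i ≫ r = 𝟙`. An
endomorphism of the simple object `A` composed from `i` and `r` is then an integral scalar. If it
does not change when `i` and `r` are multiplied by inverse scalars, and the `Hom` spaces are lines,
this scalar can be computed in `Rep(PGL(2))`.

For an odd prime `p = 2j + 1`, take `A` of dimension `p` and `Z` the unit: the zigzag of the
normalized pairing and copairing is `1/p` up to sign (`exists_zigzag_eq`). All simple dimensions are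
odd, so for `p = 2` another graph is needed: take `A = Z = X` adjoint, where `m (1 ⊗ m) (m_* ⊗ 1)
m_*` is `1/2` as soon as `m m_* = 1` (`exists_tetra_eq`). In general, for `m` equal to `s` times the
commutator and the pairing `c` times the trace form, these two endomorphisms are `u = 4s²/c` and
`u²/2`; with `dim X = 3` the amplitudes are `3u` and `3u²/2`. -/

/-! ### Elements of `PGL(2)` and regular functions along curves -/

section Elements

open Matrix Polynomial

variable {k : Type} [Field k]

/-- The class of an invertible matrix in `PGL(2)`, given by its entries. -/
noncomputable def pgl (a b c d : k) (h : a * d - b * c ≠ 0) : PGL(2, k) :=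
  ProjGenLinGroup.mk (GeneralLinearGroup.mkOfDetNeZero !![a, b; c, d] (by simpa [det_fin_two] using h))

theorem pgl_mul {a b c d a' b' c' d' : k} (h : a * d - b * c ≠ 0) (h' : a' * d' - b' * c' ≠ 0) :
    pgl a b c d h * pgl a' b' c' d' h' =
      pgl (a * a' + b * c') (a * b' + b * d') (c * a' + d * c') (c * b' + d * d')
        (by convert mul_ne_zero h h' using 1; ring) := by
  rw [pgl, pgl, pgl, ← map_mul]
  congr 1
  ext i j
  fin_cases i <;> fin_cases j <;>
    simp [GeneralLinearGroup.mkOfDetNeZero, Matrix.mul_apply, Fin.sum_univ_two]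

theorem pgl_eq_pgl {a b c d a' b' c' d' : k} (h : a * d - b * c ≠ 0) (h' : a' * d' - b' * c' ≠ 0)
    (u : k) (ha : a' = u * a) (hb : b' = u * b) (hc : c' = u * c) (hd : d' = u * d) :
    pgl a b c d h = pgl a' b' c' d' h' := by
  have hu : u ≠ 0 := by
    rintro rfl
    simp_all
  rw [pgl, pgl, ProjGenLinGroup.mk_eq_mk_iff]
  refine ⟨Units.mk0 u hu, ?_⟩
  ext i j
  fin_cases i <;> fin_cases j <;>
    simp [GeneralLinearGroup.mkOfDetNeZero, ha, hb, hc, hd, mul_comm, Matrix.mul_apply, Fin.sum_univ_two]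

theorem mk_eq_pgl (g : GL (Fin 2) k) : ∃ h, ProjGenLinGroup.mk g =
    pgl (g.1 0 0) (g.1 0 1) (g.1 1 0) (g.1 1 1) h := by
  have hd : g.1.det ≠ 0 := (Matrix.isUnit_iff_isUnit_det _).1 g.isUnit |>.ne_zero
  rw [det_fin_two] at hd
  refine ⟨hd, ?_⟩
  rw [pgl]
  congr 1
  ext i j
  fin_cases i <;> fin_cases j <;> rfl

theorem exists_eq_pgl (g : PGL(2, k)) : ∃ a b c d h, g = pgl a b c d h := by
  induction g using ProjGenLinGroup.induction_on with
  | mk g => exact ⟨_, _, _, _, mk_eq_pgl g⟩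

theorem pgl_one : pgl (1 : k) 0 0 1 (by simp) = 1 := by
  rw [pgl, ← map_one ProjGenLinGroup.mk]
  congr 1
  ext i j
  fin_cases i <;> fin_cases j <;> rfl

theorem pgl_inv {a b c d : k} (h : a * d - b * c ≠ 0) :
    (pgl a b c d h)⁻¹ = pgl d (-b) (-c) a (by convert h using 1; ring) := by
  rw [inv_eq_iff_mul_eq_one, pgl_mul, ← pgl_one]
  symm
  apply pgl_eq_pgl (u := a * d - b * c) <;> ring

/-- The point of affine space with the given coordinates. -/
def entries (a b c d : k) (ij : Fin 2 × Fin 2) : k := !![a, b; c, d] ij.1 ij.2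

theorem isRegularFun_iff {φ : PGL(2, k) → k} : IsRegularFun k φ ↔
    ∃ (P : MvPolynomial (Fin 2 × Fin 2) k) (n : ℕ), ∀ a b c d h,
      φ (pgl a b c d h) * (a * d - b * c) ^ n = MvPolynomial.eval (entries a b c d) P := by
  constructor
  · rintro ⟨P, n, hP⟩
    refine ⟨P, n, fun a b c d h => ?_⟩
    have hd : (!![a, b; c, d]).det = a * d - b * c := det_fin_two_of a b c d
    rw [← hd]
    exact hP (GeneralLinearGroup.mkOfDetNeZero !![a, b; c, d] (by simpa [det_fin_two] using h))
  · rintro ⟨P, n, hP⟩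
    refine ⟨P, n, fun g => ?_⟩
    obtain ⟨h, hg⟩ := mk_eq_pgl g
    rw [hg, det_fin_two, hP]
    congr 2
    funext ⟨i, j⟩
    fin_cases i <;> fin_cases j <;> rfl

/-- Precomposition with a map given by polynomials in the entries. -/
theorem IsRegularFun.comp_of_entries {φ : PGL(2, k) → k} (hφ : IsRegularFun k φ)
    (A B C D : MvPolynomial (Fin 2 × Fin 2) k) (u : k) (hu : u ≠ 0) (γ : PGL(2, k) → PGL(2, k))
    (hdet : ∀ a b c d : k, MvPolynomial.eval (entries a b c d) A * MvPolynomial.eval (entries a b c d) D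
      - MvPolynomial.eval (entries a b c d) B * MvPolynomial.eval (entries a b c d) C
        = u * (a * d - b * c))
    (hγ : ∀ a b c d h, γ (pgl a b c d h) = pgl (MvPolynomial.eval (entries a b c d) A)
      (MvPolynomial.eval (entries a b c d) B) (MvPolynomial.eval (entries a b c d) C)
      (MvPolynomial.eval (entries a b c d) D) (by rw [hdet]; exact mul_ne_zero hu h)) :
    IsRegularFun k (fun g => φ (γ g)) := by
  obtain ⟨P, n, hP⟩ := isRegularFun_iff.1 hφ
  refine isRegularFun_iff.2 ⟨MvPolynomial.C (u⁻¹ ^ n) *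
    MvPolynomial.bind₁ (fun ij => !![A, B; C, D] ij.1 ij.2) P, n, fun a b c d h => ?_⟩
  have h1 := hP _ _ _ _ (by rw [hdet a b c d]; exact mul_ne_zero hu h)
  rw [← hγ _ _ _ _ h, hdet, mul_pow] at h1
  have h2 : MvPolynomial.eval (entries a b c d)
      (MvPolynomial.bind₁ (fun ij => !![A, B; C, D] ij.1 ij.2) P) = MvPolynomial.eval
      (entries (MvPolynomial.eval (entries a b c d) A) (MvPolynomial.eval (entries a b c d) B)
        (MvPolynomial.eval (entries a b c d) C) (MvPolynomial.eval (entries a b c d) D)) P := by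
    rw [MvPolynomial.eval, MvPolynomial.eval₂Hom_bind₁, MvPolynomial.eval]
    congr 2
    funext ⟨i, j⟩
    fin_cases i <;> fin_cases j <;> rfl
  have hu' : u⁻¹ ^ n * u ^ n = 1 := by rw [← mul_pow, inv_mul_cancel₀ hu, one_pow]
  rw [map_mul, MvPolynomial.eval_C, h2, ← h1]
  linear_combination (-(φ (γ (pgl a b c d h)) * (a * d - b * c) ^ n)) * hu'

theorem IsRegularFun.inv {φ : PGL(2, k) → k} (hφ : IsRegularFun k φ) :
    IsRegularFun k (fun g => φ g⁻¹) := by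
  refine hφ.comp_of_entries (.X (1, 1)) (-.X (0, 1)) (-.X (1, 0)) (.X (0, 0)) 1 one_ne_zero _ ?_ ?_
  · intro a b c d
    simp [entries]
    ring
  · intro a b c d h
    rw [pgl_inv]
    apply pgl_eq_pgl (u := 1) <;> simp [entries]

theorem IsRegularFun.mul_left {φ : PGL(2, k) → k} (hφ : IsRegularFun k φ) (x : PGL(2, k)) :
    IsRegularFun k (fun g => φ (x * g)) := by
  obtain ⟨a, b, c, d, h, rfl⟩ := exists_eq_pgl x
  refine hφ.comp_of_entries (.C a * .X (0, 0) + .C b * .X (1, 0)) (.C a * .X (0, 1) + .C b * .X (1, 1))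
    (.C c * .X (0, 0) + .C d * .X (1, 0)) (.C c * .X (0, 1) + .C d * .X (1, 1)) _ h _ ?_ ?_
  · intro a b c d
    simp [entries]
    ring
  · intro a b c d h
    rw [pgl_mul]
    apply pgl_eq_pgl (u := 1) <;> simp [entries]

theorem IsRegularFun.mul_right {φ : PGL(2, k) → k} (hφ : IsRegularFun k φ) (x : PGL(2, k)) :
    IsRegularFun k (fun g => φ (g * x)) := by
  convert ((hφ.inv).mul_left x⁻¹).inv using 3
  simp

/-- Restriction to a polynomial curve of matrices makes one-variable arguments available. The curves
used below have determinant `1` (unipotents and the chart at infinity) or `t` (the torus). -/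
theorem IsRegularFun.exists_polynomial {φ : PGL(2, k) → k} (hφ : IsRegularFun k φ)
    (A B C D : k[X]) : ∃ (P : k[X]) (n : ℕ), ∀ t h,
      φ (pgl (A.eval t) (B.eval t) (C.eval t) (D.eval t) h) *
        ((A * D - B * C).eval t) ^ n = P.eval t := by
  obtain ⟨P, n, hP⟩ := isRegularFun_iff.1 hφ
  refine ⟨MvPolynomial.eval₂ Polynomial.C (fun ij => !![A, B; C, D] ij.1 ij.2) P, n, fun t h => ?_⟩
  have h1 := hP _ _ _ _ h
  rw [eval_sub, eval_mul, eval_mul, h1, ← Polynomial.coe_evalRingHom, MvPolynomial.eval₂_comp_left]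
  rw [MvPolynomial.eval, MvPolynomial.coe_eval₂Hom]
  congr 1
  · ext; simp
  · funext ⟨i, j⟩
    fin_cases i <;> fin_cases j <;> rfl

/-- Upper unipotent elements. -/
noncomputable def up (s : k) : PGL(2, k) := pgl 1 s 0 1 (by simp)

/-- Lower unipotent elements. -/
noncomputable def lo (r : k) : PGL(2, k) := pgl 1 0 r 1 (by simp)

/-- The elements of the diagonal torus. -/
noncomputable def di (t : kˣ) : PGL(2, k) := pgl (t : k) 0 0 1 (by simp)

/-- The nontrivial element of the Weyl group. -/
noncomputable def weyl : PGL(2, k) := pgl (0 : k) 1 (-1) 0 (by simp)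

theorem up_zero : up (0 : k) = 1 := pgl_one

theorem lo_zero : lo (0 : k) = 1 := pgl_one

theorem lo_inv (r : k) : (lo r)⁻¹ = lo (-r) := by
  rw [lo, lo, pgl_inv]
  apply pgl_eq_pgl (u := 1) <;> simp

theorem di_one : di (1 : kˣ) = 1 := by
  rw [← pgl_one]; rfl

theorem di_mul (s t : kˣ) : di (s * t) = di s * di t := by
  rw [di, di, di, pgl_mul]
  apply pgl_eq_pgl (u := 1) <;> simp

/-- Torus conjugation rescales unipotents, so a variable unipotent can be traded for a fixed one and
a variable torus element. -/
theorem di_mul_up (t : kˣ) (s : k) : di t * up s = up (t * s) * di t := by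
  simp only [di, up, pgl_mul]
  apply pgl_eq_pgl (u := 1) <;> simp

theorem di_mul_lo (t : kˣ) : di t * lo (t : k) = lo 1 * di t := by
  simp only [di, lo, pgl_mul]
  apply pgl_eq_pgl (u := 1) <;> simp

theorem IsRegularFun.exists_polynomial_up {φ : PGL(2, k) → k} (hφ : IsRegularFun k φ) :
    ∃ P : k[X], ∀ s, φ (up s) = P.eval s := by
  obtain ⟨P, n, hP⟩ := hφ.exists_polynomial 1 X 0 1
  refine ⟨P, fun s => ?_⟩
  rw [← hP s (by simp)]
  simp [up]

theorem IsRegularFun.exists_polynomial_lo {φ : PGL(2, k) → k} (hφ : IsRegularFun k φ) :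
    ∃ P : k[X], ∀ s, φ (lo s) = P.eval s := by
  obtain ⟨P, n, hP⟩ := hφ.exists_polynomial 1 0 X 1
  refine ⟨P, fun s => ?_⟩
  rw [← hP s (by simp)]
  simp [lo]

theorem IsRegularFun.exists_polynomial_di {φ : PGL(2, k) → k} (hφ : IsRegularFun k φ) :
    ∃ (P : k[X]) (n : ℕ), ∀ t : kˣ, φ (di t) * (t : k) ^ n = P.eval (t : k) := by
  obtain ⟨P, n, hP⟩ := hφ.exists_polynomial X 0 0 1
  refine ⟨P, n, fun t => ?_⟩
  rw [← hP t (by simp)]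
  simp [di]

end Elements

/-! ### Highest weight vectors of rational representations -/

section HighestWeight

open Polynomial

variable {k : Type} [Field k]

/-- A representation of `PGL(2)` whose matrix coefficients are regular functions. -/
def IsRationalRep {V : Type} [AddCommGroup V] [Module k V] (ρ : Representation k PGL(2, k) V) : Prop :=
  ∀ (f : Module.Dual k V) (v : V), IsRegularFun k (fun g => f (ρ g v))

theorem polynomial_eq_of_forall_ne_zero [Infinite k] {p q : k[X]}
    (h : ∀ t : k, t ≠ 0 → p.eval t = q.eval t) : p = q := by
  refine Polynomial.eq_of_infinite_eval_eq p q (Set.Infinite.mono (s := {0}ᶜ) (fun t ht => h t ht) ?_)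
  exact (Set.finite_singleton 0).infinite_compl

/-- `p * X ^ N` has degree at most `N`, so `p` is constant. This turns a bound on torus weights into
invariance under a unipotent subgroup. -/
theorem eval_eq_of_mul_pow_eq [Infinite k] (p : k[X]) (N : ℕ) (a : ℕ → k)
    (h : ∀ t : k, t ≠ 0 → p.eval t * t ^ N = ∑ i ∈ Finset.range (N + 1), t ^ i * a i) (t : k) :
    p.eval t = p.eval 0 := by
  have h1 : p * X ^ N = ∑ i ∈ Finset.range (N + 1), C (a i) * X ^ i :=
    polynomial_eq_of_forall_ne_zero fun t ht => by
      simp only [eval_mul, eval_pow, eval_X, h t ht, eval_finsetSum, eval_C]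
      exact Finset.sum_congr rfl fun _ _ => mul_comm _ _
  have h2 : p = C (p.coeff 0) := by
    ext m
    rcases m with _ | m
    · simp
    · have := congrArg (fun q => q.coeff (m + 1 + N)) h1
      simp only [coeff_mul_X_pow, finsetSum_coeff, coeff_C_mul, coeff_X_pow] at this
      rw [this, coeff_C_of_ne_zero (Nat.succ_ne_zero m)]
      refine Finset.sum_eq_zero fun i hi => ?_
      rw [if_neg (by have := Finset.mem_range.1 hi; omega), mul_zero]
  rw [h2]
  simp

theorem eq_of_sum_pow_smul_eq [Infinite k] {M : Type*} [AddCommGroup M] [Module k M] (N : ℕ)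
    (c d : ℕ → M)
    (h : ∀ t : k, t ≠ 0 → ∑ i ∈ Finset.range N, t ^ i • c i = ∑ i ∈ Finset.range N, t ^ i • d i)
    (i : ℕ) (hi : i < N) : c i = d i := by
  rw [← sub_eq_zero, ← Module.forall_dual_apply_eq_zero_iff k]
  intro f
  have h1 : ∑ i ∈ Finset.range N, C (f (c i)) * X ^ i = ∑ i ∈ Finset.range N, C (f (d i)) * X ^ i :=
    polynomial_eq_of_forall_ne_zero fun t ht => by
      have h2 := congrArg f (h t ht)
      simp only [map_sum, map_smul, smul_eq_mul, mul_comm (t ^ _)] at h2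
      simpa only [eval_finsetSum, eval_mul, eval_C, eval_pow, eval_X] using h2
  have := congrArg (fun q => q.coeff i) h1
  simp only [finsetSum_coeff, coeff_C_mul, coeff_X_pow] at this
  simpa [hi, sub_eq_zero] using this

variable {V : Type} [AddCommGroup V] [Module k V] {ρ : Representation k PGL(2, k) V}

/-- The torus acts by a Laurent polynomial with operator coefficients; matrix coefficients in a
basis give it entry by entry, once their denominators are made equal. -/
theorem IsRationalRep.exists_sum_di [Module.Finite k V] (hρ : IsRationalRep ρ) :
    ∃ (n N : ℕ) (c : ℕ → Module.End k V), ∀ t : kˣ,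
      (t : k) ^ n • ρ (di t) = ∑ i ∈ Finset.range N, (t : k) ^ i • c i := by
  let b := Module.finBasis k V
  choose P n hP using fun i j => (hρ (b.coord i) (b j)).exists_polynomial_di
  -- The sum is a crude common exponent, at least each `n i j`; the sum defining `N` likewise
  -- exceeds every degree.
  let m := ∑ i, ∑ j, n i j
  have hm : ∀ i j, n i j ≤ m := fun i j =>
    (Finset.single_le_sum (f := fun j => n i j) (fun _ _ => Nat.zero_le _) (Finset.mem_univ j)).trans
      (Finset.single_le_sum (f := fun i => ∑ j, n i j) (fun _ _ => Nat.zero_le _) (Finset.mem_univ i))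
  let Q := fun i j => P i j * X ^ (m - n i j)
  let N := ∑ i, ∑ j, ((Q i j).natDegree + 1)
  have hN : ∀ i j, (Q i j).natDegree < N := fun i j => Nat.lt_of_succ_le <|
    (Finset.single_le_sum (f := fun j => (Q i j).natDegree + 1) (fun _ _ => Nat.zero_le _)
      (Finset.mem_univ j)).trans (Finset.single_le_sum
        (f := fun i => ∑ j, ((Q i j).natDegree + 1)) (fun _ _ => Nat.zero_le _) (Finset.mem_univ i))
  refine ⟨m, N, fun l => (LinearMap.toMatrix b b).symm (Matrix.of fun i j => (Q i j).coeff l), fun t => ?_⟩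
  apply (LinearMap.toMatrix b b).injective
  ext i j
  simp only [map_smul, map_sum, LinearEquiv.apply_symm_apply, Matrix.smul_apply, Matrix.sum_apply,
    Matrix.of_apply, smul_eq_mul]
  rw [LinearMap.toMatrix_apply]
  have h1 := hP i j t
  have h2 : (Q i j).eval (t : k) = (P i j).eval (t : k) * (t : k) ^ (m - n i j) := by simp [Q]
  rw [eval_eq_sum_range' (hN i j), ← h1, mul_assoc, ← pow_add, Nat.add_sub_cancel' (hm i j)] at h2
  simp only [Module.Basis.coord_apply] at h2
  rw [mul_comm, ← h2]
  exact Finset.sum_congr rfl fun _ _ => mul_comm _ _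

/-- A nonzero rational representation has a vector of highest weight and a functional of lowest
weight which do not vanish on each other. -/
theorem IsRationalRep.exists_highest_weight [Infinite k] [Module.Finite k V] [Nontrivial V]
    (hρ : IsRationalRep ρ) : ∃ (j : ℤ) (v : V) (f : Module.Dual k V), f v = 1 ∧
      (∀ s, ρ (up s) v = v) ∧ (∀ t : kˣ, ρ (di t) v = (t : k) ^ j • v) ∧
      (∀ r w, f (ρ (lo r) w) = f w) ∧ ∀ (t : kˣ) w, f (ρ (di t) w) = (t : k) ^ j * f w := by
  classical
  obtain ⟨n, hn⟩ := hρ.exists_sum_di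
  -- With `n` fixed, the length `N = I + 1` is taken least, so that the top coefficient `c I` is
  -- nonzero.
  have hmin := Nat.find_spec hn
  have hlt := fun m => Nat.find_min hn (m := m)
  generalize Nat.find hn = N at hmin hlt
  obtain ⟨c, hc⟩ := hmin
  rcases N with _ | I
  · have := hc 1
    simp [di_one] at this
  have htop : c I ≠ 0 := fun h0 => hlt I (Nat.lt_succ_self I) ⟨c, fun t => by
    rw [hc, Finset.sum_range_succ, h0, smul_zero, add_zero]⟩
  -- Comparing the coefficients of `s ^ i` in `ρ (di (t * s)) = ρ (di t) * ρ (di s)`: each `c i` is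
  -- a weight operator of weight `i - n`, here from the left and below from the right.
  have hleft : ∀ (t : kˣ) i, i < I + 1 → (t : k) ^ n • (ρ (di t) * c i) = (t : k) ^ i • c i := by
    intro t
    apply eq_of_sum_pow_smul_eq (k := k)
    intro s hs
    obtain ⟨s, rfl⟩ : ∃ u : kˣ, (u : k) = s := ⟨Units.mk0 s hs, rfl⟩
    have h1 := hc (t * s)
    rw [di_mul, map_mul, Units.val_mul, mul_pow, mul_smul, ← mul_smul_comm, hc s, Finset.mul_sum,
      Finset.smul_sum] at h1
    simp only [mul_smul_comm, smul_smul] at h1 ⊢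
    simp only [mul_comm ((s : k) ^ _) , ← mul_pow] at h1 ⊢
    simpa only [mul_pow] using h1
  have hright : ∀ (t : kˣ) i, i < I + 1 → (t : k) ^ n • (c i * ρ (di t)) = (t : k) ^ i • c i := by
    intro t
    apply eq_of_sum_pow_smul_eq (k := k)
    intro s hs
    obtain ⟨s, rfl⟩ : ∃ u : kˣ, (u : k) = s := ⟨Units.mk0 s hs, rfl⟩
    have h1 := hc (s * t)
    rw [di_mul, map_mul, Units.val_mul, mul_comm (s : k), mul_pow, mul_smul, ← smul_mul_assoc, hc s,
      Finset.sum_mul, Finset.smul_sum] at h1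
    simp only [smul_mul_assoc, smul_smul] at h1 ⊢
    simp only [mul_comm ((s : k) ^ _) , ← mul_pow] at h1 ⊢
    simpa only [mul_pow] using h1
  -- The coefficients of `t ^ n • (ρ (di t) * c I) = t ^ I • c I` give `c i * c I = 0` for `i < I`
  -- and `c I * c I = c I`.
  have hidem : c I * c I = c I := by
    have := eq_of_sum_pow_smul_eq (k := k) (I + 1) (fun i => c i * c I)
      (fun i => if i = I then c I else 0) ?_ I (Nat.lt_succ_self I)
    · simpa using this
    · intro t ht
      obtain ⟨t, rfl⟩ : ∃ u : kˣ, (u : k) = t := ⟨Units.mk0 t ht, rfl⟩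
      have h1 := hleft t I (Nat.lt_succ_self I)
      rw [← smul_mul_assoc, hc, Finset.sum_mul] at h1
      simp only [smul_mul_assoc] at h1
      rw [h1]
      simp
  obtain ⟨x, hx⟩ : ∃ x, c I x ≠ 0 := by
    by_contra! h
    exact htop (LinearMap.ext h)
  obtain ⟨f, hf⟩ : ∃ f : Module.Dual k V, f (c I x) = 1 := by
    obtain ⟨f, hf⟩ := not_forall.1 ((Module.forall_dual_apply_eq_zero_iff k _).not.2 hx)
    exact ⟨(f (c I x))⁻¹ • f, by simp [hf]⟩
  have hz : ∀ t : kˣ, (t : k) ^ ((I : ℤ) - n) = ((t : k) ^ n)⁻¹ * (t : k) ^ I := by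
    intro t
    rw [zpow_sub₀ t.ne_zero, zpow_natCast, zpow_natCast, div_eq_inv_mul]
  have hleft' : ∀ t : kˣ, ρ (di t) * c I = (t : k) ^ ((I : ℤ) - n) • c I := by
    intro t
    rw [hz, mul_smul, ← hleft t I (Nat.lt_succ_self I), smul_smul,
      inv_mul_cancel₀ (pow_ne_zero _ t.ne_zero), one_smul]
  have hright' : ∀ t : kˣ, c I * ρ (di t) = (t : k) ^ ((I : ℤ) - n) • c I := by
    intro t
    rw [hz, mul_smul, ← hright t I (Nat.lt_succ_self I), smul_smul,
      inv_mul_cancel₀ (pow_ne_zero _ t.ne_zero), one_smul]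
  refine ⟨(I : ℤ) - n, c I x, f ∘ₗ c I, ?_, ?_, ?_, ?_, ?_⟩
  · rw [LinearMap.comp_apply, ← Module.End.mul_apply, hidem, hf]
  · intro s
    rw [← sub_eq_zero, ← Module.forall_dual_apply_eq_zero_iff k]
    intro ξ
    obtain ⟨p, hp⟩ := (hρ ξ (c I x)).exists_polynomial_up
    -- As `di t * up 1 = up t * di t` and the vector has weight `I - n`, `t ^ I * ξ (ρ (up t) (c I
    -- x))` is a polynomial in `t` of degree at most `I`. The maximality of the weight `I` is what
    -- makes this conclusive.
    have := eval_eq_of_mul_pow_eq p I (fun i => ξ (c i (ρ (up 1) (c I x)))) ?_ s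
    · rw [← hp, ← hp, up_zero, map_one] at this
      simp [this]
    · intro t ht
      obtain ⟨t, rfl⟩ : ∃ u : kˣ, (u : k) = t := ⟨Units.mk0 t ht, rfl⟩
      have h1 := congrArg (fun T => ξ (T (ρ (up 1) (c I x)))) (hc t)
      simp only [LinearMap.smul_apply, LinearMap.sum_apply, map_sum, map_smul, smul_eq_mul] at h1
      rw [← h1, ← Module.End.mul_apply, ← map_mul, di_mul_up, mul_one, map_mul, Module.End.mul_apply,
        ← Module.End.mul_apply (ρ (di t)), hleft', LinearMap.smul_apply, map_smul, map_smul, hz, hp,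
        smul_eq_mul]
      field_simp
  · intro t
    rw [← Module.End.mul_apply, hleft', LinearMap.smul_apply]
  · intro r w
    obtain ⟨p, hp⟩ := (hρ (f ∘ₗ c I) w).exists_polynomial_lo
    -- The mirror argument, with `di t * lo t = lo 1 * di t` and the torus acting on `c I` from the
    -- right.
    have := eval_eq_of_mul_pow_eq p I (fun i => f (c I (ρ (lo 1) (c i w)))) ?_ r
    · rw [← hp, ← hp, lo_zero, map_one] at this
      exact this
    · intro t ht
      obtain ⟨t, rfl⟩ : ∃ u : kˣ, (u : k) = t := ⟨Units.mk0 t ht, rfl⟩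
      have h1 := congrArg (fun T => f (c I (ρ (lo 1) (T w)))) (hc t)
      simp only [LinearMap.smul_apply, LinearMap.sum_apply, map_sum, map_smul, smul_eq_mul] at h1
      rw [← h1, ← Module.End.mul_apply (ρ (lo 1)), ← map_mul, ← di_mul_lo, map_mul,
        Module.End.mul_apply, ← Module.End.mul_apply (c I), hright', LinearMap.smul_apply, map_smul,
        hz, ← hp, smul_eq_mul, LinearMap.comp_apply]
      field_simp
  · intro t w
    rw [LinearMap.comp_apply, ← Module.End.mul_apply, hright', LinearMap.smul_apply, map_smul,
      smul_eq_mul, LinearMap.comp_apply]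

end HighestWeight

/-! ### Binary forms -/

section BinaryForms

open Polynomial

variable {k : Type} [Field k]

/-- `h` is a regular function on `PGL(2)` on which the lower triangular subgroup acts, by left
translations, through the character of weight `j`. -/
structure IsForm (j : ℤ) (h : PGL(2, k) → k) : Prop where
  regular : IsRegularFun k h
  lo_mul : ∀ r g, h (lo r * g) = h g
  di_mul : ∀ (t : kˣ) g, h (di t * g) = (t : k) ^ j * h g

/-- The quotient of the group by its lower triangular subgroup is a projective line. The left side
is its chart at infinity, which meets the big cell in the coordinate `s⁻¹`; the torus part `s ^ 2`
produces the factor `s ^ (2 * j)` below. -/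
theorem pgl_eq_lo_mul_di_mul_weyl (s : k) (hs : s ≠ 0) : pgl s 1 (-1) 0 (by simp) =
    lo (-s⁻¹) * (di (Units.mk0 s hs ^ 2) * up s⁻¹) := by
  simp only [lo, di, up, pgl_mul]
  symm
  apply pgl_eq_pgl (u := s⁻¹) <;> simp [hs, sq]

/-- A form of weight `j` is a section of `O(2j)` on the projective line: `p` and `q` are its
expressions in the two affine charts, and the last clause is the change of trivialization. -/
theorem IsForm.exists_polynomials {j : ℤ} {h : PGL(2, k) → k} (hh : IsForm j h) :
    ∃ p q : k[X], (∀ s, h (up s) = p.eval s) ∧ (∀ s, h (pgl s 1 (-1) 0 (by simp)) = q.eval s) ∧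
      ∀ s, s ≠ 0 → q.eval s = s ^ (2 * j) * p.eval s⁻¹ := by
  obtain ⟨p, hp⟩ := hh.regular.exists_polynomial_up
  obtain ⟨q, n, hq⟩ := hh.regular.exists_polynomial X 1 (-1) 0
  have hq' : ∀ s, h (pgl s 1 (-1) 0 (by simp)) = q.eval s := fun s => by
    rw [← hq s (by simp)]
    simp
  refine ⟨p, q, hp, hq', fun s hs => ?_⟩
  rw [← hq', ← hp, pgl_eq_lo_mul_di_mul_weyl s hs, hh.lo_mul, hh.di_mul, zpow_mul]
  simp

/-- The elements with `a ≠ 0` form the big cell `lo * di * up`. Those with `a = 0` form one coset,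
the origin of the chart at infinity, where the value is `q` at `0`; and `q` is determined by `p`. -/
theorem IsForm.ext {j : ℤ} [Infinite k] {h h' : PGL(2, k) → k} (hh : IsForm j h) (hh' : IsForm j h')
    (H : ∀ s, h (up s) = h' (up s)) : h = h' := by
  obtain ⟨p, q, hp, hq, hpq⟩ := hh.exists_polynomials
  obtain ⟨p', q', hp', hq', hpq'⟩ := hh'.exists_polynomials
  have hp1 : p = p' := polynomial_eq_of_forall_ne_zero fun t _ => by rw [← hp, ← hp', H]
  have hq1 : q = q' := polynomial_eq_of_forall_ne_zero fun t ht => by rw [hpq t ht, hpq' t ht, hp1]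
  funext g
  obtain ⟨a, b, c, d, hd, rfl⟩ := exists_eq_pgl g
  rcases eq_or_ne a 0 with rfl | ha
  · have hb : b ≠ 0 := by rintro rfl; simp at hd
    have hc : c ≠ 0 := by rintro rfl; simp at hd
    have : pgl 0 b c d hd = lo (d / b) * (di (Units.mk0 (-(b / c))
        (neg_ne_zero.2 (div_ne_zero hb hc))) * pgl 0 1 (-1) 0 (by simp)) := by
      simp only [lo, di, pgl_mul]
      symm
      apply pgl_eq_pgl (u := -c) <;> simp <;> field_simp
    rw [this, hh.lo_mul, hh'.lo_mul, hh.di_mul, hh'.di_mul, hq, hq', hq1]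
  · have : pgl a b c d hd = lo (c / a) * (di (Units.mk0 (a ^ 2 / (a * d - b * c))
        (div_ne_zero (pow_ne_zero 2 ha) hd)) * up (b / a)) := by
      simp only [lo, di, up, pgl_mul]
      symm
      apply pgl_eq_pgl (u := (a * d - b * c) / a) <;> simp <;> generalize hδ : a * d - b * c = δ at hd ⊢ <;>
        field_simp
      rw [← hδ]
      ring
    rw [this, hh.lo_mul, hh'.lo_mul, hh.di_mul, hh'.di_mul, H]

/-- A line bundle of negative degree has no nonzero sections: with `p = 1`, the polynomial `q` would
be a negative power of `s`. -/
theorem IsForm.weight_nonneg {j : ℤ} [Infinite k] {h : PGL(2, k) → k} (hh : IsForm j h)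
    (H : ∀ s, h (up s) = 1) : 0 ≤ j := by
  obtain ⟨p, q, hp, hq, hpq⟩ := hh.exists_polynomials
  by_contra! hj
  obtain ⟨m, rfl⟩ : ∃ m : ℕ, j = -(m + 1 : ℕ) := ⟨(-j - 1).toNat, by omega⟩
  have : X ^ (2 * (m + 1)) * q = 1 := polynomial_eq_of_forall_ne_zero fun t ht => by
    rw [eval_mul, hpq t ht, ← hp, H, eval_pow, eval_X, eval_one, mul_one, ← zpow_natCast,
      ← zpow_add₀ ht]
    convert zpow_zero t using 2
    push_cast
    ring
  simpa using congrArg (eval 0) this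

theorem IsForm.exists_coeff {j : ℕ} [Infinite k] {h : PGL(2, k) → k} (hh : IsForm j h) :
    ∃ c : ℕ → k, ∀ s, h (up s) = ∑ i ∈ Finset.range (2 * j + 1), c i * s ^ i := by
  obtain ⟨p, q, hp, hq, hpq⟩ := hh.exists_polynomials
  refine ⟨p.coeff, fun s => ?_⟩
  rw [hp]
  apply eval_eq_sum_range'
  by_contra! hd
  -- The transition formula multiplied by `t ^ p.natDegree`. If the degree exceeds `2 * j`, the
  -- coefficient of `X ^ (2 * j)` is `0` on the left and the leading coefficient of `p` on the
  -- right.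
  have hrev : X ^ p.natDegree * q = X ^ (2 * j) * p.reverse :=
    polynomial_eq_of_forall_ne_zero fun t ht => by
      let := invertibleOfNonzero (inv_ne_zero ht)
      have := eval₂_reverse_mul_pow (RingHom.id k) t⁻¹ p
      simp only [invOf_eq_inv, inv_inv] at this
      rw [eval_mul, hpq t ht, eval_mul, eval_pow, eval_pow, eval_X, Polynomial.eval, Polynomial.eval, ← this, inv_pow]
      have h2 : (t : k) ^ (2 * (j : ℤ)) = t ^ (2 * j) := by exact_mod_cast zpow_natCast t (2 * j)
      rw [h2]
      field_simp
  have hp0 : p ≠ 0 := by rintro rfl; simp at hd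
  have := congrArg (fun r => r.coeff (2 * j)) hrev
  simp only [coeff_X_pow_mul', le_refl, if_true, Nat.sub_self, coeff_zero_reverse,
    if_neg (show ¬ p.natDegree ≤ 2 * j by omega)] at this
  exact hp0 (leadingCoeff_eq_zero.1 this.symm)

/-- The monomial `x ^ (2 * j - i) * y ^ i` as a function on `PGL(2)`. -/
noncomputable def monomialForm (k : Type) [Field k] (j i : ℕ) (g : PGL(2, k)) : k :=
  let m := (Function.surjInv Matrix.ProjGenLinGroup.mk_surjective g : GL (Fin 2) k).1
  m 0 0 ^ (2 * j - i) * m 0 1 ^ i / m.det ^ j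

/-- The choice of a matrix in the definition is harmless: a scalar `u` multiplies both numerator and
denominator by `u ^ (2 * j)`. -/
theorem monomialForm_pgl {j i : ℕ} (hi : i ≤ 2 * j) (a b c d : k) (h : a * d - b * c ≠ 0) :
    monomialForm k j i (pgl a b c d h) = a ^ (2 * j - i) * b ^ i / (a * d - b * c) ^ j := by
  have h1 := Function.surjInv_eq Matrix.ProjGenLinGroup.mk_surjective (pgl a b c d h)
  rw [monomialForm]
  generalize Function.surjInv Matrix.ProjGenLinGroup.mk_surjective (pgl a b c d h) = m at h1
  rw [pgl, eq_comm, Matrix.ProjGenLinGroup.mk_eq_mk_iff] at h1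
  obtain ⟨u, rfl⟩ := h1
  have hu := u.ne_zero
  have hd : ((Matrix.GeneralLinearGroup.mkOfDetNeZero !![a, b; c, d]
      (by simpa [Matrix.det_fin_two] using h) * Matrix.GeneralLinearGroup.scalar (Fin 2) u :
        GL (Fin 2) k) : Matrix (Fin 2) (Fin 2) k) = !![a * u, b * u; c * u, d * u] := by
    ext i j
    fin_cases i <;> fin_cases j <;>
      simp [Matrix.GeneralLinearGroup.mkOfDetNeZero, Matrix.mul_apply, Fin.sum_univ_two]
  simp only [hd, Matrix.det_fin_two_of]
  simp only [Matrix.of_apply, Matrix.cons_val', Matrix.cons_val_zero, Matrix.cons_val_one,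
    Matrix.cons_val_fin_one]
  rw [show a * u * (d * u) - b * u * (c * u) = (a * d - b * c) * (u : k) ^ 2 by ring, mul_pow, mul_pow,
    mul_pow, ← pow_mul, div_eq_div_iff (by positivity) (by positivity)]
  have : (u : k) ^ (2 * j) = (u : k) ^ (2 * j - i) * (u : k) ^ i := by
    rw [← pow_add, Nat.sub_add_cancel hi]
  rw [this]
  ring

theorem monomialForm_up {j i : ℕ} (hi : i ≤ 2 * j) (s : k) : monomialForm k j i (up s) = s ^ i := by
  rw [up, monomialForm_pgl hi]
  simp

theorem isForm_monomialForm {j i : ℕ} (hi : i ≤ 2 * j) : IsForm j (monomialForm k j i) where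
  regular := isRegularFun_iff.2 ⟨.X (0, 0) ^ (2 * j - i) * .X (0, 1) ^ i, j, fun a b c d h => by
    rw [monomialForm_pgl hi, div_mul_cancel₀ _ (pow_ne_zero _ h)]
    simp [entries]⟩
  lo_mul r g := by
    obtain ⟨a, b, c, d, h, rfl⟩ := exists_eq_pgl g
    rw [lo, pgl_mul, monomialForm_pgl hi, monomialForm_pgl hi]
    congr 1 <;> ring
  di_mul t g := by
    obtain ⟨a, b, c, d, h, rfl⟩ := exists_eq_pgl g
    rw [di, pgl_mul, monomialForm_pgl hi, monomialForm_pgl hi]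
    have ht := t.ne_zero
    simp only [zero_mul, add_zero, one_mul, zero_add]
    rw [mul_pow, mul_pow, mul_assoc (t : k), mul_assoc (t : k), ← mul_sub, mul_pow, zpow_natCast,
      ← mul_div_assoc, div_eq_div_iff (by positivity) (by positivity)]
    have : (t : k) ^ (2 * j) = (t : k) ^ (2 * j - i) * (t : k) ^ i := by
      rw [← pow_add, Nat.sub_add_cancel hi]
    have h2 : (t : k) ^ (2 * j) = (t : k) ^ j * (t : k) ^ j := by rw [two_mul, pow_add]
    linear_combination (-(a ^ (2 * j - i) * b ^ i * (a * d - b * c) ^ j)) * this +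
      (a ^ (2 * j - i) * b ^ i * (a * d - b * c) ^ j) * h2

end BinaryForms

/-! ### The representation on binary forms, its basis and its invariant functionals. -/

section BinaryFormsRepresentation

open Polynomial

variable {k : Type} [Field k]

/-- Binary forms of degree `2 * j`, realized as functions on `PGL(2)`. -/
def binaryForms (k : Type) [Field k] (j : ℕ) : Submodule k (PGL(2, k) → k) where
  carrier := {h | IsForm j h}
  zero_mem' := ⟨IsRegularFun.const 0, fun _ _ => rfl, fun _ _ => by simp⟩
  add_mem' {a b} ha hb := ⟨ha.regular.add hb.regular, fun r g => by simp [ha.lo_mul, hb.lo_mul],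
    fun t g => by simp [ha.di_mul, hb.di_mul, mul_add]⟩
  smul_mem' c a ha := ⟨(IsRegularFun.const c).mul ha.regular, fun r g => by simp [ha.lo_mul],
    fun t g => by simp [ha.di_mul, mul_left_comm]⟩

theorem IsForm.eq_sum_monomialForm [Infinite k] {j : ℕ} {h : PGL(2, k) → k} (hh : IsForm j h)
    {c : ℕ → k} (hc : ∀ s, h (up s) = ∑ i ∈ Finset.range (2 * j + 1), c i * s ^ i) :
    h = ∑ i ∈ Finset.range (2 * j + 1), c i • monomialForm k j i := by
  refine hh.ext ((binaryForms k j).sum_mem fun i hi => (binaryForms k j).smul_mem _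
    (isForm_monomialForm (Nat.lt_succ_iff.1 (Finset.mem_range.1 hi)))) fun s => ?_
  rw [hc, Finset.sum_apply]
  refine Finset.sum_congr rfl fun i hi => ?_
  rw [Pi.smul_apply, monomialForm_up (Nat.lt_succ_iff.1 (Finset.mem_range.1 hi)), smul_eq_mul]

/-- The monomial basis of the space of binary forms. -/
noncomputable def monomialBasis (k : Type) [Field k] [Infinite k] (j : ℕ) :
    Module.Basis (Fin (2 * j + 1)) k (binaryForms k j) :=
  Module.Basis.mk (v := fun i => ⟨monomialForm k j i, isForm_monomialForm (Nat.lt_succ_iff.1 i.2)⟩)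
    (by
      rw [Fintype.linearIndependent_iff]
      intro c hc
      have h1 : ∑ i : Fin (2 * j + 1), C (c i) * X ^ (i : ℕ) = (0 : k[X]) :=
        polynomial_eq_of_forall_ne_zero fun t _ => by
          have h2 := congrFun (congrArg Subtype.val hc) (up t)
          simp only [Submodule.coe_sum, Submodule.coe_smul, Finset.sum_apply, Pi.smul_apply] at h2
          simp only [eval_finsetSum, eval_mul, eval_C, eval_pow, eval_X]
          rw [eval_zero]
          refine Eq.trans (Finset.sum_congr rfl fun i _ => ?_) h2
          rw [monomialForm_up (Nat.lt_succ_iff.1 i.2), smul_eq_mul]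
      intro i
      have := congrArg (fun q => q.coeff i) h1
      simp only [finsetSum_coeff, coeff_C_mul, coeff_X_pow, Fin.val_inj, coeff_zero] at this
      simpa using this)
    (by
      rintro ⟨h, hh⟩ -
      obtain ⟨c, hc⟩ := IsForm.exists_coeff hh
      have : (⟨h, hh⟩ : binaryForms k j) = ∑ i : Fin (2 * j + 1), c i •
          (⟨monomialForm k j i, isForm_monomialForm (Nat.lt_succ_iff.1 i.2)⟩ : binaryForms k j) := by
        ext1
        refine (IsForm.eq_sum_monomialForm hh hc).trans ?_
        rw [Finset.sum_range]
        simp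
      rw [this]
      exact Submodule.sum_mem _ fun i _ => Submodule.smul_mem _ _ (Submodule.subset_span ⟨i, rfl⟩))

theorem monomialBasis_apply [Infinite k] (j : ℕ) (i : Fin (2 * j + 1)) :
    (monomialBasis k j i : PGL(2, k) → k) = monomialForm k j i := by
  simp [monomialBasis]

instance [Infinite k] (j : ℕ) : Module.Finite k (binaryForms k j) := .of_basis (monomialBasis k j)

theorem finrank_binaryForms [Infinite k] (j : ℕ) :
    Module.finrank k (binaryForms k j) = 2 * j + 1 := by
  rw [Module.finrank_eq_card_basis (monomialBasis k j), Fintype.card_fin]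

/-- A binary form is a combination of monomials with the coefficients of its dehomogenization. -/
theorem binaryForms_eq_sum [Infinite k] {j : ℕ} (h : binaryForms k j) {c : ℕ → k}
    (hc : ∀ s, h.1 (up s) = ∑ i ∈ Finset.range (2 * j + 1), c i * s ^ i) :
    h = ∑ i : Fin (2 * j + 1), c i • monomialBasis k j i := by
  ext1
  rw [IsForm.eq_sum_monomialForm h.2 hc, Finset.sum_range]
  simp [monomialBasis_apply]

/-- `PGL(2)` acts on binary forms by right translations. -/
def binaryFormsRep (k : Type) [Field k] (j : ℕ) : Representation k PGL(2, k) (binaryForms k j) where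
  toFun g :=
    { toFun := fun h => ⟨fun x => h.1 (x * g), h.2.regular.mul_right g,
        fun r x => by rw [mul_assoc, h.2.lo_mul], fun t x => by rw [mul_assoc, h.2.di_mul]⟩
      map_add' := fun _ _ => rfl
      map_smul' := fun _ _ => rfl }
  map_one' := by ext h x; exact congrArg h.1 (mul_one x)
  map_mul' g g' := by ext h x; exact congrArg h.1 (mul_assoc x g g').symm

theorem binaryFormsRep_apply {j : ℕ} (g x : PGL(2, k)) (h : binaryForms k j) :
    (binaryFormsRep k j g h).1 x = h.1 (x * g) := rfl

/-- Evaluation of binary forms at a point of `PGL(2)`. -/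
def evalForm (k : Type) [Field k] (j : ℕ) (x : PGL(2, k)) : Module.Dual k (binaryForms k j) where
  toFun h := h.1 x
  map_add' _ _ := rfl
  map_smul' _ _ := rfl

/-- Evaluations span the dual, since a form killed by all of them is zero. For an evaluation at `x`
the matrix coefficient is the left translate `g ↦ h (x * g)` of a regular function. -/
theorem isRationalRep_binaryForms [Infinite k] (j : ℕ) : IsRationalRep (binaryFormsRep k j) := by
  intro f h
  have hf : f ∈ Submodule.span k (Set.range (evalForm k j)) := by
    rw [← Subspace.dualCoannihilator_dualAnnihilator_eq
      (W := Submodule.span k (Set.range (evalForm k j)))]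
    rw [Submodule.mem_dualAnnihilator]
    intro w hw
    have : w = 0 := by
      ext x
      exact (Submodule.mem_dualCoannihilator w).1 hw _ (Submodule.subset_span ⟨x, rfl⟩)
    rw [this, map_zero]
  induction hf using Submodule.span_induction with
  | mem f hf =>
    obtain ⟨x, rfl⟩ := hf
    exact h.2.regular.mul_left x
  | zero => exact IsRegularFun.const 0
  | add f f' _ _ hf hf' => exact hf.add hf'
  | smul c f _ hf => exact (IsRegularFun.const c).mul hf

/-- A functional on binary forms invariant under lower unipotents is proportional to the
evaluation at `1`. -/
theorem eq_smul_evalForm_one [CharZero k] {j : ℕ} (f : Module.Dual k (binaryForms k j))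
    (hf : ∀ r h, f (binaryFormsRep k j (lo r) h) = f h) :
    f = f (monomialBasis k j 0) • evalForm k j 1 := by
  -- `lo r` sends `x ^ (2 * j)` to `(x + r * y) ^ (2 * j)`. An invariant `f` takes a value
  -- independent of `r` on it, so `f` kills every monomial with `i > 0`, the binomial coefficients
  -- being invertible.
  have h0 : ∀ r : k, binaryFormsRep k j (lo r) (monomialBasis k j 0) =
      ∑ i : Fin (2 * j + 1), ((2 * j).choose i * r ^ (i : ℕ)) • monomialBasis k j i := by
    intro r
    refine binaryForms_eq_sum (c := fun i => (2 * j).choose i * r ^ i) _ fun s => ?_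
    rw [binaryFormsRep_apply, monomialBasis_apply, up, lo, pgl_mul, monomialForm_pgl (by simp)]
    simp only [mul_one, mul_zero, one_mul, zero_add, Fin.val_zero, pow_zero,
      Nat.sub_zero]
    rw [show 1 + s * r - s * r = (1 : k) by ring, one_pow, div_one, add_comm, add_pow]
    refine Finset.sum_congr rfl fun i _ => ?_
    rw [mul_pow, one_pow]
    ring
  have h1 : ∑ i : Fin (2 * j + 1), C ((2 * j).choose i * f (monomialBasis k j i)) * X ^ (i : ℕ) =
      C (f (monomialBasis k j 0)) :=
    polynomial_eq_of_forall_ne_zero fun r _ => by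
      have h2 := hf r (monomialBasis k j 0)
      rw [h0, map_sum] at h2
      simp only [eval_finsetSum, eval_mul, eval_C, eval_pow, eval_X, ← h2, map_smul, smul_eq_mul]
      exact Finset.sum_congr rfl fun i _ => by ring
  refine (monomialBasis k j).ext fun i => ?_
  have h2 := congrArg (fun q => q.coeff i) h1
  simp only [finsetSum_coeff, coeff_C_mul, coeff_X_pow, coeff_C] at h2
  have h3 : ((2 * j).choose i : k) ≠ 0 :=
    Nat.cast_ne_zero.2 (Nat.choose_pos (Nat.lt_succ_iff.1 i.2)).ne'
  have h4 : evalForm k j 1 (monomialBasis k j i) = if (i : ℕ) = 0 then 1 else 0 := by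
    change (monomialBasis k j i).1 1 = _
    rw [monomialBasis_apply, ← up_zero, monomialForm_up (Nat.lt_succ_iff.1 i.2), zero_pow_eq]
  rw [LinearMap.smul_apply, h4]
  rcases eq_or_ne i 0 with rfl | hi
  · simp
  · have hi' : (i : ℕ) ≠ 0 := fun h => hi (Fin.ext h)
    simp only [Fin.val_inj, mul_ite, mul_one, mul_zero, Finset.sum_ite_eq, Finset.mem_univ, if_true,
      if_neg hi'] at h2
    rw [if_neg hi', smul_zero]
    exact (mul_eq_zero.1 h2).resolve_left h3

end BinaryFormsRepresentation

/-! ### Frobenius reciprocity, self-duality and Schur's lemma for binary forms. -/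

section Frobenius

open Polynomial

variable {k : Type} [Field k] {V : Type} [AddCommGroup V] [Module k V]
  {ρ : Representation k PGL(2, k) V}

/-- Frobenius reciprocity: the map to binary forms given by a functional of lowest weight. -/
def frobeniusMap (hρ : IsRationalRep ρ) {j : ℕ} (f : Module.Dual k V)
    (hlo : ∀ r w, f (ρ (lo r) w) = f w) (hdi : ∀ (t : kˣ) w, f (ρ (di t) w) = (t : k) ^ (j : ℤ) * f w) :
    V →ₗ[k] binaryForms k j where
  toFun v := ⟨fun g => f (ρ g v), hρ f v, fun r g => by rw [map_mul, Module.End.mul_apply, hlo],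
    fun t g => by rw [map_mul, Module.End.mul_apply, hdi]⟩
  map_add' v w := by ext g; simp
  map_smul' c v := by ext g; simp

theorem weyl_inv_mul_lo (r : k) : lo (-r) * weyl = weyl * up r := by
  simp only [lo, weyl, up, pgl_mul]
  apply pgl_eq_pgl (u := 1) <;> simp

theorem di_inv_mul_weyl (t : kˣ) : (di t)⁻¹ * weyl = weyl * di t := by
  simp only [di, weyl, pgl_inv, pgl_mul]
  apply pgl_eq_pgl (u := 1) <;> simp

/-- The map from the dual to binary forms given by a vector of highest weight. -/
noncomputable def dualFrobeniusMap (hρ : IsRationalRep ρ) {j : ℕ} (v : V) (hup : ∀ s, ρ (up s) v = v)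
    (hdi : ∀ t : kˣ, ρ (di t) v = (t : k) ^ (j : ℤ) • v) : Module.Dual k V →ₗ[k] binaryForms k j where
  -- The Weyl element carries lower unipotents to upper ones and inverts the torus. Together with
  -- the inversion of `g` this gives the left transformation rule of a form of weight `j`, rather
  -- than one for the opposite subgroup.
  toFun ξ := ⟨fun g => ξ (ρ g⁻¹ (ρ weyl v)),
    (hρ ξ (ρ weyl v)).inv,
    fun r g => by
      rw [mul_inv_rev, lo_inv, map_mul, Module.End.mul_apply, ← Module.End.mul_apply (ρ (lo (-r))),
        ← map_mul, weyl_inv_mul_lo, map_mul ρ weyl, Module.End.mul_apply, hup],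
    fun t g => by
      rw [mul_inv_rev, map_mul, Module.End.mul_apply, ← Module.End.mul_apply (ρ (di t)⁻¹),
        ← map_mul, di_inv_mul_weyl, map_mul ρ weyl, Module.End.mul_apply, hdi, map_smul, map_smul,
        map_smul, smul_eq_mul]⟩
  map_add' ξ ζ := rfl
  map_smul' c ξ := rfl

variable [Module.Finite k V]

/-- The map from the dual of the space of binary forms given by a vector of highest weight. -/
noncomputable def highestWeightMap (hρ : IsRationalRep ρ) {j : ℕ} (v : V)
    (hup : ∀ s, ρ (up s) v = v) (hdi : ∀ t : kˣ, ρ (di t) v = (t : k) ^ (j : ℤ) • v) :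
    Module.Dual k (binaryForms k j) →ₗ[k] V :=
  (Module.evalEquiv k V).symm.toLinearMap ∘ₗ (dualFrobeniusMap hρ v hup hdi).dualMap

theorem dual_highestWeightMap (hρ : IsRationalRep ρ) {j : ℕ} (v : V)
    (hup : ∀ s, ρ (up s) v = v) (hdi : ∀ t : kˣ, ρ (di t) v = (t : k) ^ (j : ℤ) • v)
    (ξ : Module.Dual k V) (l : Module.Dual k (binaryForms k j)) :
    ξ (highestWeightMap hρ v hup hdi l) = l (dualFrobeniusMap hρ v hup hdi ξ) :=
  Module.apply_evalEquiv_symm_apply ..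

theorem highestWeightMap_dual (hρ : IsRationalRep ρ) {j : ℕ} (v : V)
    (hup : ∀ s, ρ (up s) v = v) (hdi : ∀ t : kˣ, ρ (di t) v = (t : k) ^ (j : ℤ) • v) (g : PGL(2, k))
    (l : Module.Dual k (binaryForms k j)) :
    highestWeightMap hρ v hup hdi ((binaryFormsRep k j).dual g l) =
      ρ g (highestWeightMap hρ v hup hdi l) := by
  rw [← sub_eq_zero, ← Module.forall_dual_apply_eq_zero_iff k]
  intro ξ
  have h1 := dual_highestWeightMap hρ v hup hdi (ξ ∘ₗ ρ g) l
  rw [map_sub, dual_highestWeightMap]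
  rw [LinearMap.comp_apply] at h1
  rw [h1, sub_eq_zero, Representation.dual_apply]
  change l _ = l _
  congr 1
  ext x
  change ξ (ρ (x * g⁻¹)⁻¹ _) = ξ (ρ g (ρ x⁻¹ _))
  rw [mul_inv_rev, inv_inv, map_mul, Module.End.mul_apply]

/-- Evaluation at `weyl` undoes the Weyl twist, which exhibits `v` in the image. -/
theorem highestWeightMap_evalForm_weyl (hρ : IsRationalRep ρ) {j : ℕ} (v : V)
    (hup : ∀ s, ρ (up s) v = v) (hdi : ∀ t : kˣ, ρ (di t) v = (t : k) ^ (j : ℤ) • v) :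
    highestWeightMap hρ v hup hdi (evalForm k j weyl) = v := by
  rw [← sub_eq_zero, ← Module.forall_dual_apply_eq_zero_iff k]
  intro ξ
  rw [map_sub, dual_highestWeightMap, sub_eq_zero]
  change ξ (ρ weyl⁻¹ (ρ weyl v)) = ξ v
  rw [← Module.End.mul_apply, ← map_mul, inv_mul_cancel, map_one, Module.End.one_apply]

/-- Every nonzero rational representation maps to some space of binary forms, and receives a map
from its dual, with nonzero composition. -/
theorem IsRationalRep.exists_maps [CharZero k] [Nontrivial V] (hρ : IsRationalRep ρ) :
    ∃ (j : ℕ) (r : V →ₗ[k] binaryForms k j) (i : Module.Dual k (binaryForms k j) →ₗ[k] V),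
      (∀ g v, r (ρ g v) = binaryFormsRep k j g (r v)) ∧
      (∀ g l, i ((binaryFormsRep k j).dual g l) = ρ g (i l)) ∧ r ∘ₗ i ≠ 0 := by
  obtain ⟨j, v, f, hfv, hup, hdi, hlo, hdi'⟩ := hρ.exists_highest_weight
  have hform : IsForm j (fun g => f (ρ g v)) := ⟨hρ f v, fun r g => by
    rw [map_mul, Module.End.mul_apply, hlo], fun t g => by rw [map_mul, Module.End.mul_apply, hdi']⟩
  obtain ⟨j, rfl⟩ := Int.eq_ofNat_of_zero_le (hform.weight_nonneg fun s => by rw [hup, hfv])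
  refine ⟨j, frobeniusMap hρ f hlo hdi', highestWeightMap hρ v hup hdi, fun g v => ?_,
    highestWeightMap_dual hρ v hup hdi, fun h => ?_⟩
  · ext x
    change f (ρ x (ρ g v)) = f (ρ (x * g) v)
    rw [map_mul, Module.End.mul_apply]
  -- The composite is tested on the evaluation at `weyl`: it goes to `v`, then to the form `g ↦ f (ρ
  -- g v)`, whose value at `1` is `f v = 1`.
  · have h1 := congrArg (fun T => (T (evalForm k j weyl)).1 1) h
    simp only [LinearMap.comp_apply, highestWeightMap_evalForm_weyl] at h1
    change f (ρ 1 v) = 0 at h1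
    rw [map_one, Module.End.one_apply, hfv] at h1
    exact one_ne_zero h1

/-- The representation on binary forms is self-dual. -/
theorem exists_dual_equiv_binaryForms [CharZero k] (j : ℕ) :
    ∃ e : Module.Dual k (binaryForms k j) ≃ₗ[k] binaryForms k j,
      ∀ g l, e ((binaryFormsRep k j).dual g l) = binaryFormsRep k j g (e l) := by
  have hup : ∀ s, binaryFormsRep k j (up s) (monomialBasis k j 0) = monomialBasis k j 0 := fun s => by
    ext x
    obtain ⟨a, b, c, d, h, rfl⟩ := exists_eq_pgl x
    rw [binaryFormsRep_apply, monomialBasis_apply, up, pgl_mul, monomialForm_pgl (by simp),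
      monomialForm_pgl (by simp)]
    simp only [mul_one, mul_zero, add_zero, Fin.val_zero, pow_zero]
    congr 2
    ring
  have hdi : ∀ t : kˣ, binaryFormsRep k j (di t) (monomialBasis k j 0) =
      (t : k) ^ (j : ℤ) • monomialBasis k j 0 := fun t => by
    ext x
    obtain ⟨a, b, c, d, h, rfl⟩ := exists_eq_pgl x
    rw [binaryFormsRep_apply, Submodule.coe_smul, Pi.smul_apply, monomialBasis_apply, di, pgl_mul,
      monomialForm_pgl (by simp), monomialForm_pgl (by simp)]
    have ht := t.ne_zero
    simp only [mul_one, mul_zero, add_zero, zero_add, Fin.val_zero, pow_zero, Nat.sub_zero, zpow_natCast,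
      smul_eq_mul]
    rw [show a * t * d - b * (c * t) = (t : k) * (a * d - b * c) by ring, mul_pow, mul_pow,
      ← mul_div_assoc, div_eq_div_iff (mul_ne_zero (pow_ne_zero _ ht) (pow_ne_zero _ h))
        (pow_ne_zero _ h), two_mul, pow_add (t : k)]
    ring
  -- `x ^ (2 * j)` is a highest weight vector. The map it induces from the dual is injective, hence
  -- bijective by equality of dimensions.
  let i := highestWeightMap (isRationalRep_binaryForms j) (monomialBasis k j 0) hup hdi
  have hinj : Function.Injective i := by
    rw [injective_iff_map_eq_zero]
    intro l hl
    -- Evaluation at `up y` goes to the form with dehomogenization `(s - y) ^ (2 * j)`. A functional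
    -- `l` in the kernel of `i` annihilates all these powers; expanding in `y`, it kills each
    -- monomial.
    have h0 : ∀ y : k, dualFrobeniusMap (isRationalRep_binaryForms j) (monomialBasis k j 0) hup hdi
        (evalForm k j (up y)) =
        ∑ i : Fin (2 * j + 1), ((2 * j).choose i * (-y) ^ (2 * j - i)) • monomialBasis k j i := by
      intro y
      refine binaryForms_eq_sum (c := fun i => (2 * j).choose i * (-y) ^ (2 * j - i)) _ fun s => ?_
      change (monomialBasis k j 0).1 (up y * (up s)⁻¹ * weyl) = _
      rw [monomialBasis_apply, up, up, weyl, pgl_inv, pgl_mul, pgl_mul, monomialForm_pgl (by simp)]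
      simp only [mul_one, mul_zero, add_zero, one_mul, zero_mul, zero_add, Fin.val_zero, pow_zero,
        Nat.sub_zero, neg_zero]
      rw [show (-s + y) * -1 = s + -y by ring, show (0 - -1) = (1 : k) by ring,
        one_pow, div_one, add_pow]
      exact Finset.sum_congr rfl fun i _ => by ring
    have h1 : ∑ i : Fin (2 * j + 1),
        C ((2 * j).choose i * l (monomialBasis k j i)) * X ^ (2 * j - i : ℕ) = 0 :=
      polynomial_eq_of_forall_ne_zero fun y _ => by
        have h2 := dual_highestWeightMap (isRationalRep_binaryForms j) (monomialBasis k j 0) hup hdi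
          (evalForm k j (up (-y))) l
        rw [h0, neg_neg, map_sum] at h2
        change evalForm k j (up (-y)) (i l) = _ at h2
        rw [hl, map_zero] at h2
        simp only [eval_finsetSum, eval_mul, eval_C, eval_pow, eval_X]
        rw [eval_zero, h2]
        exact Finset.sum_congr rfl fun i _ => by rw [map_smul, smul_eq_mul]; ring
    refine (monomialBasis k j).ext fun i => ?_
    have h2 := congrArg (fun q => q.coeff (2 * j - i)) h1
    simp only [finsetSum_coeff, coeff_C_mul, coeff_X_pow, coeff_zero] at h2
    have h3 : ((2 * j).choose i : k) ≠ 0 :=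
      Nat.cast_ne_zero.2 (Nat.choose_pos (Nat.lt_succ_iff.1 i.2)).ne'
    have h4 : ∀ x : Fin (2 * j + 1), (2 * j - (i : ℕ) = 2 * j - (x : ℕ)) ↔ i = x := fun x => by
      rw [Fin.ext_iff]
      omega
    simp only [h4, mul_ite, mul_one, mul_zero, Finset.sum_ite_eq, Finset.mem_univ, if_true] at h2
    exact (mul_eq_zero.1 h2).resolve_left h3
  exact ⟨LinearEquiv.ofInjectiveOfFinrankEq i hinj Subspace.dual_finrank_eq,
    highestWeightMap_dual (isRationalRep_binaryForms j) _ hup hdi⟩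

/-- Equivariant maps between spaces of binary forms are scalar. -/
theorem equivariant_binaryForms [CharZero k] {i j : ℕ} (φ : binaryForms k i →ₗ[k] binaryForms k j)
    (hφ : ∀ g h, φ (binaryFormsRep k i g h) = binaryFormsRep k j g (φ h)) :
    ∃ c : k, (c ≠ 0 → i = j) ∧ ∀ h, (φ h).1 = c • h.1 := by
  -- `h ↦ (φ h) 1` is invariant under lower unipotents, hence a multiple of evaluation at `1`;
  -- translating by `g` determines `φ` everywhere.
  have h1 := eq_smul_evalForm_one (evalForm k j 1 ∘ₗ φ) fun r h => by
    rw [LinearMap.comp_apply, hφ]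
    change (φ h).1 (1 * lo r) = (φ h).1 1
    rw [one_mul, ← mul_one (lo r), (φ h).2.lo_mul]
  have h2 : ∀ h g, (φ h).1 g =
      (evalForm k j 1 ∘ₗ φ) (monomialBasis k i 0) * h.1 g := fun h g => by
    have := LinearMap.congr_fun h1 (binaryFormsRep k i g h)
    rw [LinearMap.comp_apply, hφ] at this
    change (φ h).1 (1 * g) = _ * h.1 (1 * g) at this
    rwa [one_mul] at this
  refine ⟨_, fun hc => ?_, fun h => funext fun g => h2 h g⟩
  -- If the scalar is nonzero, the weights agree: comparing the actions of `di 2` gives `2 ^ i = 2 ^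
  -- j`.
  have h3 := (φ (monomialBasis k i 0)).2.di_mul (Units.mk0 2 two_ne_zero) 1
  have h4 := (monomialBasis k i 0).2.di_mul (Units.mk0 2 two_ne_zero) 1
  have h5 : (monomialBasis k i 0).1 1 = 1 := by
    rw [monomialBasis_apply, ← up_zero, monomialForm_up (by simp)]
    simp
  rw [h2, h2, h4, h5, mul_one, mul_one, mul_comm] at h3
  have h6 := mul_right_cancel₀ hc h3
  simp only [Units.val_mk0, zpow_natCast] at h6
  have h7 : (2 ^ i : ℕ) = 2 ^ j := by exact_mod_cast h6
  exact Nat.pow_right_injective le_rfl h7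

end Frobenius

/-! ### The category of rational representations -/

section Category

variable {k : Type} [Field k] {U V W : RepPGL₂ k}

/-- The linear map underlying a morphism of rational representations. -/
def toLin (f : V ⟶ W) : V.obj →ₗ[k] W.obj := f.hom.hom.hom.hom

theorem toLin_injective : Function.Injective (toLin : (V ⟶ W) → _) := fun f g h => by
  apply ObjectProperty.hom_ext
  apply Action.Hom.ext
  apply InducedCategory.hom_ext
  exact ModuleCat.hom_ext h

theorem toLin_ρ (f : V ⟶ W) (g : PGL(2, k)) (v : V.obj) :
    toLin f (V.obj.ρ g v) = W.obj.ρ g (toLin f v) :=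
  ConcreteCategory.congr_hom (f.hom.comm g) v

/-- The morphism of rational representations given by an equivariant linear map. -/
def ofLin (f : V.obj →ₗ[k] W.obj) (h : ∀ g v, f (V.obj.ρ g v) = W.obj.ρ g (f v)) : V ⟶ W :=
  ObjectProperty.homMk ⟨InducedCategory.homMk (ModuleCat.ofHom f), fun g => by
    ext v
    exact h g v⟩

theorem toLin_comp (f : U ⟶ V) (g : V ⟶ W) : toLin (f ≫ g) = toLin g ∘ₗ toLin f := rfl

theorem toLin_add (f g : V ⟶ W) : toLin (f + g) = toLin f + toLin g := by
  change (f + g).hom.hom.hom.hom = _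
  rfl

theorem toLin_sub (f g : V ⟶ W) : toLin (f - g) = toLin f - toLin g := by
  rw [eq_sub_iff_add_eq, ← toLin_add, sub_add_cancel]

theorem toLin_sum {ι : Type*} (s : Finset ι) (f : ι → (V ⟶ W)) :
    toLin (∑ i ∈ s, f i) = ∑ i ∈ s, toLin (f i) :=
  map_sum (AddMonoidHom.mk' toLin toLin_add) f s

/-- The object given by a rational representation. -/
noncomputable def repOf {V : Type} [AddCommGroup V] [Module k V] [Module.Finite k V]
    (ρ : Representation k PGL(2, k) V) (hρ : IsRationalRep ρ) : RepPGL₂ k :=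
  ⟨FDRep.of ρ, hρ⟩

theorem isRationalRep_ρ (V : RepPGL₂ k) : IsRationalRep V.obj.ρ := V.property

theorem IsRationalRep.dual {V : Type} [AddCommGroup V] [Module k V] [Module.Finite k V]
    {ρ : Representation k PGL(2, k) V} (hρ : IsRationalRep ρ) : IsRationalRep ρ.dual := by
  intro f ξ
  convert (hρ ξ ((Module.evalEquiv k V).symm f)).inv using 2 with g
  have := Module.apply_evalEquiv_symm_apply k V (ξ ∘ₗ ρ g⁻¹) f
  rw [LinearMap.comp_apply] at this
  rw [this]
  rfl

theorem IsRationalRep.of_injective {V V' : Type} [AddCommGroup V] [Module k V] [AddCommGroup V']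
    [Module k V'] {ρ : Representation k PGL(2, k) V} {ρ' : Representation k PGL(2, k) V'}
    (hρ : IsRationalRep ρ) (i : V' →ₗ[k] V) (hi : Function.Injective i)
    (h : ∀ g v, i (ρ' g v) = ρ g (i v)) : IsRationalRep ρ' := by
  intro f v
  obtain ⟨F, hF⟩ := LinearMap.exists_leftInverse_of_injective i (LinearMap.ker_eq_bot.2 hi)
  convert hρ (f ∘ₗ F) (i v) using 2 with g
  rw [← h, LinearMap.comp_apply, ← LinearMap.comp_apply F, hF, LinearMap.id_apply]

/-- The dual object. -/
noncomputable def dualRep (V : RepPGL₂ k) : RepPGL₂ k :=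
  repOf (Representation.dual V.obj.ρ) (isRationalRep_ρ V).dual

theorem toLin_associator_hom : toLin (α_ U V W).hom =
    (TensorProduct.assoc k U.obj V.obj W.obj).toLinearMap :=
  TensorProduct.ext_threefold (fun _ _ _ => rfl)

theorem toLin_associator_inv : toLin (α_ U V W).inv =
    (TensorProduct.assoc k U.obj V.obj W.obj).symm.toLinearMap := by
  apply LinearMap.ext
  intro x
  apply (TensorProduct.assoc k U.obj V.obj W.obj).injective
  have h1 := LinearMap.congr_fun (congrArg toLin (α_ U V W).inv_hom_id) x
  rw [toLin_comp, toLin_associator_hom] at h1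
  refine h1.trans ?_
  exact ((TensorProduct.assoc k U.obj V.obj W.obj).apply_symm_apply x).symm

theorem toLin_leftUnitor_hom : toLin (λ_ U).hom = (TensorProduct.lid k U.obj).toLinearMap :=
  TensorProduct.ext' (fun _ _ => rfl)

theorem toLin_rightUnitor_hom : toLin (ρ_ U).hom = (TensorProduct.rid k U.obj).toLinearMap :=
  TensorProduct.ext' (fun _ _ => rfl)

section
variable {G V : Type*} [Group G] [AddCommGroup V] [Module k V]
  (ρ : Representation k G V) (g : G)

theorem contractLeft_map (x) :
    contractLeft k V (TensorProduct.map (ρ.dual g) (ρ g) x) = contractLeft k V x := by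
  induction x using TensorProduct.induction_on with
  | zero => simp
  | add x y hx hy => rw [map_add, map_add, hx, hy, map_add]
  | tmul ξ v =>
    rw [TensorProduct.map_tmul, contractLeft_apply, contractLeft_apply, Representation.dual_apply]
    change ξ (ρ g⁻¹ (ρ g v)) = _
    rw [← Module.End.mul_apply, ← map_mul, inv_mul_cancel, map_one, Module.End.one_apply]

variable [Module.Finite k V]

/-- Under `V ⊗ V* ≅ End V` the coevaluation is the identity and `g` acts by conjugation. -/
theorem map_coevaluation (c : k) :
    TensorProduct.map (ρ g) (ρ.dual g) (coevaluation k V c) = coevaluation k V c := by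
  have key : ∀ x : TensorProduct k V (Module.Dual k V),
      dualTensorHomEquiv k V V (TensorProduct.comm k _ _ (TensorProduct.map (ρ g) (ρ.dual g) x)) =
        ρ g ∘ₗ dualTensorHomEquiv k V V (TensorProduct.comm k _ _ x) ∘ₗ ρ g⁻¹ := by
    intro x
    induction x using TensorProduct.induction_on with
    | zero => simp
    | add x y hx hy => simp only [map_add, hx, hy, LinearMap.add_comp, LinearMap.comp_add]
    | tmul v ξ =>
      ext w
      simp
      rfl
  have h1 : dualTensorHomEquiv k V V (TensorProduct.comm k _ _ (coevaluation k V c)) = c • LinearMap.id := by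
    rw [← mul_one c, ← smul_eq_mul, map_smul, coevaluation_apply_one, map_smul, map_smul, smul_eq_mul, mul_one]
    congr 1
    apply (Module.Basis.ofVectorSpace k V).ext
    intro i
    simpa using (Module.Basis.ofVectorSpace k V).sum_repr i
  apply (TensorProduct.comm k V (Module.Dual k V)).injective
  apply (dualTensorHomEquiv k V V).injective
  rw [key, h1]
  ext v
  simp [← Module.End.mul_apply, ← map_mul]

end

/-- The evaluation and coevaluation of a rational representation. -/
noncomputable abbrev dualRepPairing (V : RepPGL₂ k) : ExactPairing V (dualRep V) where
  coevaluation' := ofLin (V := 𝟙_ _) (W := V ⊗ dualRep V) (coevaluation k V.obj) (fun g c =>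
    (map_coevaluation V.obj.ρ g c).symm)
  evaluation' := ofLin (V := dualRep V ⊗ V) (W := 𝟙_ _) (contractLeft k V.obj)
    (contractLeft_map V.obj.ρ)
  coevaluation_evaluation' := toLin_injective (by
    rw [toLin_comp, toLin_comp, toLin_comp, toLin_associator_inv, toLin_rightUnitor_hom]
    exact contractLeft_assoc_coevaluation k V.obj)
  evaluation_coevaluation' := toLin_injective (by
    rw [toLin_comp, toLin_comp, toLin_comp, toLin_associator_hom, toLin_leftUnitor_hom]
    exact contractLeft_assoc_coevaluation' k V.obj)

/-- The space of binary forms as a rational representation. -/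
noncomputable def formRep (k : Type) [Field k] [CharZero k] (j : ℕ) : RepPGL₂ k :=
  repOf (binaryFormsRep k j) (isRationalRep_binaryForms j)

section
variable {G ι : Type*} {V : ι → Type*} [Monoid G] [∀ i, AddCommGroup (V i)] [∀ i, Module k (V i)]

/-- The product of representations. -/
def piRep (ρ : ∀ i, Representation k G (V i)) : Representation k G (∀ i, V i) where
  toFun g := LinearMap.pi fun i => ρ i g ∘ₗ LinearMap.proj i
  map_one' := by ext; simp
  map_mul' g h := by
    apply LinearMap.ext
    intro v
    ext i
    simp

theorem single_piRep [DecidableEq ι] (ρ : ∀ i, Representation k G (V i)) (i : ι) (g : G) (v : V i) :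
    LinearMap.single k V i (ρ i g v) = piRep ρ g (LinearMap.single k V i v) := by
  funext l
  change Pi.single i (ρ i g v) l = ρ l g (Pi.single i v l)
  rcases eq_or_ne l i with rfl | h
  · rw [Pi.single_eq_same, Pi.single_eq_same]
  · rw [Pi.single_eq_of_ne h, Pi.single_eq_of_ne h, map_zero]
end

theorem IsRationalRep.pi {ι : Type} [Finite ι] {V : ι → Type} [∀ i, AddCommGroup (V i)]
    [∀ i, Module k (V i)] {ρ : ∀ i, Representation k PGL(2, k) (V i)} (hρ : ∀ i, IsRationalRep (ρ i)) :
    IsRationalRep (piRep ρ) := by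
  classical
  have := Fintype.ofFinite ι
  intro f v
  have : (fun g => f (piRep ρ g v)) = fun g => ∑ i, (f ∘ₗ LinearMap.single k V i) (ρ i g (v i)) := by
    funext g
    conv_lhs => rw [← Finset.univ_sum_single (piRep ρ g v), map_sum]
    rfl
  rw [this]
  exact IsRegularFun.sum _ fun i _ => hρ i _ _

theorem hasFiniteBiproducts_repPGL₂ : HasFiniteBiproducts (RepPGL₂ k) where
  out n := ⟨fun V => by
    let P : RepPGL₂ k := repOf (piRep fun i => (V i).obj.ρ) (.pi fun i => isRationalRep_ρ (V i))
    let b : Bicone V :=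
      { pt := P
        π := fun i => ofLin (V := P) (W := V i) (LinearMap.proj i) fun g v => rfl
        ι := fun i => ofLin (V := V i) (W := P) (LinearMap.single k (fun l => (V l).obj) i) fun g v =>
          single_piRep (fun l => (V l).obj.ρ) i g v
        ι_π := fun i j => toLin_injective <| LinearMap.ext fun v => by
          change Pi.single (M := fun l => (V l).obj) i v j = _
          split_ifs with h
          · subst h
            exact Pi.single_eq_same ..
          · exact Pi.single_eq_of_ne (Ne.symm h) _ }
    refine HasBiproduct.mk ⟨b, isBilimitOfTotal b (toLin_injective ?_)⟩
    rw [toLin_sum]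
    apply LinearMap.ext
    intro v
    rw [LinearMap.sum_apply]
    exact Finset.univ_sum_single (M := fun i => (V i).obj) v⟩

end Category

/-! ### Semisimplicity -/

section Decomposition

universe v u

variable {R : Type*} [CommRing R] {C : Type u} [Category.{v} C] [Preadditive C] [Linear R C]
  {I : Type*} {X : I → C}

theorem IsSimpleBasis.exists_decomposition (h : IsSimpleBasis R X) (Y : C) :
    ∃ (n : ℕ) (s : Fin n → I) (i : ∀ a, X (s a) ⟶ Y) (r : ∀ a, Y ⟶ X (s a)),
      (∀ a, i a ≫ r a = 𝟙 _) ∧ (∀ a b, a ≠ b → i a ≫ r b = 0) ∧ ∑ a, r a ≫ i a = 𝟙 Y := by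
  obtain ⟨n, s, b, ⟨hb⟩, ⟨e⟩⟩ := h.directSum Y
  refine ⟨n, s, fun a => b.ι a ≫ e.hom, fun a => e.inv ≫ b.π a, fun a => ?_, fun a b' hab => ?_, ?_⟩
  · simp
  · simp [b.ι_π, hab]
  · simp only [Category.assoc]
    rw [← Preadditive.comp_sum]
    simp only [← Category.assoc]
    rw [← Preadditive.sum_comp]
    rw [IsBilimit.total hb]
    simp

theorem exists_bilimit_of_decomposition {Y : C} {n : ℕ} {s : Fin n → I} (i : ∀ a, X (s a) ⟶ Y)
    (r : ∀ a, Y ⟶ X (s a)) (h1 : ∀ a, i a ≫ r a = 𝟙 _) (h0 : ∀ a b, a ≠ b → i a ≫ r b = 0)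
    (ht : ∑ a, r a ≫ i a = 𝟙 Y) :
    ∃ b : Bicone (fun a => X (s a)), Nonempty b.IsBilimit ∧ Nonempty (b.pt ≅ Y) :=
  let b : Bicone (fun a => X (s a)) :=
    { pt := Y
      π := r
      ι := i
      ι_π := fun a b => by
        split_ifs with h
        · subst h
          simp [h1]
        · exact h0 a b h }
  ⟨b, ⟨isBilimitOfTotal b ht⟩, ⟨Iso.refl _⟩⟩

end Decomposition

section Semisimplicity

variable {k : Type} [Field k]

/-- The complement is the kernel of `r`, with projection `1 - r ≫ i`; it is rational as a
subrepresentation. -/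
theorem exists_complement {V W : RepPGL₂ k} (i : W ⟶ V) (r : V ⟶ W) (hir : i ≫ r = 𝟙 _) :
    ∃ (K : RepPGL₂ k) (i' : K ⟶ V) (r' : V ⟶ K), i' ≫ r' = 𝟙 _ ∧ i ≫ r' = 0 ∧ i' ≫ r = 0 ∧
      r ≫ i + r' ≫ i' = 𝟙 _ := by
  let ρK : Representation k PGL(2, k) (LinearMap.ker (toLin r)) :=
    { toFun := fun g => (V.obj.ρ g).restrict (p := LinearMap.ker (toLin r))
        (q := LinearMap.ker (toLin r)) fun v hv => by
          rw [LinearMap.mem_ker] at hv ⊢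
          rw [toLin_ρ, hv, map_zero]
      map_one' := by
        ext v
        exact LinearMap.congr_fun (map_one V.obj.ρ) v.1
      map_mul' := fun g h => by
        ext v
        exact LinearMap.congr_fun (map_mul V.obj.ρ g h) v.1 }
  have hρK : IsRationalRep ρK := (isRationalRep_ρ V).of_injective
    (LinearMap.ker (toLin r)).subtype Subtype.val_injective fun g v => rfl
  have hir' : ∀ w, toLin r (toLin i w) = w := fun w => LinearMap.congr_fun (congrArg toLin hir) w
  let i' : repOf ρK hρK ⟶ V := ofLin (V := repOf ρK hρK) (LinearMap.ker (toLin r)).subtype fun g v => rfl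
  let r' : V ⟶ repOf ρK hρK := ofLin (W := repOf ρK hρK) (LinearMap.codRestrict (LinearMap.ker (toLin r))
    (LinearMap.id - toLin i ∘ₗ toLin r) fun v => by
      rw [LinearMap.mem_ker, LinearMap.sub_apply, map_sub, LinearMap.comp_apply, hir', LinearMap.id_apply,
        sub_self]) fun g v => Subtype.ext <| by
      change V.obj.ρ g v - toLin i (toLin r (V.obj.ρ g v)) = V.obj.ρ g (v - toLin i (toLin r v))
      rw [toLin_ρ, toLin_ρ, map_sub]
  have hr'i' : r' ≫ i' = 𝟙 _ - r ≫ i := by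
    apply toLin_injective
    rw [toLin_sub]
    rfl
  refine ⟨repOf ρK hρK, i', r', toLin_injective (LinearMap.ext fun v => Subtype.ext ?_),
    toLin_injective (LinearMap.ext fun v => Subtype.ext ?_),
    toLin_injective (LinearMap.ext fun v => v.2), ?_⟩
  · change v.1 - toLin i (toLin r v.1) = v.1
    rw [show toLin r v.1 = 0 from v.2, map_zero, sub_zero]
  · change toLin i v - toLin i (toLin r (toLin i v)) = 0
    rw [hir', sub_self]
  · rw [hr'i', add_sub_cancel]

variable [CharZero k]

theorem hom_formRep {i j : ℕ} (f : formRep k i ⟶ formRep k j) :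
    ∃ c : k, (c ≠ 0 → i = j) ∧ ∀ h : binaryForms k i, (toLin f h : binaryForms k j).1 = c • h.1 :=
  equivariant_binaryForms (toLin f) (toLin_ρ f)

theorem formRep_end (j : ℕ) :
    Function.Bijective (fun c : k => c • 𝟙 (formRep k j)) := by
  constructor
  · intro c c' h
    have h1 := LinearMap.congr_fun (congrArg toLin h) (monomialBasis k j 0)
    change c • monomialBasis k j 0 = c' • monomialBasis k j 0 at h1
    exact smul_left_injective k ((monomialBasis k j).ne_zero 0) h1
  · intro f
    obtain ⟨c, -, hc⟩ := hom_formRep f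
    exact ⟨c, toLin_injective (LinearMap.ext fun h => Subtype.ext (hc h).symm)⟩

theorem formRep_hom_zero {i j : ℕ} (hij : i ≠ j) (f : formRep k i ⟶ formRep k j) : f = 0 := by
  obtain ⟨c, h0, hc⟩ := hom_formRep f
  have : c = 0 := by
    by_contra h
    exact hij (h0 h)
  subst this
  refine toLin_injective (LinearMap.ext fun h => Subtype.ext ?_)
  refine (hc h).trans ?_
  rw [zero_smul]
  rfl

theorem id_formRep_ne_zero (j : ℕ) : 𝟙 (formRep k j) ≠ 0 := fun h =>
  one_ne_zero ((formRep_end (k := k) j).1 (by simp [h] : (1 : k) • 𝟙 (formRep k j) = (0 : k) • 𝟙 _))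

/-- Spaces of binary forms are self-dual. -/
theorem nonempty_dualRep_iso (j : ℕ) : Nonempty (formRep k j ≅ dualRep (formRep k j)) := by
  obtain ⟨e, he⟩ := exists_dual_equiv_binaryForms (k := k) j
  refine ⟨⟨ofLin (V := formRep k j) (W := dualRep (formRep k j)) e.symm.toLinearMap fun g h => ?_,
    ofLin (V := dualRep (formRep k j)) (W := formRep k j) e.toLinearMap he,
    toLin_injective ?_, toLin_injective ?_⟩⟩
  · apply e.injective
    refine (e.apply_symm_apply _).trans ?_
    refine Eq.trans ?_ (he g (e.symm h)).symm
    exact congrArg (binaryFormsRep k j g) (e.apply_symm_apply h).symm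
  · exact LinearMap.ext e.apply_symm_apply
  · exact LinearMap.ext e.symm_apply_apply

/-- Self-duality turns `B* → V → B` into a nonzero endomorphism of the space `B` of binary forms. It
is a nonzero scalar by Schur's lemma, and dividing by it gives a retraction. -/
theorem exists_formRep_retract (V : RepPGL₂ k) [Nontrivial V.obj] :
    ∃ (j : ℕ) (i : formRep k j ⟶ V) (r : V ⟶ formRep k j), i ≫ r = 𝟙 _ := by
  obtain ⟨j, r, i, hr, hi, hri⟩ := (isRationalRep_ρ V).exists_maps
  obtain ⟨e⟩ := nonempty_dualRep_iso (k := k) j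
  let r' : V ⟶ formRep k j := ofLin r hr
  let i' : dualRep (formRep k j) ⟶ V := ofLin (V := dualRep (formRep k j)) i hi
  obtain ⟨c, hc⟩ := (formRep_end (k := k) j).2 (e.hom ≫ i' ≫ r')
  have hc0 : c ≠ 0 := by
    rintro rfl
    simp only [zero_smul] at hc
    have h1 : i' ≫ r' = 0 := by
      rw [← cancel_epi e.hom, ← hc, comp_zero]
    exact hri (congrArg toLin h1)
  refine ⟨j, c⁻¹ • (e.hom ≫ i'), r', ?_⟩
  simp only [Linear.smul_comp, Category.assoc]
  rw [← hc, smul_smul, inv_mul_cancel₀ hc0, one_smul]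

theorem exists_formRep_decomposition (V : RepPGL₂ k) :
    ∃ (n : ℕ) (s : Fin n → ℕ) (i : ∀ a, formRep k (s a) ⟶ V) (r : ∀ a, V ⟶ formRep k (s a)),
      (∀ a, i a ≫ r a = 𝟙 _) ∧ (∀ a b, a ≠ b → i a ≫ r b = 0) ∧ ∑ a, r a ≫ i a = 𝟙 V := by
  induction hd : Module.finrank k V.obj using Nat.strong_induction_on generalizing V with
  | _ d ih =>
  rcases subsingleton_or_nontrivial V.obj with hV | hV
  · exact ⟨0, Fin.elim0, fun a => a.elim0, fun a => a.elim0, fun a => a.elim0, fun a => a.elim0,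
      toLin_injective (LinearMap.ext fun v => Subsingleton.elim _ _)⟩
  obtain ⟨j, i, r, hir⟩ := exists_formRep_retract V
  obtain ⟨K, i', r', h1, h2, h3, h4⟩ := exists_complement i r hir
  have hlt : Module.finrank k K.obj < d := by
    rw [← hd]
    have hinj : Function.Injective (toLin i') := Function.LeftInverse.injective (g := toLin r')
      fun v => LinearMap.congr_fun (congrArg toLin h1) v
    have hle : LinearMap.range (toLin i') ≤ LinearMap.ker (toLin r) := by
      rintro _ ⟨v, rfl⟩
      exact LinearMap.congr_fun (congrArg toLin h3) v
    have hne : LinearMap.ker (toLin r) ≠ ⊤ := fun h => by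
      have h0 : toLin r = 0 := LinearMap.ker_eq_top.1 h
      have : r = 0 := toLin_injective h0
      rw [this, comp_zero] at hir
      exact id_formRep_ne_zero j hir.symm
    rw [← LinearMap.finrank_range_of_inj hinj]
    exact (Submodule.finrank_mono hle).trans_lt (Submodule.finrank_lt hne)
  obtain ⟨n, s, ι, π, H1, H2, H3⟩ := ih _ hlt K rfl
  refine ⟨n + 1, Fin.cons j s, Fin.cases i fun a => ι a ≫ i', Fin.cases r fun a => r' ≫ π a, ?_, ?_, ?_⟩
  · intro a
    cases a using Fin.cases with
    | zero => exact hir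
    | succ a =>
      change (ι a ≫ i') ≫ r' ≫ π a = 𝟙 _
      rw [Category.assoc, reassoc_of% h1, H1]
  · intro a b hab
    cases a using Fin.cases with
    | zero =>
      cases b using Fin.cases with
      | zero => exact absurd rfl hab
      | succ b =>
        change i ≫ r' ≫ π b = 0
        rw [reassoc_of% h2, zero_comp]
    | succ a =>
      cases b using Fin.cases with
      | zero =>
        change (ι a ≫ i') ≫ r = 0
        rw [Category.assoc, h3, comp_zero]
      | succ b =>
        change (ι a ≫ i') ≫ r' ≫ π b = 0
        rw [Category.assoc, reassoc_of% h1, H2 a b fun h => hab (congrArg Fin.succ h)]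
  · rw [Fin.sum_univ_succ]
    change r ≫ i + ∑ a, (r' ≫ π a) ≫ ι a ≫ i' = 𝟙 V
    rw [← h4]
    congr 1
    calc ∑ a, (r' ≫ π a) ≫ ι a ≫ i' = r' ≫ (∑ a, π a ≫ ι a) ≫ i' := by
          rw [Preadditive.sum_comp, Preadditive.comp_sum]
          simp only [Category.assoc]
      _ = r' ≫ i' := by rw [H3, Category.id_comp]

theorem isSimpleBasis_formRep : IsSimpleBasis k (fun j : ULift.{1} ℕ => formRep k j.down) where
  end_scalar j := formRep_end j.down
  hom_zero i j hij := formRep_hom_zero fun h => hij (ULift.ext _ _ h)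
  directSum V := by
    obtain ⟨n, s, i, r, h1, h0, ht⟩ := exists_formRep_decomposition V
    obtain ⟨b, hb⟩ := exists_bilimit_of_decomposition (X := fun j : ULift.{1} ℕ => formRep k j.down)
      (s := fun a => ULift.up (s a)) i r h1 h0 ht
    exact ⟨n, _, b, hb⟩

theorem isSemisimpleTensorCategory_repPGL₂ : IsSemisimpleTensorCategory k (RepPGL₂ k) where
  hasFiniteBiproducts := hasFiniteBiproducts_repPGL₂
  exists_simpleBasis := ⟨_, _, isSimpleBasis_formRep⟩
  end_unit := by
    constructor
    · intro c c' h
      have h1 : c * 1 = c' * 1 := LinearMap.congr_fun (congrArg toLin h) (1 : k)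
      simpa using h1
    · intro f
      refine ⟨toLin f (1 : k), toLin_injective ?_⟩
      apply LinearMap.ext_ring
      change toLin f (1 : k) * 1 = toLin f (1 : k)
      exact mul_one _
  exists_rightDual V := ⟨dualRep V, ⟨dualRepPairing V⟩⟩
  exists_leftDual V := ⟨dualRep V, ⟨by
    have := dualRepPairing V
    exact BraidedCategory.exactPairing_swap V (dualRep V)⟩⟩

/-- A nonzero source `Y` contains some `formRep j'` as a retract. Its composite with the
monomorphism is nonzero, so `j' = j` and the composite is an invertible scalar, which splits `f`. -/
theorem simple_formRep (j : ℕ) : Simple (formRep k j) where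
  mono_isIso_iff_nonzero {Y} f hf := by
    constructor
    · rintro hiso rfl
      have := IsIso.inv_hom_id (0 : Y ⟶ formRep k j)
      rw [comp_zero] at this
      exact id_formRep_ne_zero j this.symm
    · intro hf0
      have : Nontrivial Y.obj := by
        by_contra h
        rw [not_nontrivial_iff_subsingleton] at h
        refine hf0 (toLin_injective (LinearMap.ext fun v => ?_))
        rw [Subsingleton.elim v 0, map_zero, map_zero]
      obtain ⟨j', i, r, hir⟩ := exists_formRep_retract Y
      have hne : i ≫ f ≠ 0 := fun h => by
        have : i = 0 := by rw [← cancel_mono f, h, zero_comp]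
        rw [this, zero_comp] at hir
        exact id_formRep_ne_zero j' hir.symm
      obtain rfl : j' = j := by
        by_contra h
        exact hne (formRep_hom_zero h _)
      obtain ⟨c, hc⟩ := (formRep_end (k := k) j').2 (i ≫ f)
      have hc0 : c ≠ 0 := by
        rintro rfl
        exact hne (by rw [← hc]; exact zero_smul _ _)
      have : IsSplitEpi f := ⟨⟨⟨c⁻¹ • i, by
        rw [Linear.smul_comp, ← hc, smul_smul, inv_mul_cancel₀ hc0, one_smul]⟩⟩⟩
      exact isIso_of_mono_of_isSplitEpi f

theorem exists_iso_formRep (S : RepPGL₂ k) [Simple S] : ∃ j, Nonempty (S ≅ formRep k j) := by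
  have : Nontrivial S.obj := by
    by_contra h
    rw [not_nontrivial_iff_subsingleton] at h
    exact id_nonzero S (toLin_injective (LinearMap.ext fun v => Subsingleton.elim _ _))
  obtain ⟨j, i, r, hir⟩ := exists_formRep_retract S
  have : IsSplitMono i := ⟨⟨⟨r, hir⟩⟩⟩
  have : IsIso i := isIso_of_mono_of_nonzero fun h => by
    rw [h, zero_comp] at hir
    exact id_formRep_ne_zero j hir.symm
  exact ⟨j, ⟨(asIso i).symm⟩⟩

theorem repDim_formRep (j : ℕ) : repDim (formRep k j) = 2 * j + 1 := finrank_binaryForms j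

end Semisimplicity

/-! ### Extension of scalars -/

section ScalarExtension

universe v u v' u' v₀ u₀

section SimpleBasis

variable {R : Type*} [CommRing R] {C : Type u} [Category.{v} C] [Preadditive C] [Linear R C]
  {I : Type*} {X : I → C}

/-- Over a ring `f` itself need not split. It only detects a summand of `B` to which it has a
nonzero component; that summand must be `X i₀`, and its own inclusion and projection are the answer.
This is the source of integrality. -/
theorem IsSimpleBasis.exists_retract (hX : IsSimpleBasis R X) {A B : C} {i₀ : I} (e : A ≅ X i₀)
    {f : A ⟶ B} (hf : f ≠ 0) : ∃ (i : A ⟶ B) (r : B ⟶ A), i ≫ r = 𝟙 A := by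
  obtain ⟨m, t, i', r', h1', h0', ht'⟩ := hX.exists_decomposition B
  obtain ⟨b, hb⟩ : ∃ b, f ≫ r' b ≠ 0 := by
    by_contra! hall
    refine hf ?_
    rw [← Category.comp_id f, ← ht', Preadditive.comp_sum]
    refine Finset.sum_eq_zero fun b _ => ?_
    rw [reassoc_of% hall b, zero_comp]
  have hi : i₀ = t b := by
    by_contra hne
    refine hb ?_
    rw [← cancel_epi e.inv, comp_zero]
    exact hX.hom_zero _ _ hne _
  subst hi
  exact ⟨e.hom ≫ i' b, r' b ≫ e.inv, by simp [reassoc_of% h1' b]⟩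

theorem IsSimpleBasis.end_scalar_of_iso (hX : IsSimpleBasis R X) {A : C} {i₀ : I} (e : A ≅ X i₀)
    (f : A ⟶ A) : ∃ r : R, f = r • 𝟙 A := by
  obtain ⟨r, hr⟩ := (hX.end_scalar i₀).2 (e.inv ≫ f ≫ e.hom)
  refine ⟨r, ?_⟩
  rw [← cancel_mono e.hom, ← cancel_epi e.inv, ← hr]
  simp

end SimpleBasis

section Basic

variable {R S : Type*} [CommRing R] [CommRing S] {φ : R →+* S}
  {C : Type u} [Category.{v} C] [Preadditive C] [Linear R C] [MonoidalCategory C]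
  {D : Type u'} [Category.{v'} D] [Preadditive D] [Linear S D] [MonoidalCategory D]
  {F : C ⥤ D}

theorem IsScalarExtension.map_smul (h : IsScalarExtension φ F) {X Y : C} (r : R) (f : X ⟶ Y) :
    F.map (r • f) = φ r • F.map f := by
  obtain ⟨l, hl, -⟩ := h.baseChange X Y
  rw [← hl, ← hl, map_smulₛₗ]

theorem IsScalarExtension.map_zero (h : IsScalarExtension φ F) (X Y : C) :
    F.map (0 : X ⟶ Y) = 0 := by
  obtain ⟨l, hl, -⟩ := h.baseChange X Y
  rw [← hl, _root_.map_zero]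

theorem IsScalarExtension.map_sub (h : IsScalarExtension φ F) {X Y : C} (f g : X ⟶ Y) :
    F.map (f - g) = F.map f - F.map g := by
  obtain ⟨l, hl, -⟩ := h.baseChange X Y
  rw [← hl, ← hl, ← hl, _root_.map_sub]

theorem IsScalarExtension.map_sum (h : IsScalarExtension φ F) {X Y : C} {ι : Type*} (s : Finset ι)
    (f : ι → (X ⟶ Y)) : F.map (∑ i ∈ s, f i) = ∑ i ∈ s, F.map (f i) := by
  obtain ⟨l, hl, -⟩ := h.baseChange X Y
  simp only [← hl, _root_.map_sum]

theorem IsScalarExtension.hom_induction (h : IsScalarExtension φ F) {X Y : C}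
    {P : (F.obj X ⟶ F.obj Y) → Prop} (zero : P 0) (map : ∀ f : X ⟶ Y, P (F.map f))
    (smul : ∀ (c : S) f, P f → P (c • f)) (add : ∀ f g, P f → P g → P (f + g))
    (f : F.obj X ⟶ F.obj Y) : P f := by
  obtain ⟨l, hl, hb⟩ := h.baseChange X Y
  let : Algebra R S := φ.toAlgebra
  let : Module R (F.obj X ⟶ F.obj Y) := Module.compHom _ φ
  have : IsScalarTower R S (F.obj X ⟶ F.obj Y) := ⟨fun r s x => mul_smul (φ r) s x⟩
  exact IsBaseChange.inductionOn hb f P zero (fun g => by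
    change P (l g)
    rw [hl]
    exact map g) (fun c g hg => smul c g hg) (fun f g hf hg => add f g hf hg)

theorem IsScalarExtension.hom_eq_smul (h : IsScalarExtension φ F) {X Y : C} {f₀ : X ⟶ Y}
    (h₀ : ∀ f : X ⟶ Y, ∃ r : R, f = r • f₀) (f : F.obj X ⟶ F.obj Y) : ∃ c : S, f = c • F.map f₀ := by
  refine h.hom_induction (P := fun f => ∃ c : S, f = c • F.map f₀) ⟨0, (zero_smul _ _).symm⟩ (fun f => ?_) ?_ ?_ f
  · obtain ⟨r, rfl⟩ := h₀ f
    exact ⟨φ r, h.map_smul r f₀⟩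
  · rintro c _ ⟨d, rfl⟩
    exact ⟨c * d, (mul_smul _ _ _).symm⟩
  · rintro _ _ ⟨c, rfl⟩ ⟨d, rfl⟩
    exact ⟨c + d, (add_smul _ _ _).symm⟩

/-- By the universal property of base change, `φ ∘ g` extends to an `S`-linear functional on the
`Hom` space of `D`. -/
theorem IsScalarExtension.apply_eq_zero (h : IsScalarExtension φ F) {X Y : C} {f : X ⟶ Y}
    (hf : F.map f = 0) (g : (X ⟶ Y) →ₗ[R] R) : φ (g f) = 0 := by
  obtain ⟨l, hl, hb⟩ := h.baseChange X Y
  let : Algebra R S := φ.toAlgebra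
  let : Module R (F.obj X ⟶ F.obj Y) := Module.compHom _ φ
  have : IsScalarTower R S (F.obj X ⟶ F.obj Y) := ⟨fun r s x => mul_smul (φ r) s x⟩
  have hb' : IsBaseChange S ({ toFun := l, map_add' := l.map_add, map_smul' := l.map_smulₛₗ } :
    (X ⟶ Y) →ₗ[R] (F.obj X ⟶ F.obj Y)) := hb
  have h1 := hb'.lift_eq ((Algebra.linearMap R S) ∘ₗ g) f
  change hb'.lift _ (l f) = φ (g f) at h1
  rw [hl, hf, _root_.map_zero] at h1
  exact h1.symm

theorem IsScalarExtension.map_id_smul_injective [Nontrivial S] (h : IsScalarExtension φ F)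
    (hφ : Function.Injective φ) {X : C}
    (hX : Function.Bijective (fun r : R => r • 𝟙 X)) {r : R} (hr : F.map (r • 𝟙 X) = 0) : r = 0 := by
  let e : R ≃ₗ[R] (X ⟶ X) := LinearEquiv.ofBijective (LinearMap.toSpanSingleton R _ (𝟙 X)) hX
  have h1 := h.apply_eq_zero hr e.symm.toLinearMap
  have h2 : e.symm (r • 𝟙 X) = r := e.symm_apply_apply r
  change φ (e.symm (r • 𝟙 X)) = 0 at h1
  rw [h2] at h1
  exact (map_eq_zero_iff φ hφ).1 h1

theorem IsScalarExtension.map_ne_zero_of_field {k : Type*} [Field k] {ι : k →+* S} [Nontrivial S]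
    {C : Type u} [Category.{v} C] [Preadditive C] [Linear k C] [MonoidalCategory C]
    {F : C ⥤ D} (h : IsScalarExtension ι F) {X Y : C} {f : X ⟶ Y} (hf : f ≠ 0) : F.map f ≠ 0 := by
  intro h0
  obtain ⟨g, hg⟩ := not_forall.1 ((Module.forall_dual_apply_eq_zero_iff k f).not.2 hf)
  exact hg ((map_eq_zero_iff ι ι.injective).1 (h.apply_eq_zero h0 g))

variable [Nontrivial S] {I : Type*} {X : I → C}

/-- Between members of the simple basis morphisms are zero or scalars, where injectivity of `φ`
applies; a general morphism is recovered from its matrix entries. -/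
theorem IsScalarExtension.faithful (h : IsScalarExtension φ F) (hφ : Function.Injective φ)
    (hX : IsSimpleBasis R X) {A B : C} {f : A ⟶ B} (hf : F.map f = 0) : f = 0 := by
  obtain ⟨n, s, i, r, h1, h0, ht⟩ := hX.exists_decomposition A
  obtain ⟨m, t, i', r', h1', h0', ht'⟩ := hX.exists_decomposition B
  have hsimple : ∀ (i j : I) (g : X i ⟶ X j), F.map g = 0 → g = 0 := by
    intro i j g hg
    by_cases hij : i = j
    · subst hij
      obtain ⟨r, rfl⟩ := (hX.end_scalar i).2 g
      change r • 𝟙 (X i) = 0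
      rw [h.map_id_smul_injective hφ (hX.end_scalar i) hg, zero_smul]
    · exact hX.hom_zero _ _ hij g
  have key : ∀ a b, i a ≫ f ≫ r' b = 0 := by
    intro a b
    have hz : F.map (i a ≫ f ≫ r' b) = 0 := by
      rw [F.map_comp, F.map_comp, hf, zero_comp, comp_zero]
    exact hsimple _ _ _ hz
  calc f = 𝟙 A ≫ f ≫ 𝟙 B := by simp
    _ = 0 := by
      rw [← ht, ← ht', Preadditive.sum_comp]
      refine Finset.sum_eq_zero fun a _ => ?_
      rw [Preadditive.comp_sum, Preadditive.comp_sum]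
      refine Finset.sum_eq_zero fun b _ => ?_
      have := key a b
      simp only [Category.assoc]
      rw [reassoc_of% this, zero_comp, comp_zero]

/-- An object which becomes simple over the field was simple before. Some idempotent `r a ≫ i a` of
the decomposition has nonzero image, a scalar idempotent, thus `1`; by faithfulness it is already
the identity of `A`. -/
theorem IsScalarExtension.exists_iso {S : Type*} [Field S] {φ : R →+* S} {D : Type u'} [Category.{v'} D]
    [Preadditive D] [Linear S D] [MonoidalCategory D] {F : C ⥤ D} (h : IsScalarExtension φ F)
    (hφ : Function.Injective φ) (hX : IsSimpleBasis R X) {A : C}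
    (hA : ∀ e : F.obj A ⟶ F.obj A, ∃ c : S, e = c • 𝟙 _) (hA0 : 𝟙 (F.obj A) ≠ 0) :
    ∃ i, Nonempty (A ≅ X i) := by
  obtain ⟨n, s, i, r, h1, h0, ht⟩ := hX.exists_decomposition A
  obtain ⟨a, ha⟩ : ∃ a, F.map (r a ≫ i a) ≠ 0 := by
    by_contra! hall
    have := h.map_sum Finset.univ (fun a => r a ≫ i a)
    rw [ht, F.map_id, Finset.sum_eq_zero fun a _ => hall a] at this
    exact hA0 this
  obtain ⟨c, hc⟩ := hA (F.map (r a ≫ i a))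
  have hidem : F.map (r a ≫ i a) ≫ F.map (r a ≫ i a) = F.map (r a ≫ i a) := by
    rw [← F.map_comp, Category.assoc, reassoc_of% h1 a]
  have hc1 : c = 1 := by
    rw [hc] at hidem ha
    rw [Linear.smul_comp, Category.id_comp, smul_smul, ← sub_eq_zero, ← sub_smul, smul_eq_zero] at hidem
    have hc0 : c ≠ 0 := by
      rintro rfl
      exact ha (zero_smul _ _)
    have h2 : c * (c - 1) = 0 := by
      linear_combination hidem.resolve_right hA0
    exact sub_eq_zero.1 ((mul_eq_zero.1 h2).resolve_left hc0)
  have hone : r a ≫ i a = 𝟙 A := by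
    rw [← sub_eq_zero]
    apply h.faithful hφ hX
    rw [h.map_sub, hc, hc1, one_smul, F.map_id, sub_self]
  exact ⟨s a, ⟨⟨r a, i a, hone, h1 a⟩⟩⟩

end Basic

end ScalarExtension

/-! ### Transport of endomorphisms built from tensor products -/

section Transport

universe v u v' u' v₀ u₀

section

variable {C : Type u} [Category.{v} C] [MonoidalCategory C]

/-- The endomorphism `m (1 ⊗ m) (d ⊗ 1) d` of `X`. -/
def tetra {X : C} (m : X ⊗ X ⟶ X) (d : X ⟶ X ⊗ X) : X ⟶ X :=
  d ≫ d ▷ X ≫ (α_ X X X).hom ≫ X ◁ m ≫ m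

/-- The endomorphism `(r ⊗ 1) (1 ⊗ i)` of `X`. -/
def zigzag {X : C} (r : X ⊗ X ⟶ 𝟙_ C) (i : 𝟙_ C ⟶ X ⊗ X) : X ⟶ X :=
  (ρ_ X).inv ≫ X ◁ i ≫ (α_ X X X).inv ≫ r ▷ X ≫ (λ_ X).hom

theorem tetra_conj {X Y : C} (e : X ≅ Y) (m : X ⊗ X ⟶ X) (d : X ⟶ X ⊗ X) :
    tetra ((e.inv ⊗ₘ e.inv) ≫ m ≫ e.hom) (e.inv ≫ d ≫ (e.hom ⊗ₘ e.hom)) =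
      e.inv ≫ tetra m d ≫ e.hom := by
  have h1 : (e.hom ⊗ₘ e.hom) ≫ (e.inv ≫ d ≫ (e.hom ⊗ₘ e.hom)) ▷ Y =
      d ▷ X ≫ ((e.hom ⊗ₘ e.hom) ⊗ₘ e.hom) := by
    rw [← tensorHom_id, ← tensorHom_id, tensorHom_comp_tensorHom, tensorHom_comp_tensorHom]
    simp
  have h2 : (e.hom ⊗ₘ (e.hom ⊗ₘ e.hom)) ≫ Y ◁ ((e.inv ⊗ₘ e.inv) ≫ m ≫ e.hom) =
      X ◁ m ≫ (e.hom ⊗ₘ e.hom) := by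
    rw [← id_tensorHom, ← id_tensorHom, tensorHom_comp_tensorHom, tensorHom_comp_tensorHom,
      tensorHom_comp_tensorHom_assoc]
    simp
  simp only [tetra, Category.assoc]
  rw [reassoc_of% h1, associator_naturality_assoc, reassoc_of% h2, tensorHom_comp_tensorHom_assoc]
  simp

theorem zigzag_conj {X Y : C} (e : X ≅ Y) (r : X ⊗ X ⟶ 𝟙_ C) (i : 𝟙_ C ⟶ X ⊗ X) :
    zigzag ((e.inv ⊗ₘ e.inv) ≫ r) (i ≫ (e.hom ⊗ₘ e.hom)) =
      e.inv ≫ zigzag r i ≫ e.hom := by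
  have h1 : (ρ_ Y).inv ≫ Y ◁ (i ≫ (e.hom ⊗ₘ e.hom)) =
      e.inv ≫ (ρ_ X).inv ≫ X ◁ i ≫ (e.hom ⊗ₘ (e.hom ⊗ₘ e.hom)) := by
    rw [rightUnitor_inv_naturality_assoc, ← id_tensorHom, ← id_tensorHom, ← tensorHom_id,
      tensorHom_comp_tensorHom, tensorHom_comp_tensorHom]
    simp
  have h2 : ((e.hom ⊗ₘ e.hom) ⊗ₘ e.hom) ≫ ((e.inv ⊗ₘ e.inv) ≫ r) ▷ Y = r ▷ X ≫ 𝟙_ C ◁ e.hom := by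
    rw [← id_tensorHom, ← tensorHom_id, ← tensorHom_id, tensorHom_comp_tensorHom,
      tensorHom_comp_tensorHom, tensorHom_comp_tensorHom_assoc]
    simp
  simp only [zigzag, Category.assoc]
  rw [reassoc_of% h1, associator_inv_naturality_assoc, reassoc_of% h2, leftUnitor_naturality]

variable {D : Type u'} [Category.{v'} D] [MonoidalCategory D] (F : C ⥤ D) [F.Monoidal]

open Functor.LaxMonoidal Functor.OplaxMonoidal

theorem map_tetra {X : C} (m : X ⊗ X ⟶ X) (d : X ⟶ X ⊗ X) :
    tetra (μ F X X ≫ F.map m) (F.map d ≫ δ F X X) = F.map (tetra m d) := by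
  simp only [tetra, F.map_comp, Functor.Monoidal.map_whiskerRight, Functor.Monoidal.map_whiskerLeft,
    Functor.Monoidal.map_associator, comp_whiskerRight, MonoidalCategory.whiskerLeft_comp, Category.assoc,
    Functor.Monoidal.μ_δ_assoc]

theorem map_zigzag {X : C} (r : X ⊗ X ⟶ 𝟙_ C) (i : 𝟙_ C ⟶ X ⊗ X) :
    zigzag (μ F X X ≫ F.map r ≫ η F) (ε F ≫ F.map i ≫ δ F X X) = F.map (zigzag r i) := by
  simp only [zigzag, F.map_comp, Functor.Monoidal.map_whiskerRight, Functor.Monoidal.map_whiskerLeft,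
    Functor.Monoidal.map_associator_inv, Functor.Monoidal.map_leftUnitor,
    Functor.Monoidal.map_rightUnitor_inv, comp_whiskerRight, MonoidalCategory.whiskerLeft_comp,
    Category.assoc, Functor.Monoidal.μ_δ_assoc]
end

variable {R : Type*} [CommRing R] {C : Type u} [Category.{v} C] [Preadditive C] [Linear R C] [MonoidalCategory C]
  [MonoidalPreadditive C] [MonoidalLinear R C]

/-- `m` and `d` each occur twice, so the value depends only on `a * b`, which the normalization `d ≫
m = 𝟙` forces to be `1`. -/
theorem tetra_smul {X : C} (m : X ⊗ X ⟶ X) (d : X ⟶ X ⊗ X) (a b : R) :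
    tetra (a • m) (b • d) = ((a * b) * (a * b)) • tetra m d := by
  simp only [tetra]
  simp [smul_smul]
  congr 1
  ring

theorem zigzag_smul {X : C} (r : X ⊗ X ⟶ 𝟙_ C) (i : 𝟙_ C ⟶ X ⊗ X) (a b : R) :
    zigzag (a • r) (b • i) = (a * b) • zigzag r i := by
  simp only [zigzag]
  simp [smul_smul]

end Transport

/-! ### Integrality of amplitudes in a lift -/

section Integrality

universe v u v' u' v₀ u₀

open Functor.LaxMonoidal Functor.OplaxMonoidal

theorem end_scalar_of_iso {S : Type*} [CommRing S] {D : Type u} [Category.{v} D] [Preadditive D]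
    [Linear S D] {A B : D} (e : A ≅ B) (h : ∀ f : B ⟶ B, ∃ c : S, f = c • 𝟙 B) (f : A ⟶ A) :
    ∃ c : S, f = c • 𝟙 A := by
  obtain ⟨c, hc⟩ := h (e.inv ≫ f ≫ e.hom)
  refine ⟨c, ?_⟩
  rw [← cancel_mono e.hom, ← cancel_epi e.inv, hc]
  simp

variable {R S k : Type*} [CommRing R] [Field S] [Field k] {φ : R →+* S} {ι : k →+* S}
  {Ct : Type u} [Category.{v} Ct] [Preadditive Ct] [Linear R Ct] [MonoidalCategory Ct]
  {D : Type u'} [Category.{v'} D] [Preadditive D] [Linear S D] [MonoidalCategory D]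
  {C : Type u₀} [Category.{v₀} C] [Preadditive C] [Linear k C] [MonoidalCategory C]
  {G : Ct ⥤ D} {H : C ⥤ D} {I : Type*} {X : I → Ct}

theorem IsScalarExtension.exists_ne_zero (hG : IsScalarExtension φ G) {A B : Ct}
    {f : G.obj A ⟶ G.obj B} (hf : f ≠ 0) : ∃ f' : A ⟶ B, f' ≠ 0 := by
  by_contra! h
  obtain ⟨c, hc⟩ := hG.hom_eq_smul (f₀ := 0) (fun f => ⟨0, by rw [h f, smul_zero]⟩) f
  exact hf (by rw [hc, hG.map_zero, smul_zero])

variable [MonoidalPreadditive D] [MonoidalLinear S D]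

/-- The lift of `V` is a direct summand of its tensor square over `R`, and the endomorphism formed
from an integral splitting is a scalar of `R`. In `D` that splitting differs from `d₀`, `m₀` by
scalars with product `1`, so the scalar is the image of `κ`. -/
theorem IsScalarExtension.exists_tetra_eq (hG : IsScalarExtension φ G) (hφ : Function.Injective φ)
    (hX : IsSimpleBasis R X) (hH : IsScalarExtension ι H) {V : C} {m₀ : V ⊗ V ⟶ V} {d₀ : V ⟶ V ⊗ V}
    (hV : 𝟙 V ≠ 0) (hend : ∀ f : V ⟶ V, ∃ c : k, f = c • 𝟙 V)
    (hm : ∀ f : V ⊗ V ⟶ V, ∃ c : k, f = c • m₀) (hd : ∀ f : V ⟶ V ⊗ V, ∃ c : k, f = c • d₀)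
    (h1 : d₀ ≫ m₀ = 𝟙 V) {κ : k} (hκ : tetra m₀ d₀ = κ • 𝟙 V) : ∃ x : R, φ x = ι κ := by
  obtain ⟨_⟩ := hG.monoidal
  obtain ⟨_⟩ := hH.monoidal
  have := hG.essSurj
  let A := G.objPreimage (H.obj V)
  let e : G.obj A ≅ H.obj V := G.objObjPreimageIso (H.obj V)
  have hV' : 𝟙 (H.obj V) ≠ 0 := by
    rw [← H.map_id]
    exact hH.map_ne_zero_of_field hV
  have hend' : ∀ f : H.obj V ⟶ H.obj V, ∃ c : S, f = c • 𝟙 _ := by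
    rw [← H.map_id]
    exact hH.hom_eq_smul hend
  have hA : 𝟙 (G.obj A) ≠ 0 := fun h => hV' (by
    rw [← e.inv_hom_id, ← Category.id_comp e.hom, h, zero_comp, comp_zero])
  -- The image of `V` in `D` keeps only scalar endomorphisms, so its lift `A` belongs to the simple
  -- basis.
  obtain ⟨i₀, ⟨eA⟩⟩ := hG.exists_iso hφ hX (end_scalar_of_iso e hend') hA
  -- `d₀` transported to `A` is nonzero in `D`, hence some morphism is nonzero already in `Ct`.
  obtain ⟨f, hf⟩ : ∃ f : A ⟶ A ⊗ A, f ≠ 0 := by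
    refine hG.exists_ne_zero (f := e.hom ≫ H.map d₀ ≫ δ H V V ≫ (e.inv ⊗ₘ e.inv) ≫ μ G A A) fun h => hV' ?_
    have h2 : H.map d₀ = e.inv ≫ (e.hom ≫ H.map d₀ ≫ δ H V V ≫ (e.inv ⊗ₘ e.inv) ≫ μ G A A) ≫
        δ G A A ≫ (e.hom ⊗ₘ e.hom) ≫ μ H V V := by
      simp [tensorHom_comp_tensorHom_assoc]
    rw [← H.map_id, ← h1, H.map_comp, h2, h, zero_comp, comp_zero, zero_comp]
  obtain ⟨d, m, hdm⟩ := hX.exists_retract eA hf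
  obtain ⟨x, hx⟩ := hX.end_scalar_of_iso eA (tetra m d)
  refine ⟨x, ?_⟩
  let mG := (e.inv ⊗ₘ e.inv) ≫ (μ G A A ≫ G.map m) ≫ e.hom
  let dG := e.inv ≫ (G.map d ≫ δ G A A) ≫ (e.hom ⊗ₘ e.hom)
  have hmG : ∃ c : S, mG = c • (μ H V V ≫ H.map m₀) := by
    obtain ⟨c, hc⟩ := hH.hom_eq_smul hm (δ H V V ≫ mG)
    refine ⟨c, ?_⟩
    rw [← Linear.comp_smul, ← hc, Functor.Monoidal.μ_δ_assoc]
  have hdG : ∃ c : S, dG = c • (H.map d₀ ≫ δ H V V) := by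
    obtain ⟨c, hc⟩ := hH.hom_eq_smul hd (dG ≫ μ H V V)
    refine ⟨c, ?_⟩
    rw [← Linear.smul_comp, ← hc, Category.assoc, Functor.Monoidal.μ_δ, Category.comp_id]
  obtain ⟨a, ha⟩ := hmG
  obtain ⟨b, hb⟩ := hdG
  have hone : dG ≫ mG = 𝟙 _ := by
    simp only [dG, mG, Category.assoc, tensorHom_comp_tensorHom_assoc]
    simp only [Iso.hom_inv_id, id_tensorHom_id, Category.id_comp, Functor.Monoidal.δ_μ_assoc]
    rw [← G.map_comp_assoc, hdm, G.map_id, Category.id_comp, e.inv_hom_id]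
  -- Both pairs compose to the identity, so the two comparison scalars are inverse to each other.
  have hab : a * b = 1 := by
    rw [ha, hb, Linear.smul_comp, Linear.comp_smul, smul_smul, Category.assoc,
      Functor.Monoidal.δ_μ_assoc, ← H.map_comp, h1, H.map_id, ← sub_eq_zero] at hone
    nth_rewrite 2 [← one_smul S (𝟙 (H.obj V))] at hone
    rw [← sub_smul, smul_eq_zero] at hone
    rw [mul_comm]
    exact sub_eq_zero.1 (hone.resolve_right hV')
  have ht1 : tetra mG dG = φ x • 𝟙 _ := by
    rw [tetra_conj, map_tetra, hx, hG.map_smul, G.map_id]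
    simp
  have ht2 : tetra mG dG = ι κ • 𝟙 _ := by
    rw [ha, hb, tetra_smul, hab, mul_one, one_smul, map_tetra, hκ, hH.map_smul, H.map_id]
  rw [ht1, ← sub_eq_zero, ← sub_smul, smul_eq_zero] at ht2
  exact sub_eq_zero.1 (ht2.resolve_right hV')

/-- The same comparison with the unit object in place of `V` as the summand of `V ⊗ V`. The unit
constraints of `G` and `H` enter, and the lift of the unit must also be recognized as simple. -/
theorem IsScalarExtension.exists_zigzag_eq (hG : IsScalarExtension φ G) (hφ : Function.Injective φ)
    (hX : IsSimpleBasis R X) (hH : IsScalarExtension ι H) {V : C} {r₀ : V ⊗ V ⟶ 𝟙_ C} {i₀ : 𝟙_ C ⟶ V ⊗ V}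
    (hV : 𝟙 V ≠ 0) (hend : ∀ f : V ⟶ V, ∃ c : k, f = c • 𝟙 V)
    (hU : 𝟙 (𝟙_ C) ≠ 0) (hendU : ∀ f : 𝟙_ C ⟶ 𝟙_ C, ∃ c : k, f = c • 𝟙 (𝟙_ C))
    (hr : ∀ f : V ⊗ V ⟶ 𝟙_ C, ∃ c : k, f = c • r₀) (hi : ∀ f : 𝟙_ C ⟶ V ⊗ V, ∃ c : k, f = c • i₀)
    (h1 : i₀ ≫ r₀ = 𝟙 _) {κ : k} (hκ : zigzag r₀ i₀ = κ • 𝟙 V) : ∃ x : R, φ x = ι κ := by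
  obtain ⟨_⟩ := hG.monoidal
  obtain ⟨_⟩ := hH.monoidal
  have := hG.essSurj
  let A := G.objPreimage (H.obj V)
  let e : G.obj A ≅ H.obj V := G.objObjPreimageIso (H.obj V)
  let eU : G.obj (𝟙_ Ct) ≅ H.obj (𝟙_ C) := (Functor.Monoidal.εIso G).symm ≪≫ Functor.Monoidal.εIso H
  have hV' : 𝟙 (H.obj V) ≠ 0 := by
    rw [← H.map_id]
    exact hH.map_ne_zero_of_field hV
  have hend' : ∀ f : H.obj V ⟶ H.obj V, ∃ c : S, f = c • 𝟙 _ := by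
    rw [← H.map_id]
    exact hH.hom_eq_smul hend
  have hU' : 𝟙 (H.obj (𝟙_ C)) ≠ 0 := by
    rw [← H.map_id]
    exact hH.map_ne_zero_of_field hU
  have hendU' : ∀ f : H.obj (𝟙_ C) ⟶ H.obj (𝟙_ C), ∃ c : S, f = c • 𝟙 _ := by
    rw [← H.map_id]
    exact hH.hom_eq_smul hendU
  have hA : 𝟙 (G.obj A) ≠ 0 := fun h => hV' (by
    rw [← e.inv_hom_id, ← Category.id_comp e.hom, h, zero_comp, comp_zero])
  have hAU : 𝟙 (G.obj (𝟙_ Ct)) ≠ 0 := fun h => hU' (by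
    rw [← eU.inv_hom_id, ← Category.id_comp eU.hom, h, zero_comp, comp_zero])
  obtain ⟨j, ⟨eA⟩⟩ := hG.exists_iso hφ hX (end_scalar_of_iso e hend') hA
  obtain ⟨jU, ⟨eAU⟩⟩ := hG.exists_iso hφ hX (end_scalar_of_iso eU hendU') hAU
  obtain ⟨f, hf⟩ : ∃ f : 𝟙_ Ct ⟶ A ⊗ A, f ≠ 0 := by
    refine hG.exists_ne_zero
      (f := eU.hom ≫ H.map i₀ ≫ δ H V V ≫ (e.inv ⊗ₘ e.inv) ≫ μ G A A) fun h => hU' ?_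
    have h2 : H.map i₀ = eU.inv ≫ (eU.hom ≫ H.map i₀ ≫ δ H V V ≫ (e.inv ⊗ₘ e.inv) ≫ μ G A A) ≫
        δ G A A ≫ (e.hom ⊗ₘ e.hom) ≫ μ H V V := by
      simp only [Category.assoc, Functor.Monoidal.μ_δ_assoc, tensorHom_comp_tensorHom_assoc,
        Iso.inv_hom_id, id_tensorHom_id, Category.id_comp, Functor.Monoidal.δ_μ, Category.comp_id,
        Iso.inv_hom_id_assoc]
    rw [← H.map_id, ← h1, H.map_comp, h2, h, zero_comp, comp_zero, zero_comp]
  obtain ⟨i, r, hir⟩ := hX.exists_retract eAU hf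
  obtain ⟨x, hx⟩ := hX.end_scalar_of_iso eA (zigzag r i)
  refine ⟨x, ?_⟩
  let rG := (e.inv ⊗ₘ e.inv) ≫ (μ G A A ≫ G.map r ≫ η G)
  let iG := (ε G ≫ G.map i ≫ δ G A A) ≫ (e.hom ⊗ₘ e.hom)
  have hrG : ∃ c : S, rG = c • (μ H V V ≫ H.map r₀ ≫ η H) := by
    obtain ⟨c, hc⟩ := hH.hom_eq_smul hr (δ H V V ≫ rG ≫ ε H)
    refine ⟨c, ?_⟩
    rw [← Linear.comp_smul, ← Linear.smul_comp, ← hc]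
    simp only [Category.assoc, Functor.Monoidal.μ_δ_assoc, Functor.Monoidal.ε_η, Category.comp_id]
  have hiG : ∃ c : S, iG = c • (ε H ≫ H.map i₀ ≫ δ H V V) := by
    obtain ⟨c, hc⟩ := hH.hom_eq_smul hi (η H ≫ iG ≫ μ H V V)
    refine ⟨c, ?_⟩
    rw [← Linear.comp_smul, ← Linear.smul_comp, ← hc]
    simp only [Category.assoc, Functor.Monoidal.μ_δ, Functor.Monoidal.ε_η_assoc, Category.comp_id]
  obtain ⟨a, ha⟩ := hrG
  obtain ⟨b, hb⟩ := hiG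
  have hone : iG ≫ rG = 𝟙 _ := by
    simp only [iG, rG, Category.assoc, tensorHom_comp_tensorHom_assoc]
    simp only [Iso.hom_inv_id, id_tensorHom_id, Category.id_comp, Functor.Monoidal.δ_μ_assoc]
    rw [← G.map_comp_assoc, hir, G.map_id, Category.id_comp, Functor.Monoidal.ε_η]
  have hU'' : 𝟙 (𝟙_ D) ≠ 0 := fun h => hU' (by
    rw [← Functor.Monoidal.η_ε H, ← Category.id_comp (ε H), h, zero_comp, comp_zero])
  have hab : a * b = 1 := by
    rw [ha, hb, Linear.smul_comp, Linear.comp_smul, smul_smul, Category.assoc, Category.assoc,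
      Functor.Monoidal.δ_μ_assoc, ← H.map_comp_assoc, h1, H.map_id, Category.id_comp,
      Functor.Monoidal.ε_η, ← sub_eq_zero] at hone
    nth_rewrite 2 [← one_smul S (𝟙 (𝟙_ D))] at hone
    rw [← sub_smul, smul_eq_zero] at hone
    rw [mul_comm]
    exact sub_eq_zero.1 (hone.resolve_right hU'')
  have ht1 : zigzag rG iG = φ x • 𝟙 _ := by
    rw [zigzag_conj, map_zigzag, hx, hG.map_smul, G.map_id]
    simp
  have ht2 : zigzag rG iG = ι κ • 𝟙 _ := by
    rw [ha, hb, zigzag_smul, hab, one_smul, map_zigzag, hκ, hH.map_smul, H.map_id]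
  rw [ht1, ← sub_eq_zero, ← sub_smul, smul_eq_zero] at ht2
  exact sub_eq_zero.1 (ht2.resolve_right hV')

end Integrality

/-! ### Self-dual objects -/

section SelfDual

universe v u

section General

variable {C : Type u} [Category.{v} C] [MonoidalCategory C] {X : C} [ExactPairing X X]

theorem zigzag_evaluation_coevaluation : zigzag (ε_ X X) (η_ X X) = 𝟙 X := by
  rw [zigzag, ExactPairing.coevaluation_evaluation_assoc]
  simp

variable [Preadditive C]

theorem evaluation_ne_zero [MonoidalPreadditive C] (hX : 𝟙 X ≠ 0) : ε_ X X ≠ 0 := fun h => hX (by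
  rw [← zigzag_evaluation_coevaluation, h, zigzag, MonoidalPreadditive.zero_whiskerRight]
  simp)

variable {R : Type*} [CommRing R] [Linear R C] [MonoidalPreadditive C] [MonoidalLinear R C]

/-- Duality identifies `Hom(X ⊗ X, 𝟙)` with `Hom(X, X)`, taking the evaluation to the identity. -/
theorem eq_smul_evaluation (hX : ∀ f : X ⟶ X, ∃ c : R, f = c • 𝟙 X) (f : X ⊗ X ⟶ 𝟙_ C) :
    ∃ c : R, f = c • ε_ X X := by
  obtain ⟨c, hc⟩ := hX (tensorLeftHomEquiv X X X (𝟙_ C) f ≫ (ρ_ X).hom)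
  refine ⟨c, ?_⟩
  rw [← cancel_mono (ρ_ X).inv, Category.assoc, Iso.hom_inv_id, Category.comp_id, Linear.smul_comp,
    Category.id_comp] at hc
  rw [← (tensorLeftHomEquiv X X X (𝟙_ C)).symm_apply_apply f, hc]
  simp only [tensorLeftHomEquiv, Equiv.coe_fn_symm_mk, MonoidalLinear.whiskerLeft_smul, Linear.smul_comp]
  congr 1
  monoidal

theorem eq_smul_coevaluation (hX : ∀ f : X ⟶ X, ∃ c : R, f = c • 𝟙 X) (f : 𝟙_ C ⟶ X ⊗ X) :
    ∃ c : R, f = c • η_ X X := by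
  obtain ⟨c, hc⟩ := hX ((λ_ X).inv ≫ (tensorRightHomEquiv (𝟙_ C) X X X).symm f)
  refine ⟨c, ?_⟩
  rw [← cancel_epi (λ_ X).hom, Iso.hom_inv_id_assoc, Linear.comp_smul, Category.comp_id] at hc
  rw [← (tensorRightHomEquiv (𝟙_ C) X X X).apply_symm_apply f, hc]
  simp only [tensorRightHomEquiv, Equiv.coe_fn_mk, MonoidalLinear.smul_whiskerRight, Linear.comp_smul]
  congr 1
  monoidal

/-- Morphisms `X ⟶ X ⊗ X` form a line if morphisms `X ⊗ X ⟶ X` do. -/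
theorem eq_smul_of_hom_tensor {m : X ⊗ X ⟶ X} (hm : ∀ f : X ⊗ X ⟶ X, ∃ c : R, f = c • m)
    (f : X ⟶ X ⊗ X) : ∃ c : R, f = c • tensorRightHomEquiv X X X X m := by
  obtain ⟨c, hc⟩ := hm ((tensorRightHomEquiv X X X X).symm f)
  refine ⟨c, ?_⟩
  rw [← (tensorRightHomEquiv X X X X).apply_symm_apply f, hc]
  simp [tensorRightHomEquiv]

end General

section LinearAlgebra

variable {k V : Type*} [Field k] [AddCommGroup V] [Module k V]

/-- The endomorphism obtained by contracting the second factor of a tensor with a bilinear form. -/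
noncomputable def contractRightForm (B : V ⊗[k] V →ₗ[k] k) (u : V ⊗[k] V) : V →ₗ[k] V :=
  (TensorProduct.rid k V).toLinearMap ∘ₗ LinearMap.lTensor V B ∘ₗ
    (TensorProduct.assoc k V V V).toLinearMap ∘ₗ TensorProduct.mk k (V ⊗[k] V) V u

theorem contractRightForm_tmul (B : V ⊗[k] V →ₗ[k] k) (a b v : V) :
    contractRightForm B (a ⊗ₜ b) v = B (b ⊗ₜ v) • a := by
  simp [contractRightForm]

theorem contractRightForm_add (B : V ⊗[k] V →ₗ[k] k) (u u' : V ⊗[k] V) :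
    contractRightForm B (u + u') = contractRightForm B u + contractRightForm B u' := by
  ext v
  simp [contractRightForm]

theorem contractRightForm_zero (B : V ⊗[k] V →ₗ[k] k) : contractRightForm B 0 = 0 := by
  ext v
  simp [contractRightForm]

/-- By linearity it suffices to treat `a ⊗ b`, whose contraction is the rank one operator `v ↦ B (b
⊗ v) • a`. -/
theorem trace_contractRightForm [Module.Finite k V] (B : V ⊗[k] V →ₗ[k] k) (u : V ⊗[k] V) :
    LinearMap.trace k V (contractRightForm B u) = B (TensorProduct.comm k V V u) := by
  induction u using TensorProduct.induction_on with
  | zero => simp [contractRightForm_zero]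
  | add x y hx hy => rw [contractRightForm_add, map_add, hx, hy, map_add, map_add]
  | tmul a b =>
    have : contractRightForm B (a ⊗ₜ b) =
        dualTensorHom k V V ((B ∘ₗ TensorProduct.mk k V V b) ⊗ₜ a) := by
      ext v
      rw [contractRightForm_tmul, dualTensorHom_apply]
      rfl
    rw [this, LinearMap.trace_eq_contract_apply]
    simp

end LinearAlgebra

variable {k : Type} [Field k] {V : RepPGL₂ k}

theorem contractRightForm_coevaluation [ExactPairing V V] :
    contractRightForm (toLin (ε_ V V)) (toLin (η_ V V) (1 : k)) = LinearMap.id := by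
  have h := congrArg toLin (ExactPairing.evaluation_coevaluation V V)
  rw [toLin_comp, toLin_comp, toLin_comp, toLin_associator_hom, toLin_leftUnitor_hom] at h
  apply LinearMap.ext
  intro v
  have h1 := congrArg (TensorProduct.rid k V.obj) (LinearMap.congr_fun h ((1 : k) ⊗ₜ[k] v))
  refine h1.trans ?_
  change TensorProduct.rid k V.obj ((TensorProduct.rid k V.obj).symm (TensorProduct.lid k V.obj ((1 : k) ⊗ₜ[k] v))) = v
  rw [LinearEquiv.apply_symm_apply, TensorProduct.lid_tmul, one_smul]

theorem hom_unit_eq_smul (f : 𝟙_ (RepPGL₂ k) ⟶ 𝟙_ (RepPGL₂ k)) : f = (toLin f (1 : k) : k) • 𝟙 _ := by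
  apply toLin_injective
  apply LinearMap.ext_ring
  change toLin f (1 : k) = toLin f (1 : k) * 1
  exact (mul_one _).symm

/-- The pairing composed with the symmetry is a multiple `σ` of itself, and the symmetry is an
involution, so `σ ^ 2 = 1`. -/
theorem toLin_evaluation_comm [ExactPairing V V] (hV : 𝟙 V ≠ 0)
    (hend : ∀ f : V ⟶ V, ∃ c : k, f = c • 𝟙 V) : ∃ σ : k, (σ = 1 ∨ σ = -1) ∧
      ∀ x, toLin (ε_ V V) (TensorProduct.comm k V.obj V.obj x) = σ * (toLin (ε_ V V) x : k) := by
  obtain ⟨σ, hσ⟩ := eq_smul_evaluation hend ((β_ V V).hom ≫ ε_ V V)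
  have h2 : (β_ V V).hom ≫ (β_ V V).hom ≫ ε_ V V = (σ * σ) • ε_ V V := by
    rw [hσ, Linear.comp_smul, hσ, smul_smul]
  rw [SymmetricCategory.symmetry_assoc, ← sub_eq_zero] at h2
  nth_rewrite 1 [← one_smul k (ε_ V V)] at h2
  rw [← sub_smul, smul_eq_zero] at h2
  have h3 := h2.resolve_right (evaluation_ne_zero hV)
  refine ⟨σ, ?_, fun x => ?_⟩
  · have h4 : (σ - 1) * (σ + 1) = 0 := by linear_combination -h3
    rcases mul_eq_zero.1 h4 with h | h
    · exact Or.inl (sub_eq_zero.1 h)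
    · exact Or.inr (eq_neg_of_add_eq_zero_left h)
  · have hβ : toLin (β_ V V).hom = (TensorProduct.comm k V.obj V.obj).toLinearMap :=
      TensorProduct.ext' fun _ _ => rfl
    have := LinearMap.congr_fun (congrArg toLin hσ) x
    rw [toLin_comp, hβ] at this
    exact this

/-- The identity of `V` is the contraction of the coevaluation tensor, so its trace is the pairing
of that tensor with factors exchanged; `σ` accounts for the exchange. -/
theorem coevaluation_evaluation_eq_dim [ExactPairing V V] {σ : k} (hσ : σ = 1 ∨ σ = -1)
    (h : ∀ x, toLin (ε_ V V) (TensorProduct.comm k V.obj V.obj x) = σ * (toLin (ε_ V V) x : k)) :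
    η_ V V ≫ ε_ V V = (σ * (repDim V : k)) • 𝟙 (𝟙_ (RepPGL₂ k)) := by
  have h1 := trace_contractRightForm (toLin (ε_ V V)) (toLin (η_ V V) (1 : k))
  rw [contractRightForm_coevaluation, LinearMap.trace_id] at h1
  rw [hom_unit_eq_smul (η_ V V ≫ ε_ V V)]
  congr 1
  have h2 := h (toLin (η_ V V) (1 : k))
  have h3 : (repDim V : k) = σ * (toLin (ε_ V V) (toLin (η_ V V) (1 : k)) : k) := h1.trans h2
  rw [h3, ← mul_assoc]
  have h4 : σ * σ = 1 := by rcases hσ with rfl | rfl <;> ring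
  rw [h4, one_mul]
  rfl

end SelfDual

/-! ### The dual of a multiplication in coordinates -/

section DualMul

universe v u

/-- The adjunction characterizing `m_*`, with the pairing of `X ⊗ X` with itself nested: inner
factors are contracted first. The nesting causes the reversed order `b j ⊗ b i` below. -/
theorem dualMul_comp_evaluation {C : Type u} [Category.{v} C] [MonoidalCategory C] {X : C}
    [ExactPairing X X] (m : X ⊗ X ⟶ X) :
    dualMul m ▷ (X ⊗ X) ≫ (α_ X X (X ⊗ X)).hom ≫ X ◁ (α_ X X X).inv ≫ X ◁ (ε_ X X ▷ X) ≫
      X ◁ (λ_ X).hom ≫ ε_ X X = X ◁ m ≫ ε_ X X := by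
  have h := @rightAdjointMate_comp_evaluation C _ _ (X ⊗ X) X
    { rightDual := X ⊗ X, exact := ExactPairing.tensor } { rightDual := X } m
  refine Eq.trans ?_ h
  change _ = dualMul m ▷ (X ⊗ X) ≫ ε_ (X ⊗ X) (X ⊗ X)
  rw [ExactPairing.tensor_evaluation]
  congr 1
  monoidal

variable {k : Type} [Field k]

theorem eq_sum_of_dual_bases {V ι : Type*} [AddCommGroup V] [Module k V] [Fintype ι]
    {B : V ⊗[k] V →ₗ[k] k} {a b : ι → V} (hab : ∀ p, ∑ i, B (p ⊗ₜ a i) • b i = p)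
    {B₂ : V ⊗[k] V →ₗ[k] V ⊗[k] V →ₗ[k] k}
    (hB₂ : ∀ p q x y, B₂ (p ⊗ₜ q) (x ⊗ₜ y) = B (q ⊗ₜ x) * B (p ⊗ₜ y)) (w : V ⊗[k] V) :
    w = ∑ i, ∑ j, B₂ w (a i ⊗ₜ a j) • (b j ⊗ₜ b i) := by
  induction w using TensorProduct.induction_on with
  | zero => simp
  | add x y hx hy =>
    simp only [map_add, LinearMap.add_apply, add_smul, Finset.sum_add_distrib]
    rw [← hx, ← hy]
  | tmul p q =>
    conv_lhs => rw [← hab p, ← hab q]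
    rw [TensorProduct.tmul_sum]
    refine Finset.sum_congr rfl fun i _ => ?_
    rw [TensorProduct.sum_tmul]
    refine Finset.sum_congr rfl fun j _ => ?_
    rw [hB₂, TensorProduct.smul_tmul_smul, mul_comm]

variable {V : RepPGL₂ k} [ExactPairing V V]

theorem toLin_dualMul {ι : Type*} [Fintype ι] {a b : ι → V.obj}
    (hab : ∀ p, ∑ i, (toLin (ε_ V V) (p ⊗ₜ[k] a i) : k) • b i = p) (m : V ⊗ V ⟶ V) (v : V.obj) :
    toLin (dualMul m) v = ∑ i, ∑ j,
      (toLin (ε_ V V) (v ⊗ₜ[k] toLin m (a i ⊗ₜ[k] a j)) : k) • (b j ⊗ₜ[k] b i) := by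
  let E : (V ⊗ V) ⊗ V ⊗ V ⟶ 𝟙_ _ := (α_ V V (V ⊗ V)).hom ≫ V ◁ (α_ V V V).inv ≫
    V ◁ (ε_ V V ▷ V) ≫ V ◁ (λ_ V).hom ≫ ε_ V V
  let B₂ : V.obj ⊗[k] V.obj →ₗ[k] V.obj ⊗[k] V.obj →ₗ[k] k := TensorProduct.curry (toLin E)
  have h := fun x : V.obj ⊗[k] V.obj => LinearMap.congr_fun (congrArg toLin (dualMul_comp_evaluation m)) (v ⊗ₜ[k] x)
  have h2 := eq_sum_of_dual_bases (B := toLin (ε_ V V)) hab (B₂ := B₂) (fun p q x y => ?_) (toLin (dualMul m) v)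
  · refine h2.trans ?_
    refine Finset.sum_congr rfl fun i _ => Finset.sum_congr rfl fun j _ => ?_
    congr 1
    exact h (a i ⊗ₜ a j)
  · change toLin (ε_ V V) (p ⊗ₜ[k] ((toLin (ε_ V V) (q ⊗ₜ[k] x) : k) • y)) = _
    rw [TensorProduct.tmul_smul, map_smul]
    rfl

end DualMul

/-! ### The adjoint representation -/

section Adjoint

variable {k : Type} [Field k]

/-- The traceless matrix with the given entries. -/
def traceless (x y z : k) : TracelessMatrix k :=
  ⟨!![y, x; z, -y], by simp [LinearMap.mem_ker, Matrix.trace_fin_two]⟩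

theorem eq_traceless (A : TracelessMatrix k) : A = traceless (A.1 0 1) (A.1 0 0) (A.1 1 0) := by
  have hA : Matrix.trace A.1 = 0 := A.2
  rw [Matrix.trace_fin_two] at hA
  ext i j
  fin_cases i <;> fin_cases j <;> simp [traceless]
  linear_combination hA

theorem adjointPGL_pgl {a b c d : k} (h : a * d - b * c ≠ 0) (x y z : k) :
    adjointPGL k (pgl a b c d h) (traceless x y z) = (a * d - b * c)⁻¹ • traceless
      (a ^ 2 * x - 2 * a * b * y - b ^ 2 * z) (-a * c * x + (a * d + b * c) * y + b * d * z)
      (-c ^ 2 * x + 2 * c * d * y + d ^ 2 * z) := by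
  have h1 : (((Matrix.GeneralLinearGroup.mkOfDetNeZero !![a, b; c, d]
      (by simpa [Matrix.det_fin_two] using h))⁻¹ : GL (Fin 2) k) : Matrix (Fin 2) (Fin 2) k) =
      (a * d - b * c)⁻¹ • !![d, -b; -c, a] := by
    rw [Matrix.coe_units_inv]
    simp [Matrix.GeneralLinearGroup.mkOfDetNeZero, Matrix.inv_def, Matrix.det_fin_two]
  apply Subtype.ext
  rw [pgl, adjointPGL_mk, h1, Matrix.mul_smul]
  change _ = (a * d - b * c)⁻¹ • (traceless _ _ _).1
  congr 1
  ext i j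
  fin_cases i <;> fin_cases j <;>
    simp [traceless, Matrix.GeneralLinearGroup.mkOfDetNeZero, Matrix.mul_apply, Fin.sum_univ_two] <;> ring

/-- The upper right entry of a traceless matrix. -/
def upperEntry : TracelessMatrix k →ₗ[k] k where
  toFun A := A.1 0 1
  map_add' _ _ := rfl
  map_smul' _ _ := rfl

theorem upperEntry_traceless (x y z : k) : upperEntry (traceless x y z) = x := rfl

/-- The upper right entry generates the dual representation: its translates by the three elements
used already see all coordinates. Morphisms to the adjoint representation can therefore be compared
on this one functional. -/
theorem eq_zero_of_upperEntry [CharZero k] {A : TracelessMatrix k}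
    (h : ∀ g, upperEntry (adjointPGL k g A) = 0) : A = 0 := by
  have h1 := h (pgl 1 0 0 1 (by simp))
  have h2 := h (pgl 0 1 (-1) 0 (by simp))
  have h3 := h (pgl 1 1 0 1 (by simp))
  rw [eq_traceless A, adjointPGL_pgl, map_smul, upperEntry_traceless] at h1 h2 h3
  norm_num at h1 h2 h3
  rw [h1, h2] at h3
  norm_num at h3
  rw [eq_traceless A, h1, h2, h3]
  ext i j
  fin_cases i <;> fin_cases j <;> simp [traceless]

/-- The standard basis of the traceless matrices. -/
def sl₂E : TracelessMatrix k := traceless 1 0 0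
/-- The standard basis of the traceless matrices. -/
def sl₂H : TracelessMatrix k := traceless 0 1 0
/-- The standard basis of the traceless matrices. -/
def sl₂F : TracelessMatrix k := traceless 0 0 1

theorem traceless_eq (x y z : k) : traceless x y z = x • sl₂E + y • sl₂H + z • sl₂F := by
  ext i j
  fin_cases i <;> fin_cases j <;> simp [traceless, sl₂E, sl₂H, sl₂F]

variable {V : RepPGL₂ k}

theorem hom_adjointRep_eq_zero [CharZero k] (f : V ⟶ adjointRep k)
    (h : ∀ v, upperEntry (toLin f v : TracelessMatrix k) = 0) : f = 0 := by
  apply toLin_injective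
  apply LinearMap.ext
  intro v
  apply eq_zero_of_upperEntry (k := k)
  intro g
  rw [← h (V.obj.ρ g v)]
  exact congrArg upperEntry (toLin_ρ f g v).symm

theorem adjointPGL_di (t : kˣ) (x y z : k) : adjointPGL k (di t) (traceless x y z) =
    traceless (t * x) y ((t : k)⁻¹ * z) := by
  rw [di, adjointPGL_pgl, traceless_eq, traceless_eq, smul_add, smul_add, smul_smul, smul_smul, smul_smul]
  have : (t : k) ≠ 0 := t.ne_zero
  congr 3 <;> field_simp <;> ring

theorem adjointPGL_lo (r : k) (x y z : k) : adjointPGL k (lo r) (traceless x y z) =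
    traceless x (y - r * x) (z + 2 * r * y - r ^ 2 * x) := by
  rw [lo, adjointPGL_pgl, traceless_eq, traceless_eq, smul_add, smul_add, smul_smul, smul_smul, smul_smul]
  congr 3 <;> field_simp <;> ring

theorem upperEntry_di (t : kˣ) (A : TracelessMatrix k) :
    upperEntry (adjointPGL k (di t) A) = t * upperEntry A := by
  rw [eq_traceless A, adjointPGL_di]
  rfl

theorem upperEntry_lo (r : k) (A : TracelessMatrix k) :
    upperEntry (adjointPGL k (lo r) A) = upperEntry A := by
  rw [eq_traceless A, adjointPGL_lo]
  rfl

theorem adjointPGL_di_E (t : kˣ) : adjointPGL k (di t) sl₂E = (t : k) • sl₂E := by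
  rw [sl₂E, adjointPGL_di, traceless_eq, traceless_eq]; simp

theorem adjointPGL_di_H (t : kˣ) : adjointPGL k (di t) sl₂H = sl₂H := by
  rw [sl₂H, adjointPGL_di, traceless_eq, traceless_eq]; simp

theorem adjointPGL_di_F (t : kˣ) : adjointPGL k (di t) sl₂F = (t : k)⁻¹ • sl₂F := by
  rw [sl₂F, adjointPGL_di, traceless_eq, traceless_eq]; simp

theorem adjointPGL_lo_E : adjointPGL k (lo 1) sl₂E = sl₂E - sl₂H - sl₂F := by
  rw [sl₂E, adjointPGL_lo, traceless_eq, traceless_eq]; simp only [one_smul, zero_smul]; module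

theorem linearMap_traceless_ext {M : Type*} [AddCommGroup M] [Module k M] {f g : TracelessMatrix k →ₗ[k] M}
    (hE : f sl₂E = g sl₂E) (hH : f sl₂H = g sl₂H) (hF : f sl₂F = g sl₂F) : f = g := by
  apply LinearMap.ext
  intro A
  rw [eq_traceless A, traceless_eq]
  simp only [map_add, map_smul, hE, hH, hF]

section
variable [CharZero k]

/-- Under `di 2` the vectors `E`, `H`, `F` have the distinct eigenvalues `2`, `1`, `1/2`. -/
theorem upperEntry_unique {f : TracelessMatrix k →ₗ[k] k}
    (hf : ∀ A, f (adjointPGL k (di (Units.mk0 2 two_ne_zero)) A) = 2 * f A) :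
    f = f sl₂E • upperEntry := by
  apply linearMap_traceless_ext
  · simp [sl₂E, upperEntry_traceless]
  · have := hf sl₂H
    rw [adjointPGL_di_H] at this
    simp only [LinearMap.smul_apply, sl₂H, upperEntry_traceless] at this ⊢
    linear_combination -this
  · have := hf sl₂F
    rw [adjointPGL_di_F, map_smul, Units.val_mk0, smul_eq_mul] at this
    simp only [LinearMap.smul_apply, sl₂F, upperEntry_traceless] at this ⊢
    field_simp at this
    linear_combination -this / 3

theorem adjointRep_end (f : adjointRep k ⟶ adjointRep k) : ∃ c : k, f = c • 𝟙 _ := by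
  let f' : TracelessMatrix k →ₗ[k] TracelessMatrix k := toLin f
  refine ⟨upperEntry (f' sl₂E), sub_eq_zero.1 (hom_adjointRep_eq_zero _ fun v => ?_)⟩
  rw [toLin_sub]
  have h := upperEntry_unique (f := upperEntry ∘ₗ f') (fun A => by
    have := congrArg upperEntry (toLin_ρ f (di (Units.mk0 2 two_ne_zero)) A)
    exact this.trans (upperEntry_di _ _))
  have h1 := LinearMap.congr_fun h v
  exact (map_sub upperEntry _ _).trans (sub_eq_zero.2 h1)

/-- By `di 2`-weights only `B E H` and `B H E` can be nonzero. -/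
theorem bilinear_upperEntry_eq_zero {B : TracelessMatrix k →ₗ[k] TracelessMatrix k →ₗ[k] k}
    (hdi : ∀ x y, B (adjointPGL k (di (Units.mk0 2 two_ne_zero)) x)
      (adjointPGL k (di (Units.mk0 2 two_ne_zero)) y) = 2 * B x y)
    (hlo : ∀ x y, B (adjointPGL k (lo 1) x) (adjointPGL k (lo 1) y) = B x y)
    (h0 : B sl₂E sl₂H = 0) : B = 0 := by
  have key : ∀ {x y : TracelessMatrix k} {a b : k},
      adjointPGL k (di (Units.mk0 2 two_ne_zero)) x = a • x →
      adjointPGL k (di (Units.mk0 2 two_ne_zero)) y = b • y → a * b ≠ 2 → B x y = 0 := by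
    intro x y a b hx hy hab
    have := hdi x y
    rw [hx, hy, map_smul, map_smul, LinearMap.smul_apply, smul_eq_mul, smul_eq_mul, ← mul_assoc,
      mul_comm b a, ← sub_eq_zero, ← sub_mul] at this
    exact (mul_eq_zero.1 this).resolve_left (sub_ne_zero.2 hab)
  have hE := adjointPGL_di_E (Units.mk0 (2 : k) two_ne_zero)
  have hH : adjointPGL k (di (Units.mk0 (2 : k) two_ne_zero)) sl₂H = (1 : k) • sl₂H := by
    rw [adjointPGL_di_H, one_smul]
  have hF := adjointPGL_di_F (Units.mk0 (2 : k) two_ne_zero)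
  rw [Units.val_mk0] at hE hF
  have hEE := key hE hE (by norm_num)
  have hEF := key hE hF (by norm_num)
  have hFE := key hF hE (by norm_num)
  have hHH := key hH hH (by norm_num)
  have hHF := key hH hF (by norm_num)
  have hFH := key hF hH (by norm_num)
  have hFF := key hF hF (by norm_num)
  -- Expanding `B` at `lo 1 • E = E - H - F` in both arguments gives `B E H + B H E = 0`.
  have hHE : B sl₂H sl₂E = 0 := by
    have := hlo sl₂E sl₂E
    rw [adjointPGL_lo_E] at this
    simp only [map_sub, LinearMap.sub_apply, hEE, hEF, hFE, hHH, hHF, hFH, hFF, h0] at this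
    simpa using this
  apply linearMap_traceless_ext <;> apply linearMap_traceless_ext <;> simpa

end

/-- The commutator of traceless matrices. -/
def tracelessBracket : TracelessMatrix k →ₗ[k] TracelessMatrix k →ₗ[k] TracelessMatrix k :=
  LinearMap.mk₂ k (fun A B => ⟨A.1 * B.1 - B.1 * A.1, by
      simp [LinearMap.mem_ker, Matrix.trace_mul_comm A.1 B.1]⟩)
    (fun A A' B => by ext1; simp [add_mul, mul_add]; abel)
    (fun c A B => by ext1; simp [smul_sub])
    (fun A B B' => by ext1; simp [add_mul, mul_add]; abel)
    (fun c A B => by ext1; simp [smul_sub])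

theorem tracelessBracket_apply (A B : TracelessMatrix k) :
    (tracelessBracket A B).1 = A.1 * B.1 - B.1 * A.1 := rfl

/-- The trace form on traceless matrices. -/
def tracelessForm : TracelessMatrix k →ₗ[k] TracelessMatrix k →ₗ[k] k :=
  LinearMap.mk₂ k (fun A B => Matrix.trace (A.1 * B.1))
    (fun A A' B => by simp [add_mul])
    (fun c A B => by simp)
    (fun A B B' => by simp [mul_add])
    (fun c A B => by simp)

theorem tracelessForm_apply (A B : TracelessMatrix k) :
    tracelessForm A B = Matrix.trace (A.1 * B.1) := rfl

theorem tracelessBracket_adjointPGL (g : PGL(2, k)) (A B : TracelessMatrix k) :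
    tracelessBracket (adjointPGL k g A) (adjointPGL k g B) = adjointPGL k g (tracelessBracket A B) := by
  induction g using Matrix.ProjGenLinGroup.induction_on with
  | mk g =>
    ext1
    simp only [tracelessBracket_apply, adjointPGL_mk]
    simp [mul_sub, sub_mul, mul_assoc]

theorem tracelessForm_adjointPGL (g : PGL(2, k)) (A B : TracelessMatrix k) :
    tracelessForm (adjointPGL k g A) (adjointPGL k g B) = tracelessForm A B := by
  induction g using Matrix.ProjGenLinGroup.induction_on with
  | mk g =>
    simp only [tracelessForm_apply, adjointPGL_mk]
    rw [Matrix.trace_mul_comm]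
    simp [mul_assoc]
    rw [Matrix.trace_mul_comm]
    simp [mul_assoc]
    exact Matrix.trace_mul_comm _ _

variable (k) in
/-- The commutator as a morphism of representations. -/
noncomputable def adjointBracket : adjointRep k ⊗ adjointRep k ⟶ adjointRep k :=
  ofLin (V := adjointRep k ⊗ adjointRep k) (TensorProduct.lift (tracelessBracket (k := k))) (by
    intro g x
    have : TensorProduct.lift tracelessBracket ∘ₗ TensorProduct.map (adjointPGL k g) (adjointPGL k g) =
        adjointPGL k g ∘ₗ TensorProduct.lift tracelessBracket :=
      TensorProduct.ext' fun A B => tracelessBracket_adjointPGL g A B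
    exact LinearMap.congr_fun this x)

variable (k) in
/-- The trace form as a morphism of representations. -/
noncomputable def adjointForm : adjointRep k ⊗ adjointRep k ⟶ 𝟙_ (RepPGL₂ k) :=
  ofLin (V := adjointRep k ⊗ adjointRep k) (W := 𝟙_ (RepPGL₂ k))
    (TensorProduct.lift (tracelessForm (k := k))) (by
    intro g x
    have : TensorProduct.lift tracelessForm ∘ₗ TensorProduct.map (adjointPGL k g) (adjointPGL k g) =
        TensorProduct.lift tracelessForm :=
      TensorProduct.ext' fun A B => tracelessForm_adjointPGL g A B
    exact LinearMap.congr_fun this x)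

theorem tracelessBracket_traceless (x y z x' y' z' : k) :
    tracelessBracket (traceless x y z) (traceless x' y' z') =
      traceless (2 * (y * x' - x * y')) (x * z' - z * x') (2 * (z * y' - y * z')) := by
  ext i j
  fin_cases i <;> fin_cases j <;>
    simp [tracelessBracket_apply, traceless] <;> ring

theorem tracelessForm_traceless (x y z x' y' z' : k) :
    tracelessForm (traceless x y z) (traceless x' y' z') = 2 * y * y' + x * z' + z * x' := by
  simp [tracelessForm_apply, traceless, Matrix.trace_fin_two]
  ring

theorem eq_smul_adjointBracket [CharZero k] (f : adjointRep k ⊗ adjointRep k ⟶ adjointRep k) :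
    ∃ c : k, f = c • adjointBracket k := by
  let f' : TracelessMatrix k ⊗[k] TracelessMatrix k →ₗ[k] TracelessMatrix k := toLin f
  -- The commutator satisfies `[E, H] = -2 E`, so this is the only possible coefficient.
  let c : k := upperEntry (f' (sl₂E ⊗ₜ sl₂H)) / (-2)
  refine ⟨c, sub_eq_zero.1 (hom_adjointRep_eq_zero _ ?_)⟩
  let d : adjointRep k ⊗ adjointRep k ⟶ adjointRep k := f - c • adjointBracket k
  let d' : TracelessMatrix k ⊗[k] TracelessMatrix k →ₗ[k] TracelessMatrix k := toLin d
  let B : TracelessMatrix k →ₗ[k] TracelessMatrix k →ₗ[k] k := TensorProduct.curry (upperEntry ∘ₗ d')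
  have hB : B = 0 := by
    apply bilinear_upperEntry_eq_zero
    · intro x y
      have := congrArg upperEntry (toLin_ρ d (di (Units.mk0 2 two_ne_zero)) (x ⊗ₜ[k] y))
      exact this.trans (upperEntry_di _ _)
    · intro x y
      have := congrArg upperEntry (toLin_ρ d (lo 1) (x ⊗ₜ[k] y))
      exact this.trans (upperEntry_lo _ _)
    · have h1 : d' = f' - c • TensorProduct.lift tracelessBracket := toLin_sub _ _
      change upperEntry (d' (sl₂E ⊗ₜ sl₂H)) = 0
      rw [h1, LinearMap.sub_apply, map_sub, LinearMap.smul_apply, map_smul, TensorProduct.lift.tmul,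
        sl₂E, sl₂H, tracelessBracket_traceless, upperEntry_traceless, smul_eq_mul]
      change upperEntry (f' (sl₂E ⊗ₜ sl₂H)) - upperEntry (f' (sl₂E ⊗ₜ sl₂H)) / (-2) * _ = 0
      ring
  have h2 : upperEntry ∘ₗ d' = 0 := TensorProduct.ext hB
  exact fun v => LinearMap.congr_fun h2 v

end Adjoint

/-! ### Amplitudes of the adjoint representation -/

section AdjointAmplitudes

variable {k : Type} [Field k]

theorem sl₂E_ne_zero : (sl₂E : TracelessMatrix k) ≠ 0 := fun h =>
  one_ne_zero (congrArg upperEntry h : (1 : k) = 0)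

theorem id_adjointRep_ne_zero : 𝟙 (adjointRep k) ≠ 0 := fun h =>
  sl₂E_ne_zero (LinearMap.congr_fun (congrArg toLin h) (sl₂E : TracelessMatrix k))

theorem smul_id_unit_injective {c d : k} (h : c • 𝟙 (𝟙_ (RepPGL₂ k)) = d • 𝟙 (𝟙_ (RepPGL₂ k))) :
    c = d := by
  have := LinearMap.congr_fun (congrArg toLin h) (1 : k)
  exact (mul_one c).symm.trans (this.trans (mul_one d))

theorem eq_of_smul_hom_eq {V W : RepPGL₂ k} {f : V ⟶ W} (hf : f ≠ 0) {c d : k}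
    (h : c • f = d • f) : c = d := by
  rw [← sub_eq_zero, ← sub_smul, smul_eq_zero] at h
  exact sub_eq_zero.1 (h.resolve_right hf)

theorem nonempty_exactPairing_of_iso {V : RepPGL₂ k} (h : Nonempty (V ≅ dualRep V)) :
    Nonempty (ExactPairing V V) := by
  obtain ⟨e⟩ := h
  let := dualRepPairing V
  exact ⟨exactPairingCongrRight e⟩

theorem toLin_tetra {V : RepPGL₂ k} (m : V ⊗ V ⟶ V) (d : V ⟶ V ⊗ V) : toLin (tetra m d) =
    toLin m ∘ₗ LinearMap.lTensor V.obj (toLin m) ∘ₗ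
      (TensorProduct.assoc k V.obj V.obj V.obj).toLinearMap ∘ₗ
        LinearMap.rTensor V.obj (toLin d) ∘ₗ toLin d := by
  rw [← toLin_associator_hom]
  rfl

/-- Since the endomorphism will be a scalar, its value on `E` suffices. After applying `D` twice and
`M` once on the right, `2 r² s • (H ⊗ E - E ⊗ H)` remains, and `M` maps `H ⊗ E - E ⊗ H` to `4 s •
E`. -/
theorem tetra_of_triple {V : Type*} [AddCommGroup V] [Module k V] {D : V →ₗ[k] V ⊗[k] V}
    {M : V ⊗[k] V →ₗ[k] V} {E H F : V} {r s : k}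
    (hE : D E = r • (H ⊗ₜ[k] E - E ⊗ₜ[k] H)) (hH : D H = (r * 2) • (E ⊗ₜ[k] F - F ⊗ₜ[k] E))
    (hHE : M (H ⊗ₜ E) = s • (2 : k) • E) (hEH : M (E ⊗ₜ H) = s • (-2 : k) • E)
    (hFE : M (F ⊗ₜ E) = s • (-1 : k) • H) (hEE : M (E ⊗ₜ E) = 0) (hHH : M (H ⊗ₜ H) = 0) :
    M (LinearMap.lTensor V M (TensorProduct.assoc k V V V (LinearMap.rTensor V D (D E)))) =
      (8 * r ^ 2 * s ^ 2) • E := by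
  simp only [hE, hH, map_smul, map_sub, LinearMap.rTensor_tmul, TensorProduct.sub_tmul,
    ← TensorProduct.smul_tmul', TensorProduct.assoc_tmul, LinearMap.lTensor_tmul, hHE, hEH, hFE, hEE,
    hHH, TensorProduct.tmul_smul, TensorProduct.tmul_zero]
  simp only [map_zero]
  module

theorem dualMul_smul {V : RepPGL₂ k} [ExactPairing V V] (a : k) (m : V ⊗ V ⟶ V) :
    dualMul (a • m) = a • dualMul m := by
  simp [dualMul, rightAdjointMate]

variable [CharZero k]

theorem tracelessForm_injective : Function.Injective (tracelessForm (k := k)) := by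
  rw [injective_iff_map_eq_zero]
  intro A hA
  have hE := LinearMap.congr_fun hA sl₂E
  have hH := LinearMap.congr_fun hA sl₂H
  have hF := LinearMap.congr_fun hA sl₂F
  rw [eq_traceless A, sl₂E, tracelessForm_traceless] at hE
  rw [eq_traceless A, sl₂H, tracelessForm_traceless] at hH
  rw [eq_traceless A, sl₂F, tracelessForm_traceless] at hF
  norm_num at hE hH hF
  rw [eq_traceless A, traceless_eq, hE, hH, hF]
  simp

theorem nonempty_adjointRep_iso_dualRep : Nonempty (adjointRep k ≅ dualRep (adjointRep k)) := by
  let e : TracelessMatrix k ≃ₗ[k] Module.Dual k (TracelessMatrix k) :=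
    LinearMap.linearEquivOfInjective tracelessForm tracelessForm_injective
      Subspace.dual_finrank_eq.symm
  have he : ∀ g A, e (adjointPGL k g A) = (adjointPGL k).dual g (e A) := by
    intro g A
    ext1 B
    rw [Representation.dual_apply]
    change tracelessForm _ _ = tracelessForm A (adjointPGL k g⁻¹ B)
    rw [← tracelessForm_adjointPGL g A, ← Module.End.mul_apply, ← map_mul, mul_inv_cancel, map_one,
      Module.End.one_apply]
  refine ⟨⟨ofLin (V := adjointRep k) (W := dualRep (adjointRep k)) e.toLinearMap he,
    ofLin (V := dualRep (adjointRep k)) (W := adjointRep k) e.symm.toLinearMap fun g h => ?_,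
    toLin_injective ?_, toLin_injective ?_⟩⟩
  · apply e.injective
    refine (e.apply_symm_apply _).trans ?_
    refine Eq.trans ?_ (he g (e.symm h)).symm
    exact congrArg ((adjointPGL k).dual g) (e.apply_symm_apply h).symm
  · exact LinearMap.ext e.symm_apply_apply
  · exact LinearMap.ext e.apply_symm_apply

theorem nonempty_exactPairing_adjointRep : Nonempty (ExactPairing (adjointRep k) (adjointRep k)) :=
  nonempty_exactPairing_of_iso nonempty_adjointRep_iso_dualRep

theorem adjointBracket_ne_zero : adjointBracket k ≠ 0 := fun h => by
  have h1 : TensorProduct.lift (tracelessBracket (k := k)) (sl₂E ⊗ₜ sl₂H) = 0 :=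
    LinearMap.congr_fun (congrArg toLin h) ((sl₂E : TracelessMatrix k) ⊗ₜ[k] (sl₂H : TracelessMatrix k))
  rw [TensorProduct.lift.tmul, sl₂E, sl₂H, tracelessBracket_traceless] at h1
  have h2 := congrArg upperEntry h1
  rw [upperEntry_traceless] at h2
  norm_num at h2

theorem finrank_hom_tensor_adjointRep :
    Module.finrank k (adjointRep k ⊗ adjointRep k ⟶ adjointRep k) = 1 :=
  finrank_eq_one (adjointBracket k) adjointBracket_ne_zero fun f => by
    obtain ⟨c, hc⟩ := eq_smul_adjointBracket f
    exact ⟨c, hc.symm⟩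

theorem finrank_hom_tensor_adjointRep_unit :
    Module.finrank k (adjointRep k ⊗ adjointRep k ⟶ 𝟙_ (RepPGL₂ k)) = 1 := by
  obtain ⟨_⟩ := nonempty_exactPairing_adjointRep (k := k)
  exact finrank_eq_one _ (evaluation_ne_zero id_adjointRep_ne_zero) fun f => by
    obtain ⟨c, hc⟩ := eq_smul_evaluation adjointRep_end f
    exact ⟨c, hc.symm⟩

theorem eq_smul_id_adjointRep {f : adjointRep k ⟶ adjointRep k} {c : k}
    (h : (toLin f (sl₂E : TracelessMatrix k) : TracelessMatrix k) = c • sl₂E) : f = c • 𝟙 _ := by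
  obtain ⟨d, rfl⟩ := adjointRep_end f
  have h1 : (d • sl₂E : TracelessMatrix k) = c • sl₂E := h
  have h2 : d = c := smul_left_injective k (sl₂E_ne_zero (k := k)) h1
  rw [h2]

variable [ExactPairing (adjointRep k) (adjointRep k)]

theorem exists_evaluation_adjointRep : ∃ c : k, c ≠ 0 ∧
    ε_ (adjointRep k) (adjointRep k) = c • adjointForm k := by
  obtain ⟨c, hc⟩ := eq_smul_evaluation adjointRep_end (adjointForm k)
  have hc0 : c ≠ 0 := by
    rintro rfl
    rw [zero_smul] at hc
    have h1 : TensorProduct.lift (tracelessForm (k := k)) (sl₂E ⊗ₜ sl₂F) = 0 :=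
      LinearMap.congr_fun (congrArg toLin hc)
        ((sl₂E : TracelessMatrix k) ⊗ₜ[k] (sl₂F : TracelessMatrix k))
    rw [TensorProduct.lift.tmul, sl₂E, sl₂F, tracelessForm_traceless] at h1
    norm_num at h1
  refine ⟨c⁻¹, inv_ne_zero hc0, ?_⟩
  rw [hc, smul_smul, inv_mul_cancel₀ hc0, one_smul]

/-- The pairing is a multiple of the trace form, which is symmetric; so the sign is `+1` and the
trace is the dimension. -/
theorem selfDualTrace_id_adjointRep :
    selfDualTrace (𝟙 (adjointRep k)) = (3 : k) • 𝟙 (𝟙_ (RepPGL₂ k)) := by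
  obtain ⟨c, -, hc⟩ := exists_evaluation_adjointRep (k := k)
  have h := coevaluation_evaluation_eq_dim (V := adjointRep k) (σ := 1) (Or.inl rfl) (fun x => by
    have h1 : TensorProduct.lift (tracelessForm (k := k)) ∘ₗ
        (TensorProduct.comm k (TracelessMatrix k) (TracelessMatrix k)).toLinearMap =
        TensorProduct.lift (tracelessForm (k := k)) :=
      TensorProduct.ext' fun A B => Matrix.trace_mul_comm B.1 A.1
    rw [one_mul, hc]
    exact congrArg (c * ·) (LinearMap.congr_fun h1 x))
  have hd : repDim (adjointRep k) = 3 := by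
    let e : TracelessMatrix k ≃ₗ[k] (Fin 3 → k) :=
      { toFun := fun A => ![A.1 0 1, A.1 0 0, A.1 1 0]
        invFun := fun v => traceless (v 0) (v 1) (v 2)
        map_add' := fun A B => by ext i; fin_cases i <;> rfl
        map_smul' := fun c A => by ext i; fin_cases i <;> rfl
        left_inv := fun A => (eq_traceless A).symm
        right_inv := fun v => by ext i; fin_cases i <;> rfl }
    exact e.finrank_eq.trans (Module.finrank_fin_fun k)
  rw [hd, one_mul] at h
  rw [selfDualTrace, id_whiskerRight, Category.id_comp, h]
  norm_num

theorem selfDualTrace_smul_id_adjointRep (c : k) :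
    selfDualTrace (c • 𝟙 (adjointRep k)) = (3 * c) • 𝟙 (𝟙_ (RepPGL₂ k)) := by
  rw [selfDualTrace, MonoidalLinear.smul_whiskerRight, Linear.smul_comp, Linear.comp_smul, mul_comm,
    ← smul_smul, ← selfDualTrace_id_adjointRep]
  rfl

/-- The dual of a multiple of the commutator, in the standard basis. -/
theorem toLin_dualMul_adjointRep {c s : k} (hc0 : c ≠ 0)
    (hc : ε_ (adjointRep k) (adjointRep k) = c • adjointForm k)
    (x y z : k) :
    (toLin (V := adjointRep k) (W := adjointRep k ⊗ adjointRep k) (dualMul (s • adjointBracket k))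
      (traceless x y z : TracelessMatrix k) : TracelessMatrix k ⊗[k] TracelessMatrix k) =
      (s / c) • (x • (sl₂H (k := k) ⊗ₜ[k] sl₂E (k := k) - sl₂E (k := k) ⊗ₜ[k] sl₂H (k := k)) +
        (2 * y) • (sl₂E (k := k) ⊗ₜ[k] sl₂F (k := k) - sl₂F (k := k) ⊗ₜ[k] sl₂E (k := k)) +
        z • (sl₂F (k := k) ⊗ₜ[k] sl₂H (k := k) - sl₂H (k := k) ⊗ₜ[k] sl₂F (k := k))) := by
  let a : Fin 3 → TracelessMatrix k := ![sl₂E, sl₂H, sl₂F]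
  -- The basis dual to `E`, `H`, `F` for `c` times the trace form, in which `(E, F) = c`, `(H, H) =
  -- 2c` and the other pairings vanish.
  let b : Fin 3 → TracelessMatrix k := ![c⁻¹ • sl₂F, (c⁻¹ / 2) • sl₂H, c⁻¹ • sl₂E]
  have hab : ∀ p : TracelessMatrix k, ∑ i, (c * tracelessForm p (a i)) • b i = p := by
    intro p
    rw [eq_traceless p]
    simp only [Fin.sum_univ_three, a, b, Matrix.cons_val]
    simp only [sl₂E, sl₂H, sl₂F, tracelessForm_traceless]
    rw [traceless_eq (p.1 0 1)]
    simp only [smul_smul, sl₂E, sl₂H, sl₂F]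
    match_scalars <;> field_simp <;> ring
  have hε : ∀ A B : TracelessMatrix k,
      (toLin (ε_ (adjointRep k) (adjointRep k)) (A ⊗ₜ[k] B) : k) = c * tracelessForm A B := by
    intro A B
    rw [hc]
    rfl
  have h := toLin_dualMul (V := adjointRep k) (a := a) (b := b) (fun p => by
    refine Eq.trans ?_ (hab p)
    exact Finset.sum_congr rfl fun i _ => congrArg (· • b i) (hε p (a i)))
    (s • adjointBracket k) (traceless x y z : TracelessMatrix k)
  have h2 : ∀ i j, (toLin (ε_ (adjointRep k) (adjointRep k)) ((traceless x y z : TracelessMatrix k) ⊗ₜ[k]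
      (toLin (s • adjointBracket k) (a i ⊗ₜ[k] a j) : TracelessMatrix k)) : k) =
      c * tracelessForm (traceless x y z) (s • tracelessBracket (a i) (a j)) := fun i j => hε _ _
  have h3 : _ = ∑ i, ∑ j, (c * tracelessForm (traceless x y z) (s • tracelessBracket (a i) (a j))) •
      (b j ⊗ₜ[k] b i : TracelessMatrix k ⊗[k] TracelessMatrix k) :=
    h.trans (Finset.sum_congr rfl fun i _ => Finset.sum_congr rfl fun j _ =>
      congrArg (· • (b j ⊗ₜ[k] b i)) (h2 i j))
  refine h3.trans ?_
  simp only [Fin.sum_univ_three, a, b, Matrix.cons_val, map_smul, sl₂E, sl₂H, sl₂F,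
    tracelessBracket_traceless, tracelessForm_traceless, ← TensorProduct.smul_tmul',
    TensorProduct.tmul_smul, smul_smul, smul_eq_mul]
  match_scalars <;> field_simp <;> ring

/-- With the pairing `c` times the trace form, `u = 4 s² / c`, and the tetrahedral scalar is `8
(s/c)² s² = u² / 2`. -/
theorem exists_dualMul_comp (s : k) : ∃ u : k, (u = 0 ↔ s = 0) ∧
    dualMul (s • adjointBracket k) ≫ (s • adjointBracket k) = u • 𝟙 _ ∧
    tetra (s • adjointBracket k) (dualMul (s • adjointBracket k)) = (u ^ 2 / 2) • 𝟙 _ := by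
  obtain ⟨c, hc0, hc⟩ := exists_evaluation_adjointRep (k := k)
  let D : TracelessMatrix k →ₗ[k] TracelessMatrix k ⊗[k] TracelessMatrix k :=
    toLin (dualMul (s • adjointBracket k))
  let M : TracelessMatrix k ⊗[k] TracelessMatrix k →ₗ[k] TracelessMatrix k :=
    toLin (s • adjointBracket k)
  have hd : ∀ x y z, D (traceless x y z) = _ := toLin_dualMul_adjointRep (s := s) hc0 hc
  have hm : ∀ A B : TracelessMatrix k, M (A ⊗ₜ[k] B) = s • tracelessBracket A B := fun A B => rfl
  have hE : D sl₂E = (s / c) • (sl₂H (k := k) ⊗ₜ[k] sl₂E (k := k) - sl₂E (k := k) ⊗ₜ[k] sl₂H (k := k)) := by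
    rw [sl₂E, hd]
    simp [sl₂E]
  have hH : D sl₂H = (s / c * 2) • (sl₂E (k := k) ⊗ₜ[k] sl₂F (k := k) - sl₂F (k := k) ⊗ₜ[k] sl₂E (k := k)) := by
    rw [sl₂H, hd]
    simp [smul_smul]
  have hHE : tracelessBracket (sl₂H (k := k)) sl₂E = (2 : k) • sl₂E := by
    rw [sl₂E, sl₂H, tracelessBracket_traceless, traceless_eq, traceless_eq]
    simp
  have hEH : tracelessBracket (sl₂E (k := k)) sl₂H = (-2 : k) • sl₂E := by
    rw [sl₂E, sl₂H, tracelessBracket_traceless, traceless_eq, traceless_eq]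
    simp
  have hFE : tracelessBracket (sl₂F (k := k)) sl₂E = (-1 : k) • sl₂H := by
    rw [sl₂E, sl₂F, sl₂H, tracelessBracket_traceless, traceless_eq, traceless_eq]
    simp
  have hself : ∀ A : TracelessMatrix k, tracelessBracket A A = 0 := fun A => Subtype.ext (sub_self _)
  have h1 : M (D sl₂E) = (4 * s ^ 2 / c) • sl₂E := by
    rw [hE, map_smul, map_sub, hm, hm, hHE, hEH]
    match_scalars
    ring
  have h2 := tetra_of_triple (D := D) (M := M) hE hH (by rw [hm, hHE]) (by rw [hm, hEH])
    (by rw [hm, hFE]) (by rw [hm, hself, smul_zero]) (by rw [hm, hself, smul_zero])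
  have h3 : 8 * (s / c) ^ 2 * s ^ 2 = (4 * s ^ 2 / c) ^ 2 / 2 := by ring
  rw [h3] at h2
  refine ⟨4 * s ^ 2 / c, by simp [hc0], eq_smul_id_adjointRep h1, eq_smul_id_adjointRep ?_⟩
  rw [toLin_tetra]
  exact h2

theorem amplitude_adjointRep {m : adjointRep k ⊗ adjointRep k ⟶ adjointRep k} : ∃ u : k,
    (u = 0 ↔ m = 0) ∧ dualMul m ≫ m = u • 𝟙 _ ∧ tetra m (dualMul m) = (u ^ 2 / 2) • 𝟙 _ ∧
    amplitudeT₂ m = (3 * u) • 𝟙 _ ∧ amplitudeT₄ m = (3 / 2 * u ^ 2) • 𝟙 _ := by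
  obtain ⟨s, rfl⟩ := eq_smul_adjointBracket m
  obtain ⟨u, h0, h1, h2⟩ := exists_dualMul_comp s
  refine ⟨u, ?_, h1, h2, ?_, ?_⟩
  · rw [h0, smul_eq_zero, or_iff_left adjointBracket_ne_zero]
  · rw [amplitudeT₂, h1, selfDualTrace_smul_id_adjointRep]
  · refine (congrArg selfDualTrace h2).trans ?_
    rw [selfDualTrace_smul_id_adjointRep]
    congr 1
    ring

/-- Multiplying `m` by `a` multiplies `m m_*` by `a ^ 2`, so a square root of `u⁻¹` is needed. -/
theorem exists_dualMul_comp_eq_id [IsAlgClosed k] :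
    ∃ m : adjointRep k ⊗ adjointRep k ⟶ adjointRep k, dualMul m ≫ m = 𝟙 (adjointRep k) := by
  obtain ⟨u, h0, h1, -⟩ := exists_dualMul_comp (k := k) 1
  obtain ⟨a, ha⟩ := IsAlgClosed.exists_pow_nat_eq u⁻¹ zero_lt_two
  refine ⟨a • (1 : k) • adjointBracket k, ?_⟩
  rw [dualMul_smul, Linear.smul_comp, Linear.comp_smul, h1, smul_smul, smul_smul, ← pow_two, ha,
    inv_mul_cancel₀ (fun h => one_ne_zero (h0.1 h)), one_smul]

end AdjointAmplitudes

/-! ### Bad primes -/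

section BadPrimes

theorem PadicAlgCl.natCast_inv_not_integral (p : ℕ) [Fact p.Prime] :
    ((p : PadicAlgCl p)⁻¹) ∉ PadicAlgClInt p := by
  intro h
  have hp : 1 < p := (Fact.out : p.Prime).one_lt
  have h1 : (PadicAlgCl.valued p).v ((p : PadicAlgCl p)⁻¹) ≤ 1 := h
  have h2 : (PadicAlgCl.valued p).v (p : PadicAlgCl p) = 1 / (p : NNReal) := PadicAlgCl.valuation_p p
  rw [map_inv₀, h2, one_div, inv_inv] at h1
  exact absurd (by exact_mod_cast h1 : p ≤ 1) (not_le.2 hp)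

theorem three_halves_not_integral [Fact (Nat.Prime 2)] : (3 / 2 : PadicAlgCl 2) ∉ PadicAlgClInt 2 := by
  intro h
  apply PadicAlgCl.natCast_inv_not_integral 2
  have h1 : ((2 : ℕ) : PadicAlgCl 2)⁻¹ = 3 / 2 - 1 := by push_cast; norm_num
  rw [h1]
  exact sub_mem h (one_mem _)

/-- With `m m_* = 1` one has `u = 1`, and `exists_tetra_eq` makes the scalar `1/2` itself integral,
before any trace is taken. -/
theorem isBadPrime_two [Fact (Nat.Prime 2)] (ι : QBar →+* PadicAlgCl 2) :
    IsBadPrime.{w₁, w₂} 2 ι (RepPGL₂ QBar) := by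
  rintro ⟨Cp, _, _, _, _, _, _, -, -, Ct, _, _, _, _, _, _, hCt, -, D, _, _, _, _, _, _, G, H, hG, hH⟩
  obtain ⟨I, X, hX⟩ := hCt.exists_simpleBasis
  obtain ⟨_⟩ := nonempty_exactPairing_adjointRep (k := QBar)
  obtain ⟨m, hm⟩ := exists_dualMul_comp_eq_id (k := QBar)
  obtain ⟨u, h0, h1, h2, -⟩ := amplitude_adjointRep (m := m)
  have hu : u = 1 := eq_of_smul_hom_eq id_adjointRep_ne_zero (by rw [← h1, hm, one_smul])
  have hm0 : m ≠ 0 := fun h => one_ne_zero (hu.symm.trans (h0.2 h))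
  have hmul : ∀ f : adjointRep QBar ⊗ adjointRep QBar ⟶ adjointRep QBar, ∃ c : QBar, f = c • m :=
    fun f => exists_smul_eq_of_finrank_eq_one finrank_hom_tensor_adjointRep hm0 f |>.imp fun _ => Eq.symm
  -- Duality makes `Hom(X, X ⊗ X)` a line; `m_*` spans it because it is nonzero.
  have hcomul : ∀ f : adjointRep QBar ⟶ adjointRep QBar ⊗ adjointRep QBar,
      ∃ c : QBar, f = c • dualMul m := by
    intro f
    obtain ⟨a, ha⟩ := eq_smul_of_hom_tensor hmul (dualMul m)
    obtain ⟨b, hb⟩ := eq_smul_of_hom_tensor hmul f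
    have ha0 : a ≠ 0 := by
      rintro rfl
      rw [ha, zero_smul, zero_comp] at hm
      exact id_adjointRep_ne_zero hm.symm
    exact ⟨b * a⁻¹, by rw [hb, ha, smul_smul, mul_assoc, inv_mul_cancel₀ ha0, mul_one]⟩
  obtain ⟨x, hx⟩ := hG.exists_tetra_eq Subtype.val_injective hX hH id_adjointRep_ne_zero adjointRep_end
    hmul hcomul hm h2
  apply PadicAlgCl.natCast_inv_not_integral 2
  have h3 : ((2 : ℕ) : PadicAlgCl 2)⁻¹ = x := by
    refine Eq.trans ?_ hx.symm
    rw [hu, one_pow, map_div₀, map_one, map_ofNat]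
    norm_num
  rw [h3]
  exact x.2

/-- On the simple object of dimension `p = 2j + 1`, the unit splits off `V ⊗ V` by `η` and `ε / (σ
p)`. The zigzag of `η` and `ε` being the identity, the invariant scalar is `1 / (σ p)`, which is not
integral. -/
theorem isBadPrime_of_ne_two {p : ℕ} [Fact p.Prime] (hp : p ≠ 2) (ι : QBar →+* PadicAlgCl p) :
    IsBadPrime.{w₁, w₂} p ι (RepPGL₂ QBar) := by
  rintro ⟨Cp, _, _, _, _, _, _, -, -, Ct, _, _, _, _, _, _, hCt, -, D, _, _, _, _, _, _, G, H, hG, hH⟩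
  obtain ⟨I, X, hX⟩ := hCt.exists_simpleBasis
  have hpp : p.Prime := Fact.out
  obtain ⟨j, hj⟩ := hpp.odd_of_ne_two hp
  let V := formRep QBar j
  obtain ⟨_⟩ := nonempty_exactPairing_of_iso (nonempty_dualRep_iso (k := QBar) j)
  have hV : 𝟙 V ≠ 0 := id_formRep_ne_zero j
  have hend : ∀ f : V ⟶ V, ∃ c : QBar, f = c • 𝟙 V := fun f =>
    ((formRep_end (k := QBar) j).2 f).imp fun _ => Eq.symm
  obtain ⟨σ, hσ, hσ'⟩ := toLin_evaluation_comm hV hend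
  have hdim := coevaluation_evaluation_eq_dim hσ hσ'
  rw [show repDim V = p from (repDim_formRep j).trans hj.symm] at hdim
  have hσ0 : σ ≠ 0 := by rcases hσ with rfl | rfl <;> norm_num
  have ht : σ * (p : QBar) ≠ 0 := mul_ne_zero hσ0 (Nat.cast_ne_zero.2 hpp.ne_zero)
  obtain ⟨x, hx⟩ := hG.exists_zigzag_eq Subtype.val_injective hX hH (V := V)
    (r₀ := (σ * (p : QBar))⁻¹ • ε_ V V) (i₀ := η_ V V) (κ := (σ * (p : QBar))⁻¹) hV hend
    (fun h => one_ne_zero (smul_id_unit_injective (c := (1 : QBar)) (d := 0) (by rw [h, smul_zero, smul_zero])))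
    (fun f => ⟨_, hom_unit_eq_smul f⟩)
    (fun f => by
      obtain ⟨c, hc⟩ := eq_smul_evaluation hend f
      exact ⟨c * (σ * (p : QBar)), by rw [hc, smul_smul, mul_assoc, mul_inv_cancel₀ ht, mul_one]⟩)
    (eq_smul_coevaluation hend)
    (by rw [Linear.comp_smul, hdim, smul_smul, inv_mul_cancel₀ ht, one_smul])
    (by
      rw [← one_smul QBar (η_ V V), zigzag_smul, zigzag_evaluation_coevaluation, mul_one])
  apply PadicAlgCl.natCast_inv_not_integral p
  rw [map_inv₀, map_mul, map_natCast] at hx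
  rcases hσ with rfl | rfl
  · rw [map_one, one_mul] at hx
    rw [← hx]
    exact x.2
  · rw [map_neg, map_one, neg_one_mul, inv_neg] at hx
    rw [← neg_eq_iff_eq_neg.2 hx]
    exact neg_mem x.2

end BadPrimes

/-! ### The main theorem. -/

theorem mainTheorem9 :
    -- the category of rational representations is a semisimple rigid tensor category
    IsSemisimpleTensorCategory QBar (RepPGL₂ QBar) ∧
    -- its simple objects have dimensions `2 * m + 1`, one for each `m`
    (∃ V : ℕ → RepPGL₂ QBar, (∀ m, Simple (V m)) ∧ (∀ m, repDim (V m) = 2 * m + 1) ∧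
      ∀ S : RepPGL₂ QBar, Simple S → ∃ m, Nonempty (S ≅ V m)) ∧
    -- an odd prime divides the dimension of some simple object
    (∀ p : ℕ, p.Prime → p ≠ 2 → ∃ S : RepPGL₂ QBar, Simple S ∧ p ∣ repDim S) ∧
    -- the multiplication and the identification with the dual of the adjoint representation
    -- exist and are unique up to scaling
    Module.finrank QBar (adjointRep QBar ⊗ adjointRep QBar ⟶ adjointRep QBar) = 1 ∧
    Module.finrank QBar (adjointRep QBar ⊗ adjointRep QBar ⟶ 𝟙_ (RepPGL₂ QBar)) = 1 ∧
    Nonempty (ExactPairing (adjointRep QBar) (adjointRep QBar)) ∧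
    -- amplitudes of the adjoint representation
    (∀ _ : ExactPairing (adjointRep QBar) (adjointRep QBar),
      (∀ m : adjointRep QBar ⊗ adjointRep QBar ⟶ adjointRep QBar, m ≠ 0 →
        amplitudeT₂ m ≠ 0 ∧
        amplitudeT₄ m = (1 / 6 : QBar) • (amplitudeT₂ m ≫ amplitudeT₂ m)) ∧
      (∃ m : adjointRep QBar ⊗ adjointRep QBar ⟶ adjointRep QBar,
        dualMul m ≫ m = 𝟙 (adjointRep QBar)) ∧
      (∀ m : adjointRep QBar ⊗ adjointRep QBar ⟶ adjointRep QBar,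
        dualMul m ≫ m = 𝟙 (adjointRep QBar) →
          amplitudeT₂ m = (3 : QBar) • 𝟙 (𝟙_ (RepPGL₂ QBar)) ∧
          amplitudeT₄ m = (3 / 2 : QBar) • 𝟙 (𝟙_ (RepPGL₂ QBar)))) ∧
    -- the value `3 / 2` is not integral at `2`
    (∀ _ : Fact (Nat.Prime 2), (3 / 2 : PadicAlgCl 2) ∉ PadicAlgClInt 2) ∧
    -- all primes are bad
    (∀ (p : ℕ) [Fact p.Prime] (ι : QBar →+* PadicAlgCl p),
      IsBadPrime.{w₁, w₂} p ι (RepPGL₂ QBar)) := by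
  have hp : ∀ (p : ℕ) [Fact p.Prime] (ι : QBar →+* PadicAlgCl p),
      IsBadPrime.{w₁, w₂} p ι (RepPGL₂ QBar) := by
    intro p _ ι
    rcases eq_or_ne p 2 with rfl | h
    · exact isBadPrime_two ι
    · exact isBadPrime_of_ne_two h ι
  refine ⟨isSemisimpleTensorCategory_repPGL₂,
    ⟨formRep QBar, simple_formRep, repDim_formRep, fun S _ => exists_iso_formRep S⟩, ?_,
    finrank_hom_tensor_adjointRep, finrank_hom_tensor_adjointRep_unit,
    nonempty_exactPairing_adjointRep, ?_, fun _ => three_halves_not_integral, hp⟩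
  · intro p hp hp2
    obtain ⟨j, hj⟩ := hp.odd_of_ne_two hp2
    exact ⟨formRep QBar j, simple_formRep j, by rw [repDim_formRep, hj]⟩
  · intro _
    refine ⟨fun m hm => ?_, exists_dualMul_comp_eq_id, fun m hm => ?_⟩
    · obtain ⟨u, h0, -, -, h2, h4⟩ := amplitude_adjointRep (m := m)
      rw [h2, h4]
      constructor
      · intro h
        have h3 : 3 * u = 0 := smul_id_unit_injective (by rw [h, zero_smul])
        exact hm (h0.1 ((mul_eq_zero.1 h3).resolve_left three_ne_zero))
      -- With `A(T₂) = 3u` and `A(T₄) = 3u²/2`, the ratio `A(T₄) / A(T₂)²` is `1/6` for every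
      -- scaling.
      · rw [Linear.smul_comp, Linear.comp_smul, Category.comp_id, smul_smul, smul_smul]
        congr 1
        ring
    · obtain ⟨u, -, h1, -, h2, h4⟩ := amplitude_adjointRep (m := m)
      have hu : u = 1 := eq_of_smul_hom_eq id_adjointRep_ne_zero (by rw [← h1, hm, one_smul])
      rw [h2, h4, hu]
      norm_num
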